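/- Let $V=\bigoplus_{n\ge 0}V_n$ be a rational vertex operator algebra over $\mathbb C$ with conformal vector $\omega$, central charge $c$ and $Y(\omega,z)=\sum_n L(n)z^{-n-2}$. A $V$-module is understood to be a direct sum of finite-dimensional $L(0)$-eigenspaces whose weights are bounded below in each class modulo $\mathbb Z$; rational means that there are only finitely many irreducible $V$-modules up to isomorphism and that every $V$-module is a direct sum of irreducible ones. Let $U$ be an irreducible $V$-module spanned by the vectors $L(-n_1)\cdots L(-n_t)u$ ($t\ge 0$, all $n_i>0$) with $u\in U$ such that $L(n)u=0$ for all $n>0$. For homogeneous $a\in V$ and $m\in\mathbb Z$ let $a[m]$ be the modes of $Y[a,z]=Y(a,e^z-1)e^{z\,\mathrm{wt}(a)}=\sum_m a[m]z^{-m-1}$, i.e. $a[m]=\mathrm{Res}_z\,Y(a,z)(\log(1+z))^m(1+z)^{\mathrm{wt}(a)-1}$, and extend linearly in $a$. Let $C_{[2,0]}(U)$ be the linear span of all $a[-2]u$ and $a[0]u$ with $a\in V$, $u\in U$. Assume that $U$ satisfies condition $C_{[2,0]}$, that is, $\dim U/C_{[2,0]}(U)<\infty$. Let $W$ be a $V$-module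 and let $I(u,z)=\sum_{r\in\mathbb C}u(r)z^{-r-1}$ be an intertwining operator of type $\binom{W}{U\ W}$. Put $o^I(u)=u(\mathrm{wt}(u)-1)$ for homogeneous $u\in U$, extended linearly to all of $U$; it preserves each weight space $W_\mu$ ($\mu\in\mathbb C$). Then for every $u\in U$ the trace function $$S^I(u,\tau)=\mathrm{tr}|_W\,o^I(u)q^{L(0)-c/24}=\sum_{\mu\in\mathbb C}\mathrm{tr}\bigl(o^I(u)|_{W_\mu}\bigr)\,e^{2\pi i\tau(\mu-c/24)}$$ converges absolutely for every $\tau$ in the upper half-plane and is holomorphic in $\tau$ there. -/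

import Mathlib

universe u

namespace Vertex

noncomputable section

section Modes

variable {V M : Type*} [AddCommGroup V] [Module ℂ V] [AddCommGroup M] [Module ℂ M]

/-- The mode `a(n)` of `Y(a, z) = ∑ a(n) z ^ (-n - 1)`. Truncation (`a(n) x = 0` for `n` large)
is part of Mathlib's notion of a vertex operator. -/
def mode (Y : V →ₗ[ℂ] VertexOperator ℂ M) (a : V) (n : ℤ) : Module.End ℂ M :=
  VertexOperator.ncoeff (Y a) n

/-- `L(n)`, where `Y(ω, z) = ∑ L(n) z ^ (-n - 2)`. -/
def vir (Y : V →ₗ[ℂ] VertexOperator ℂ M) (ω : V) (n : ℤ) : Module.End ℂ M :=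
  mode Y ω (n + 1)

/-- The operators `L(n)` satisfy the Virasoro relations with central charge `c`. -/
def VirasoroRelations (L : ℤ → Module.End ℂ M) (c : ℂ) : Prop :=
  ∀ m n : ℤ, L m * L n - L n * L m =
    ((m : ℂ) - n) • L (m + n) +
      (if m + n = 0 then ((m : ℂ) ^ 3 - m) / 12 * c else 0) • (1 : Module.End ℂ M)

/-- `Y(1, z) = id`. -/
def VacuumActsAsIdentity (Y : V →ₗ[ℂ] VertexOperator ℂ M) (vac : V) : Prop :=
  ∀ n : ℤ, mode Y vac n = if n = -1 then 1 else 0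

/-- `Y(L(-1) v, z) = d/dz Y(v, z)`, where `D` is the operator `L(-1)` of `V`. -/
def DerivativeProperty (Y : V →ₗ[ℂ] VertexOperator ℂ M) (D : Module.End ℂ V) : Prop :=
  ∀ (v : V) (n : ℤ), mode Y (D v) n = (-(n : ℂ)) • mode Y v (n - 1)

/-- `(z - w) ^ N [Y(v, z), Y(u, w)] = 0` for `N` large: coefficient of
`z ^ (-m - 1) w ^ (-n - 1)`. -/
def Commutativity (Y : V →ₗ[ℂ] VertexOperator ℂ M) : Prop :=
  ∀ v u : V, ∃ N : ℕ, ∀ m n : ℤ,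
    ∑ i ∈ Finset.range (N + 1), ((-1 : ℂ) ^ i * (N.choose i : ℂ)) •
      (mode Y v (m + N - i) * mode Y u (n + i) - mode Y u (n + i) * mode Y v (m + N - i)) = 0

/-- The weight space of weight `μ` : the `μ`-eigenspace of `L(0)`. -/
def weightSpace (Y : V →ₗ[ℂ] VertexOperator ℂ M) (ω : V) (μ : ℂ) : Submodule ℂ M :=
  (vir Y ω 0).eigenspace μ

/-- The component of degree `i` of a vector, for an internal direct sum decomposition. -/
def component {ι : Type*} [DecidableEq ι] (A : ι → Submodule ℂ M) (h : DirectSum.IsInternal A)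
    (i : ι) : M →ₗ[ℂ] A i :=
  DirectSum.component ℂ ι (fun j => A j) i ∘ₗ
    (LinearEquiv.ofBijective (DirectSum.coeLinearMap A) h).symm.toLinearMap

end Modes

/-- A vertex operator algebra over `ℂ`, graded by the integral eigenvalues of `L(0)`. -/
structure VOA (V : Type*) [AddCommGroup V] [Module ℂ V] where
  Y : V →ₗ[ℂ] VertexOperator ℂ V
  vac : V
  omega : V
  c : ℂ
  vac_weight : vac ∈ weightSpace Y omega 0
  omega_weight : omega ∈ weightSpace Y omega 2
  vacuum : VacuumActsAsIdentity Y vac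
  /-- `Y(v, z) 1 = v + ∑_{n ≥ 2} v(-n) 1 z ^ (n - 1)`. -/
  creation : ∀ v : V, mode Y v (-1) vac = v ∧ ∀ n : ℤ, 0 ≤ n → mode Y v n vac = 0
  virasoro : VirasoroRelations (vir Y omega) c
  derivative : DerivativeProperty Y (vir Y omega (-1))
  commutativity : Commutativity Y
  grading : DirectSum.IsInternal (fun n : ℤ => weightSpace Y omega (n : ℂ))
  finite : ∀ n : ℤ, FiniteDimensional ℂ (weightSpace Y omega (n : ℂ))
  bounded_below : ∃ N : ℤ, ∀ n : ℤ, n < N → weightSpace Y omega (n : ℂ) = ⊥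

/-- A (left) module for a vertex operator algebra: it is the direct sum of its finite dimensional
`L(0)`-eigenspaces, and in every class of weights modulo `ℤ` the weights are bounded below. -/
structure VOAModule {V : Type*} [AddCommGroup V] [Module ℂ V] (𝒱 : VOA V)
    (M : Type*) [AddCommGroup M] [Module ℂ M] where
  Y : V →ₗ[ℂ] VertexOperator ℂ M
  vacuum : VacuumActsAsIdentity Y 𝒱.vac
  virasoro : VirasoroRelations (vir Y 𝒱.omega) 𝒱.c
  derivative : DerivativeProperty Y (vir 𝒱.Y 𝒱.omega (-1))
  commutativity : Commutativity Y
  /-- `Y(u(n) v, z) = Res_w ((w - z) ^ n Y(u, w) Y(v, z) - (-z + w) ^ n Y(v, z) Y(u, w))`: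
  coefficient of `z ^ (-r - 1)`. The sum is finite on every vector. -/
  associativity : ∀ (u v : V) (n r : ℤ) (x : M),
    mode Y (mode 𝒱.Y u n v) r x =
      ∑ᶠ i : ℕ, ((-1 : ℂ) ^ i * (Ring.choose n i : ℤ)) •
        (mode Y u (n - i) (mode Y v (r + i) x)
          - ((-1 : ℂ) ^ n) • mode Y v (n + r - i) (mode Y u i x))
  grading : DirectSum.IsInternal (fun μ : ℂ => weightSpace Y 𝒱.omega μ)
  finite : ∀ μ : ℂ, FiniteDimensional ℂ (weightSpace Y 𝒱.omega μ)
  bounded_below : ∀ μ : ℂ, ∃ N : ℕ, ∀ n : ℕ, N ≤ n → weightSpace Y 𝒱.omega (μ - n) = ⊥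

section Rationality

variable {V : Type*} [AddCommGroup V] [Module ℂ V] {𝒱 : VOA V}

/-- A subspace of a module that is stable under all modes `a(n)`. -/
def VOAModule.IsInvariant {M : Type*} [AddCommGroup M] [Module ℂ M] (X : VOAModule 𝒱 M)
    (N : Submodule ℂ M) : Prop :=
  ∀ (a : V) (n : ℤ), ∀ x ∈ N, mode X.Y a n x ∈ N

/-- An irreducible submodule. -/
def VOAModule.IsIrreducibleSub {M : Type*} [AddCommGroup M] [Module ℂ M] (X : VOAModule 𝒱 M)
    (N : Submodule ℂ M) : Prop :=
  X.IsInvariant N ∧ N ≠ ⊥ ∧ ∀ N' : Submodule ℂ M, X.IsInvariant N' → N' ≤ N → N' = ⊥ ∨ N' = N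

/-- An irreducible module. -/
def VOAModule.IsIrreducible {M : Type*} [AddCommGroup M] [Module ℂ M]
    (X : VOAModule 𝒱 M) : Prop :=
  X.IsIrreducibleSub ⊤

/-- A completely reducible module: a direct sum of irreducible submodules. -/
def VOAModule.IsCompletelyReducible {M : Type u} [AddCommGroup M] [Module ℂ M]
    (X : VOAModule 𝒱 M) : Prop :=
  ∃ (ι : Type u) (N : ι → Submodule ℂ M),
    (∀ i, X.IsIrreducibleSub (N i)) ∧ iSupIndep N ∧ ⨆ i, N i = ⊤

/-- Isomorphic modules. -/
def VOAModule.IsIsomorphic {M N : Type*} [AddCommGroup M] [Module ℂ M] [AddCommGroup N]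
    [Module ℂ N] (X : VOAModule 𝒱 M) (X' : VOAModule 𝒱 N) : Prop :=
  ∃ f : M ≃ₗ[ℂ] N, ∀ (a : V) (n : ℤ) (x : M), f (mode X.Y a n x) = mode X'.Y a n (f x)

end Rationality

/-- A module together with its underlying space. -/
structure BundledModule {V : Type u} [AddCommGroup V] [Module ℂ V] (𝒱 : VOA V) where
  carrier : Type u
  [group : AddCommGroup carrier]
  [module : Module ℂ carrier]
  str : VOAModule 𝒱 carrier

attribute [instance] BundledModule.group BundledModule.module

/-- Rationality: up to isomorphism there are only finitely many irreducible modules, and all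
modules are completely reducible. -/
def VOA.IsRational {V : Type u} [AddCommGroup V] [Module ℂ V] (𝒱 : VOA V) : Prop :=
  (∃ (k : ℕ) (F : Fin k → BundledModule 𝒱), (∀ i, (F i).str.IsIrreducible) ∧
    ∀ X : BundledModule 𝒱, X.str.IsIrreducible → ∃ i, X.str.IsIsomorphic (F i).str) ∧
  ∀ X : BundledModule 𝒱, X.str.IsCompletelyReducible

section Modules

variable {V U : Type*} [AddCommGroup V] [Module ℂ V] [AddCommGroup U] [Module ℂ U]
  {𝒱 : VOA V}

/-- `U` is spanned by the vectors `L(-n₁) ⋯ L(-n_t) u` (`t ≥ 0`, all `n_i > 0`), where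
`L(n) u = 0` for all `n > 0`. -/
def VOAModule.IsSpannedByDescendants (X : VOAModule 𝒱 U) : Prop :=
  Submodule.span ℂ {x : U | ∃ (ns : List ℤ) (u : U), (∀ n ∈ ns, 0 < n) ∧
    (∀ n : ℤ, 0 < n → vir X.Y 𝒱.omega n u = 0) ∧
    x = (ns.map fun n => vir X.Y 𝒱.omega (-n)).prod u} = ⊤

/-- The coefficient of `z ^ i` in `(log (1 + z)) ^ m (1 + z) ^ (h - 1)`. -/
def squareCoeff (h m i : ℤ) : ℂ :=
  (((PowerSeries.log ℂ : PowerSeries ℂ) : LaurentSeries ℂ) ^ m *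
    (((1 + PowerSeries.X : PowerSeries ℂ)) : LaurentSeries ℂ) ^ (h - 1)).coeff i

/-- The mode `a[m]` of `Y[a, z] = Y(a, e ^ z - 1) e ^ (z wt a) = ∑ a[m] z ^ (-m - 1)`, that is
`a[m] x = Res_z Y(a, z) x (log (1 + z)) ^ m (1 + z) ^ (wt a - 1)` for homogeneous `a`, extended
linearly to all `a`. Both sums are finite on every vector. -/
def VOAModule.squareMode (X : VOAModule 𝒱 U) (a : V) (m : ℤ) (x : U) : U :=
  ∑ᶠ h : ℤ, ∑ᶠ i : ℤ, squareCoeff h m i • mode X.Y (component _ 𝒱.grading h a : V) i x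

/-- The subspace `C_{[2,0]}(U)` spanned by all `a[-2] u` and `a[0] u`. -/
def VOAModule.C20 (X : VOAModule 𝒱 U) : Submodule ℂ U :=
  Submodule.span ℂ {x : U | ∃ (a : V) (u : U), x = X.squareMode a (-2) u ∨ x = X.squareMode a 0 u}

/-- Condition `C_{[2,0]}`. -/
def VOAModule.SatisfiesC20 (X : VOAModule 𝒱 U) : Prop :=
  FiniteDimensional ℂ (U ⧸ X.C20)

end Modules

section Intertwining

variable {V W₁ W₂ W₃ : Type*} [AddCommGroup V] [Module ℂ V] [AddCommGroup W₁] [Module ℂ W₁]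
  [AddCommGroup W₂] [Module ℂ W₂] [AddCommGroup W₃] [Module ℂ W₃] {𝒱 : VOA V}

/-- An intertwining operator of type `(W₃; W₁ W₂)`: `I(w, z) = ∑_{r ∈ ℂ} w(r) z ^ (-r - 1)`,
where `coeff r w` is `w(r)`. -/
structure IntertwiningOperator (X₁ : VOAModule 𝒱 W₁) (X₂ : VOAModule 𝒱 W₂)
    (X₃ : VOAModule 𝒱 W₃) where
  coeff : ℂ → W₁ →ₗ[ℂ] W₂ →ₗ[ℂ] W₃
  truncation : ∀ (w : W₁) (x : W₂) (r : ℂ), ∃ N : ℕ, ∀ n : ℕ, N ≤ n → coeff (r + n) w x = 0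
  derivative : ∀ (w : W₁) (r : ℂ),
    coeff r (vir X₁.Y 𝒱.omega (-1) w) = (-r) • coeff (r - 1) w
  /-- `(z - w) ^ N (Y(v, z) I(u, w) - I(u, w) Y(v, z)) = 0` for `N` large. -/
  commutativity : ∀ (v : V) (u : W₁), ∃ N : ℕ, ∀ (m : ℤ) (r : ℂ) (x : W₂),
    ∑ i ∈ Finset.range (N + 1), ((-1 : ℂ) ^ i * (N.choose i : ℂ)) •
      (mode X₃.Y v (m + N - i) (coeff (r + i) u x)
        - coeff (r + i) u (mode X₂.Y v (m + N - i) x)) = 0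
  /-- `I(v(n) u, z) = Res_w ((w - z) ^ n Y(v, w) I(u, z) - (-z + w) ^ n I(u, z) Y(v, w))`. -/
  associativity : ∀ (v : V) (u : W₁) (n : ℤ) (r : ℂ) (x : W₂),
    coeff r (mode X₁.Y v n u) x =
      ∑ᶠ i : ℕ, ((-1 : ℂ) ^ i * (Ring.choose n i : ℤ)) •
        (mode X₃.Y v (n - i) (coeff (r + i) u x)
          - ((-1 : ℂ) ^ n) • coeff (n + r - i) u (mode X₂.Y v i x))

end Intertwining

section Trace

variable {V U W : Type*} [AddCommGroup V] [Module ℂ V] [AddCommGroup U] [Module ℂ U]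
  [AddCommGroup W] [Module ℂ W] {𝒱 : VOA V} {XU : VOAModule 𝒱 U} {XW : VOAModule 𝒱 W}

/-- The grade-preserving operator `o(u)`: it is `u(wt u - 1)` for homogeneous `u`, extended
linearly to all `u`. -/
def IntertwiningOperator.zeroMode (I : IntertwiningOperator XU XW XW) (u : U) :
    Module.End ℂ W :=
  ∑ᶠ μ : ℂ, I.coeff (μ - 1) (component _ XU.grading μ u : U)

/-- The trace of `o(u)` on the weight space `W_μ`. -/
def IntertwiningOperator.weightTrace (I : IntertwiningOperator XU XW XW) (u : U) (μ : ℂ) : ℂ :=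
  LinearMap.trace ℂ (weightSpace XW.Y 𝒱.omega μ)
    (component _ XW.grading μ ∘ₗ I.zeroMode u ∘ₗ (weightSpace XW.Y 𝒱.omega μ).subtype)

/-- The contribution `tr_{W_μ} o(u) q ^ (μ - c / 24)` of `W_μ` to the trace function, where
`q ^ s = exp (2 π i s τ)`. -/
def IntertwiningOperator.traceTerm (I : IntertwiningOperator XU XW XW) (u : U) (τ μ : ℂ) : ℂ :=
  I.weightTrace u μ * Complex.exp (2 * Real.pi * Complex.I * (μ - 𝒱.c / 24) * τ)

/-- The trace function `S(u, τ) = tr_W o(u) q ^ (L(0) - c / 24)`. -/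
def IntertwiningOperator.traceFunction (I : IntertwiningOperator XU XW XW) (u : U) (τ : ℂ) : ℂ :=
  ∑' μ : ℂ, I.traceTerm u τ μ

end Trace

end

end Vertex

/-! The weights of `W` lie in finitely many classes modulo `ℤ`: by rationality `W` is a sum of
irreducible modules, each with weights in a single class, and there are finitely many isomorphism
types (`VOA.IsRational.exists_finset_weights`). On a class with lower bound `s` the trace function
is `q ^ (s - c / 24)` times the power series `traceSeries s u`, so it suffices that this series
converges for `|q| < 1`, that is, lies in the ring `discSeries`.

This follows from a differential equation. Expanding `o(a(e) u)` by associativity gives traces of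
products of a mode of `a` and a mode of `u`. Cyclicity of the trace reproduces such a trace up to a
factor `q ^ p`, while the commutator formula measures the failure to commute; solving for the trace
gives a factor `q ^ p / (1 - q ^ p)`. Summing over `p` gives Zhu's recursion with Lambert series as
coefficients, and these lie in `discSeries`. No modularity of the coefficients is needed. There are
three consequences, in which `S` denotes `traceSeries s`. First, `S(a[0] u) = 0`. Second, `S(a[-2]
u)` is a `discSeries`-combination of the `S(a[m] u)` with `m ≥ 1`
(`traceSeries_logSeries_neg_two_mem`). Third, with `a = ω`, the operator `q d/dq + s` preserves the
`discSeries`-span of all trace series (`eulerOp_traceSeries_mem`).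

The operator `L[0]` is diagonalizable on `U`, and `a[m] u` with `m ≥ 1` has lower `L[0]`-weight than
`a[-2] u`. Induction on this weight, together with `C_{[2,0]}`, shows that finitely many trace
series generate all of them over `discSeries` (`exists_finite_generators`). The generators therefore
satisfy a first order linear system with a regular singular point at `q = 0` and coefficients
convergent in the disc, and every formal solution of such a system converges there
(`mem_discSeries_of_system`). -/

namespace Vertex

/-! ### Power series convergent in the unit disc, Lambert series, and regular singular systems. -/

section Growth

/-- A sequence of complex numbers grows subexponentially: `∑ c n q ^ n` converges for `|q| < 1`. -/
def SubexpGrowth (c : ℕ → ℂ) : Prop :=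
  ∀ r : ℝ, 0 < r → r < 1 → ∃ C : ℝ, ∀ n, ‖c n‖ * r ^ n ≤ C

lemma SubexpGrowth.add {c d : ℕ → ℂ} (hc : SubexpGrowth c) (hd : SubexpGrowth d) :
    SubexpGrowth (fun n => c n + d n) := by
  intro r h0 h1
  obtain ⟨C, hC⟩ := hc r h0 h1
  obtain ⟨D, hD⟩ := hd r h0 h1
  refine ⟨C + D, fun n => ?_⟩
  have h2 : 0 ≤ r ^ n := by positivity
  calc ‖c n + d n‖ * r ^ n ≤ (‖c n‖ + ‖d n‖) * r ^ n := by gcongr; exact norm_add_le _ _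
    _ ≤ C + D := by linarith [hC n, hD n]

lemma exists_succ_mul_pow_le {x : ℝ} (h0 : 0 ≤ x) (h1 : x < 1) :
    ∃ C : ℝ, ∀ n : ℕ, ((n : ℝ) + 1) * x ^ n ≤ C := by
  have h := tendsto_self_mul_const_pow_of_lt_one h0 h1
  obtain ⟨C, hC⟩ := h.bddAbove_range
  refine ⟨C + 1, fun n => ?_⟩
  have h2 : (n : ℝ) * x ^ n ≤ C := hC ⟨n, rfl⟩
  have h3 : x ^ n ≤ 1 := pow_le_one₀ h0 h1.le
  linarith

/-- Each factor is estimated at radius `√r`, since `r ^ n = √r ^ n * √r ^ n`. -/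
lemma SubexpGrowth.mul {c d : ℕ → ℂ} (hc : SubexpGrowth c) (hd : SubexpGrowth d) :
    SubexpGrowth (fun n => c n * d n) := by
  intro r h0 h1
  have hs0 : 0 < √r := Real.sqrt_pos.2 h0
  have hs1 : √r < 1 := by rw [Real.sqrt_lt' one_pos]; simpa using h1
  obtain ⟨C, hC⟩ := hc (√r) hs0 hs1
  obtain ⟨D, hD⟩ := hd (√r) hs0 hs1
  refine ⟨C * D, fun n => ?_⟩
  have h2 : r ^ n = √r ^ n * √r ^ n := by rw [← mul_pow, Real.mul_self_sqrt h0.le]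
  have h3 : 0 ≤ ‖c n‖ * √r ^ n := by positivity
  calc ‖c n * d n‖ * r ^ n = (‖c n‖ * √r ^ n) * (‖d n‖ * √r ^ n) := by
        rw [norm_mul, h2]; ring
    _ ≤ C * D := mul_le_mul (hC n) (hD n) (by positivity) (h3.trans (hC n))

lemma SubexpGrowth.const (a : ℂ) : SubexpGrowth (fun _ => a) := by
  intro r h0 h1
  refine ⟨‖a‖, fun n => ?_⟩
  exact mul_le_of_le_one_right (norm_nonneg _) (pow_le_one₀ h0.le h1.le)

lemma SubexpGrowth.natCast : SubexpGrowth (fun n => (n : ℂ)) := by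
  intro r h0 h1
  obtain ⟨C, hC⟩ := exists_succ_mul_pow_le h0.le h1
  refine ⟨C, fun n => le_trans ?_ (hC n)⟩
  have : 0 ≤ r ^ n := by positivity
  rw [Complex.norm_natCast]
  linarith

/-- A binomial coefficient is a polynomial in its upper entry, built up one linear factor at a time.
-/
lemma SubexpGrowth.choose {z : ℕ → ℤ} (hz : SubexpGrowth (fun n => (z n : ℂ))) (j : ℕ) :
    SubexpGrowth (fun n => ((Ring.choose (z n) j : ℤ) : ℂ)) := by
  induction j with
  | zero => simpa using SubexpGrowth.const 1
  | succ j ih =>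
    have h : (fun n => ((Ring.choose (z n) (j + 1) : ℤ) : ℂ)) = fun n =>
        ((j : ℂ) + 1)⁻¹ * (((z n : ℂ) + (-(j : ℂ))) * ((Ring.choose (z n) j : ℤ) : ℂ)) := by
      funext n
      have h1 : ((j : ℤ) + 1) * Ring.choose (z n) (j + 1) = (z n - j) * Ring.choose (z n) j := by
        have e1 := Ring.descPochhammer_eq_factorial_smul_choose (z n) (j + 1)
        have e2 := Ring.descPochhammer_eq_factorial_smul_choose (z n) j
        rw [descPochhammer_succ_right, Polynomial.smeval_mul, e2] at e1
        have e3 : (Nat.factorial j : ℤ) ≠ 0 := by positivity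
        apply mul_left_cancel₀ e3
        simp [Nat.factorial_succ, Polynomial.smeval_sub, Polynomial.smeval_X,
          Polynomial.smeval_natCast] at e1
        linear_combination -e1
      have h2 : ((j : ℂ) + 1) ≠ 0 := by exact_mod_cast Nat.succ_ne_zero j
      have h3 : ((j : ℂ) + 1) * (Ring.choose (z n) (j + 1) : ℤ)
          = (z n - j) * (Ring.choose (z n) j : ℤ) := by exact_mod_cast h1
      rw [eq_inv_mul_iff_mul_eq₀ h2, h3]
      ring
    rw [h]
    exact (SubexpGrowth.const _).mul ((hz.add (SubexpGrowth.const _)).mul ih)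

/-- The factors are bounded at a radius `s` with `r < s < 1`; the `n + 1` terms of the convolution
are absorbed by `(r / s) ^ n`. -/
lemma SubexpGrowth.convolution {c d : ℕ → ℂ} (hc : SubexpGrowth c) (hd : SubexpGrowth d) :
    SubexpGrowth (fun n => ∑ p ∈ Finset.HasAntidiagonal.antidiagonal n, c p.1 * d p.2) := by
  intro r h0 h1
  obtain ⟨s, hrs, hs1⟩ := exists_between h1
  have hs0 : 0 < s := h0.trans hrs
  obtain ⟨C, hC⟩ := hc s hs0 hs1
  obtain ⟨D, hD⟩ := hd s hs0 hs1
  obtain ⟨E, hE⟩ := exists_succ_mul_pow_le (x := r / s) (by positivity) ((div_lt_one hs0).2 hrs)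
  have hC0 : 0 ≤ C := le_trans (by positivity) (hC 0)
  have hD0 : 0 ≤ D := le_trans (by positivity) (hD 0)
  refine ⟨C * D * E, fun n => ?_⟩
  calc ‖∑ p ∈ Finset.HasAntidiagonal.antidiagonal n, c p.1 * d p.2‖ * r ^ n
      ≤ (∑ p ∈ Finset.HasAntidiagonal.antidiagonal n, ‖c p.1 * d p.2‖) * r ^ n := by
        gcongr; exact norm_sum_le _ _
    _ = ∑ p ∈ Finset.HasAntidiagonal.antidiagonal n, (‖c p.1‖ * s ^ p.1) * (‖d p.2‖ * s ^ p.2) * (r / s) ^ n := by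
        rw [Finset.sum_mul]
        refine Finset.sum_congr rfl fun p hp => ?_
        rw [← Finset.HasAntidiagonal.mem_antidiagonal.1 hp, norm_mul, div_pow, pow_add s]
        field_simp
    _ ≤ ∑ p ∈ Finset.HasAntidiagonal.antidiagonal n, C * D * (r / s) ^ n := by
        gcongr with p hp
        · exact hC _
        · exact hD _
    _ = C * D * (((n : ℝ) + 1) * (r / s) ^ n) := by simp; ring
    _ ≤ C * D * E := by gcongr; exact hE n

lemma SubexpGrowth.sum_divisors {c : ℕ → ℂ} (hc : SubexpGrowth c) :
    SubexpGrowth (fun n => ∑ d ∈ n.divisors, c d) := by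
  intro r h0 h1
  obtain ⟨s, hrs, hs1⟩ := exists_between h1
  have hs0 : 0 < s := h0.trans hrs
  obtain ⟨C, hC⟩ := hc s hs0 hs1
  have hC0 : 0 ≤ C := le_trans (by positivity) (hC 0)
  obtain ⟨E, hE⟩ := exists_succ_mul_pow_le (x := r / s) (by positivity) ((div_lt_one hs0).2 hrs)
  refine ⟨C * E, fun n => ?_⟩
  have h2 : ∀ d ∈ n.divisors, ‖c d‖ ≤ C * s⁻¹ ^ n := by
    intro d hd
    have h3 : d ≤ n := Nat.divisor_le hd
    have h4 := hC d
    rw [← le_div_iff₀ (by positivity)] at h4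
    refine h4.trans ?_
    rw [div_eq_mul_inv, ← inv_pow]
    gcongr
    exact (one_le_inv₀ hs0).2 hs1.le
  calc ‖∑ d ∈ n.divisors, c d‖ * r ^ n ≤ (∑ d ∈ n.divisors, ‖c d‖) * r ^ n := by
        gcongr; exact norm_sum_le _ _
    _ ≤ (∑ d ∈ n.divisors, C * s⁻¹ ^ n) * r ^ n := by
        gcongr with d hd; exact h2 d hd
    _ = n.divisors.card * (C * s⁻¹ ^ n) * r ^ n := by simp
    _ ≤ ((n : ℝ) + 1) * (C * s⁻¹ ^ n) * r ^ n := by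
        gcongr
        have := Nat.card_divisors_le_self n
        have : (n.divisors.card : ℝ) ≤ n := by exact_mod_cast this
        linarith
    _ = C * (((n : ℝ) + 1) * (r / s) ^ n) := by rw [div_pow, inv_pow]; ring
    _ ≤ C * E := by gcongr; exact hE n

/-- The power series that converge in the unit disc. -/
noncomputable def discSeries : Subalgebra ℂ (PowerSeries ℂ) where
  carrier := {f | SubexpGrowth (fun n => PowerSeries.coeff n f)}
  mul_mem' {f g} hf hg := by
    simpa [PowerSeries.coeff_mul] using SubexpGrowth.convolution hf hg
  add_mem' {f g} hf hg := by
    simpa using SubexpGrowth.add hf hg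
  algebraMap_mem' a := by
    intro r h0 h1
    refine ⟨‖a‖, fun n => ?_⟩
    simp only [PowerSeries.algebraMap_apply, Algebra.algebraMap_self, RingHom.id_apply,
      PowerSeries.coeff_C]
    split_ifs with h
    · simp [h]
    · simp

lemma mem_discSeries {f : PowerSeries ℂ} :
    f ∈ discSeries ↔ SubexpGrowth (fun n => PowerSeries.coeff n f) := Iff.rfl

/-- `∑ c p q ^ p / (1 - q ^ p)`. -/
noncomputable def lambert (c : ℕ → ℂ) : PowerSeries ℂ :=
  PowerSeries.mk fun n => ∑ d ∈ n.divisors, c d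

lemma lambert_mem {c : ℕ → ℂ} (hc : SubexpGrowth c) : lambert c ∈ discSeries := by
  simpa [lambert, mem_discSeries] using hc.sum_divisors

/-- The operator `q d/dq + s`. -/
noncomputable def eulerOp (s : ℂ) (f : PowerSeries ℂ) : PowerSeries ℂ :=
  PowerSeries.mk fun n => (s + n) * PowerSeries.coeff n f

/-- A nonnegative sequence bounded by a convolution with a geometric sequence, up to a factor that
tends to infinity, is bounded. -/
lemma bounded_of_convolution_bound (s : ℂ) {b : ℕ → ℝ} (hb0 : ∀ n, 0 ≤ b n) {x K : ℝ}
    (hx0 : 0 ≤ x) (hx1 : x < 1) (hK0 : 0 ≤ K)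
    (key : ∀ n : ℕ, ‖s + n‖ * b n ≤
      K * ∑ p ∈ Finset.HasAntidiagonal.antidiagonal n, x ^ p.1 * b p.2) :
    ∃ M, ∀ n, b n ≤ M := by
  -- Suppose `b n` with `n > N` were the first value above the maximum of the initial segment. Then
  -- all earlier values are below `b n`, so the geometric series bounds the convolution by `b n / (1
  -- - x)`. This forces `‖s + n‖ ≤ K / (1 - x)`, which the choice of `N` excludes.
  obtain ⟨N, hN⟩ := exists_nat_gt (‖s‖ + K / (1 - x))
  set M := ∑ k ∈ Finset.range (N + 1), b k with hM
  have hM0 : 0 ≤ M := Finset.sum_nonneg fun k _ => hb0 k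
  have bound : ∀ n, b n ≤ M := by
    intro n
    induction n using Nat.strong_induction_on with
    | _ n ih =>
      by_cases hn : n ≤ N
      · exact Finset.single_le_sum (f := b) (fun k _ => hb0 k)
          (Finset.mem_range.2 (Nat.lt_succ_of_le hn))
      by_contra hlt
      push Not at hlt hn
      have hbn : 0 < b n := hM0.trans_lt hlt
      have h4 : ∑ p ∈ Finset.HasAntidiagonal.antidiagonal n, x ^ p.1 * b p.2 ≤ (1 - x)⁻¹ * b n := by
        calc _ ≤ ∑ p ∈ Finset.HasAntidiagonal.antidiagonal n, x ^ p.1 * b n := by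
              refine Finset.sum_le_sum fun p hp => ?_
              have h5 : p.2 ≤ n := by have := Finset.HasAntidiagonal.mem_antidiagonal.1 hp; omega
              gcongr
              rcases h5.lt_or_eq with h6 | h6
              · exact (ih _ h6).trans hlt.le
              · rw [h6]
          _ = (∑ k ∈ Finset.range (n + 1), x ^ k) * b n := by
              rw [Finset.sum_mul, Finset.Nat.sum_antidiagonal_eq_sum_range_succ_mk]
          _ ≤ (1 - x)⁻¹ * b n := by
              gcongr
              rw [← tsum_geometric_of_lt_one hx0 hx1]
              exact (summable_geometric_of_lt_one hx0 hx1).sum_le_tsum _ fun k _ => by positivity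
      have h7 : ‖s + n‖ * b n ≤ K / (1 - x) * b n := by
        refine (key n).trans ?_
        rw [div_eq_mul_inv, mul_assoc]
        gcongr
      have h8 : ‖s + n‖ ≤ K / (1 - x) := le_of_mul_le_mul_right h7 hbn
      have h9 : (n : ℝ) - ‖s‖ ≤ ‖s + n‖ := by
        have := norm_sub_le (s + n) s
        rw [add_sub_cancel_left, Complex.norm_natCast] at this
        linarith
      have h10 : (N : ℝ) < n := by exact_mod_cast hn
      linarith
  exact ⟨M, bound⟩

/-- Formal solutions of a first order linear system with a regular singular point at `0` and
coefficients that converge in the unit disc converge in the unit disc. -/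
lemma mem_discSeries_of_system {ι : Type*} [Fintype ι] (s : ℂ) (f : ι → PowerSeries ℂ)
    (H : ι → ι → PowerSeries ℂ) (hH : ∀ i j, H i j ∈ discSeries)
    (hf : ∀ i, eulerOp s (f i) = ∑ j, H i j * f j) (i : ι) : f i ∈ discSeries := by
  rw [mem_discSeries]
  intro r h0 h1
  -- The coefficients of `H` are bounded at the larger radius `ρ`; comparison with radius `r`
  -- supplies the geometric weight `x = r / ρ < 1` in the convolution bound.
  obtain ⟨ρ, hrρ, hρ1⟩ := exists_between h1
  have hρ0 : 0 < ρ := h0.trans hrρ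
  choose C hC using fun i j => hH i j ρ hρ0 hρ1
  have hC0 : ∀ i j, 0 ≤ C i j := fun i j => le_trans (by positivity) (hC i j 0)
  set D := ∑ i, ∑ j, C i j
  have hD : ∀ i j, C i j ≤ D := fun i j =>
    (Finset.single_le_sum (f := fun j => C i j) (fun j _ => hC0 i j) (Finset.mem_univ j)).trans
      (Finset.single_le_sum (f := fun i => ∑ j, C i j)
        (fun i _ => Finset.sum_nonneg fun j _ => hC0 i j) (Finset.mem_univ i))
  have hD0 : 0 ≤ D := Finset.sum_nonneg fun i _ => Finset.sum_nonneg fun j _ => hC0 i j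
  set b : ℕ → ℝ := fun n => ∑ i, ‖PowerSeries.coeff n (f i)‖ * r ^ n with hb
  have hb0 : ∀ n, 0 ≤ b n := fun n => Finset.sum_nonneg fun i _ => by positivity
  set x := r / ρ with hx
  have hx0 : 0 ≤ x := by positivity
  have hx1 : x < 1 := (div_lt_one hρ0).2 hrρ
  set K := (Fintype.card ι : ℝ) * D with hK
  have hK0 : 0 ≤ K := by positivity
  have key : ∀ n : ℕ, ‖s + n‖ * b n ≤ K * ∑ p ∈ Finset.HasAntidiagonal.antidiagonal n, x ^ p.1 * b p.2 := by
    intro n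
    have h2 : ∀ i, ‖s + n‖ * (‖PowerSeries.coeff n (f i)‖ * r ^ n) ≤
        D * ∑ p ∈ Finset.HasAntidiagonal.antidiagonal n, x ^ p.1 * b p.2 := by
      intro i
      have h3 : (s + n) * PowerSeries.coeff n (f i) =
          ∑ j, ∑ p ∈ Finset.HasAntidiagonal.antidiagonal n,
            PowerSeries.coeff p.1 (H i j) * PowerSeries.coeff p.2 (f j) := by
        have := congrArg (PowerSeries.coeff n) (hf i)
        simpa [eulerOp, PowerSeries.coeff_mul] using this
      rw [← mul_assoc, ← norm_mul, h3]
      calc _ ≤ (∑ j, ∑ p ∈ Finset.HasAntidiagonal.antidiagonal n,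
            ‖PowerSeries.coeff p.1 (H i j)‖ * ‖PowerSeries.coeff p.2 (f j)‖) * r ^ n := by
            gcongr
            refine (norm_sum_le _ _).trans (Finset.sum_le_sum fun j _ => ?_)
            refine (norm_sum_le _ _).trans (Finset.sum_le_sum fun p _ => ?_)
            rw [norm_mul]
        _ = ∑ j, ∑ p ∈ Finset.HasAntidiagonal.antidiagonal n, (‖PowerSeries.coeff p.1 (H i j)‖ * ρ ^ p.1) *
              (x ^ p.1 * (‖PowerSeries.coeff p.2 (f j)‖ * r ^ p.2)) := by
            rw [Finset.sum_mul]
            refine Finset.sum_congr rfl fun j _ => ?_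
            rw [Finset.sum_mul]
            refine Finset.sum_congr rfl fun p hp => ?_
            rw [← Finset.HasAntidiagonal.mem_antidiagonal.1 hp, pow_add, hx, div_pow]
            field_simp
        _ ≤ ∑ j, ∑ p ∈ Finset.HasAntidiagonal.antidiagonal n,
              D * (x ^ p.1 * (‖PowerSeries.coeff p.2 (f j)‖ * r ^ p.2)) := by
            gcongr with j _ p _
            exact (hC i j _).trans (hD i j)
        _ = _ := by
            rw [Finset.sum_comm, Finset.mul_sum]
            refine Finset.sum_congr rfl fun p _ => ?_
            rw [hb]
            simp only [Finset.mul_sum]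
    calc ‖s + n‖ * b n = ∑ i, ‖s + n‖ * (‖PowerSeries.coeff n (f i)‖ * r ^ n) := by
          rw [hb, Finset.mul_sum]
      _ ≤ ∑ i : ι, D * ∑ p ∈ Finset.HasAntidiagonal.antidiagonal n, x ^ p.1 * b p.2 :=
          Finset.sum_le_sum fun i _ => h2 i
      _ = _ := by simp [hK]; ring
  obtain ⟨M, bound⟩ := bounded_of_convolution_bound s hb0 hx0 hx1 hK0 key
  refine ⟨M, fun n => le_trans ?_ (bound n)⟩
  exact Finset.single_le_sum (f := fun i => ‖PowerSeries.coeff n (f i)‖ * r ^ n)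
    (fun i _ => by positivity) (Finset.mem_univ i)

/-- A finite set of power series spanning a `q d/dq + s`-stable module over the ring of
convergent power series consists of convergent power series. -/
lemma span_le_discSeries {T : Set (PowerSeries ℂ)} (hT : T.Finite) (s : ℂ)
    (h : ∀ t ∈ T, eulerOp s t ∈ Submodule.span discSeries T) {f : PowerSeries ℂ}
    (hf : f ∈ Submodule.span discSeries T) : f ∈ discSeries := by
  have := hT.fintype
  have h1 : ∀ t : T, ∃ c : T → discSeries, ∑ j, c j • (j : PowerSeries ℂ) = eulerOp s t :=
    fun t => (Submodule.mem_span_range_iff_exists_fun discSeries).1 (by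
      rw [Subtype.range_coe]; exact h t t.2)
  choose c hc using h1
  have h2 : ∀ t : T, (t : PowerSeries ℂ) ∈ discSeries :=
    mem_discSeries_of_system s (fun t : T => (t : PowerSeries ℂ)) (fun i j => c i j)
      (fun i j => (c i j).2) (fun i => (hc i).symm)
  induction hf using Submodule.span_induction with
  | mem x hx => exact h2 ⟨x, hx⟩
  | zero => exact zero_mem _
  | add x y _ _ hx hy => exact add_mem hx hy
  | smul a x _ hx => exact mul_mem a.2 hx

lemma summable_discSeries {f : PowerSeries ℂ} (hf : f ∈ discSeries) {r : ℝ} (h0 : 0 ≤ r)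
    (h1 : r < 1) : Summable fun n => ‖PowerSeries.coeff n f‖ * r ^ n := by
  obtain ⟨s, hrs, hs1⟩ := exists_between h1
  have hs0 : 0 < s := h0.trans_lt hrs
  obtain ⟨C, hC⟩ := hf s hs0 hs1
  refine Summable.of_nonneg_of_le (fun n => by positivity) (fun n => ?_)
    ((summable_geometric_of_lt_one (r := r / s) (by positivity)
      ((div_lt_one hs0).2 hrs)).mul_left C)
  calc _ = (‖PowerSeries.coeff n f‖ * s ^ n) * (r / s) ^ n := by rw [div_pow]; field_simp
    _ ≤ C * (r / s) ^ n := by gcongr; exact hC n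

lemma differentiableOn_discSeries {f : PowerSeries ℂ} (hf : f ∈ discSeries) :
    DifferentiableOn ℂ (fun q : ℂ => ∑' n, PowerSeries.coeff n f * q ^ n) (Metric.ball 0 1) := by
  intro q hq
  obtain ⟨r, hqr, hr1⟩ := exists_between (mem_ball_zero_iff.1 hq)
  have h : DifferentiableOn ℂ (fun q : ℂ => ∑' n, PowerSeries.coeff n f * q ^ n)
      (Metric.ball 0 r) := by
    refine Complex.differentiableOn_tsum_of_summable_norm
      (summable_discSeries hf ((norm_nonneg q).trans hqr.le) hr1) (fun n => by fun_prop)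
      Metric.isOpen_ball fun n w hw => ?_
    rw [norm_mul, norm_pow]
    gcongr
    exact (mem_ball_zero_iff.1 hw).le
  exact (h.differentiableAt (Metric.isOpen_ball.mem_nhds
    (mem_ball_zero_iff.2 hqr))).differentiableWithinAt

end Growth

/-! ### Newton interpolation of sequences over `ℤ` killed by a finite difference. -/

section Newton

variable {M : Type*} [AddCommGroup M] [Module ℂ M]

open fwdDiff in
/-- Newton interpolation over `ℤ`. -/
lemma newton_interpolation (N : ℕ) : ∀ g : ℤ → M, (fwdDiff (1 : ℤ))^[N] g = 0 → ∀ m : ℤ,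
    g m = ∑ j ∈ Finset.range N, ((Ring.choose m j : ℤ) : ℂ) • (fwdDiff (1 : ℤ))^[j] g 0 := by
  induction N with
  | zero =>
    intro g hg m
    simpa using congrFun hg m
  | succ N ih =>
    intro g hg m
    set G : ℤ → M := fun m => ∑ j ∈ Finset.range (N + 1),
      ((Ring.choose m j : ℤ) : ℂ) • (fwdDiff (1 : ℤ))^[j] g 0 with hG
    -- By Pascal's rule the difference of the interpolant of `g` is the interpolant of `fwdDiff 1
    -- g`, to which the induction hypothesis applies. So `G` and `g` have the same differences, and
    -- they agree at `0`.
    have h1 : ∀ m, G (m + 1) - G m = g (m + 1) - g m := by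
      intro m
      have h2 := ih (fwdDiff 1 g) (by rwa [Function.iterate_succ] at hg) m
      rw [fwdDiff] at h2
      rw [h2, hG]
      simp only
      rw [← Finset.sum_sub_distrib, Finset.sum_range_succ']
      simp only [Ring.choose_zero_right, sub_self, add_zero]
      refine Finset.sum_congr rfl fun j _ => ?_
      rw [Ring.choose_succ_succ, ← sub_smul, Function.iterate_succ, Function.comp]
      push_cast
      congr 1
      ring
    have h0 : G 0 = g 0 := by
      rw [hG]
      simp only
      rw [Finset.sum_range_succ']
      simp [Ring.choose_zero_succ]
    suffices h : ∀ m : ℤ, G m = g m from (h m).symm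
    intro m
    induction m using Int.induction_on with
    | zero => exact h0
    | succ i hi => have := h1 i; rw [hi] at this; exact sub_left_injective this
    | pred i hi =>
      have := h1 (-i - 1)
      rw [sub_add_cancel, hi] at this
      exact sub_right_injective this

lemma fwdDiff_iterate_eq_alternating (g : ℤ → M) (N : ℕ) (m : ℤ) :
    (fwdDiff (1 : ℤ))^[N] g m =
      ∑ i ∈ Finset.range (N + 1), ((-1 : ℂ) ^ i * (N.choose i : ℂ)) • g (m + N - i) := by
  rw [fwdDiff_iter_eq_sum_shift, ← Finset.sum_range_reflect]
  refine Finset.sum_congr rfl fun i hi => ?_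
  have hi' : i ≤ N := Nat.lt_succ_iff.1 (Finset.mem_range.1 hi)
  have e1 : N + 1 - 1 - i = N - i := by omega
  have e2 : N - (N - i) = i := by omega
  rw [e1, e2, Nat.choose_symm hi', ← Int.cast_smul_eq_zsmul ℂ]
  push_cast
  congr 2
  rw [nsmul_one, Nat.cast_sub hi']
  ring

/-- A sequence annihilated by a finite difference operator is determined by the finite
differences at the origin. -/
lemma eq_sum_choose_of_alternating {g : ℤ → M} {c : ℕ → M} {N : ℕ}
    (hN : ∀ m : ℤ, ∑ i ∈ Finset.range (N + 1),
      ((-1 : ℂ) ^ i * (N.choose i : ℂ)) • g (m + N - i) = 0)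
    (hc : ∀ j : ℕ, c j = ∑ i ∈ Finset.range (j + 1),
      ((-1 : ℂ) ^ i * (j.choose i : ℂ)) • g (j - i)) {J : ℕ} (hJ : N ≤ J) (m : ℤ) :
    g m = ∑ j ∈ Finset.range J, ((Ring.choose m j : ℤ) : ℂ) • c j := by
  have h1 : (fwdDiff (1 : ℤ))^[N] g = 0 := by
    funext m
    rw [fwdDiff_iterate_eq_alternating, hN, Pi.zero_apply]
  have h2 : (fwdDiff (1 : ℤ))^[J] g = 0 := by
    obtain ⟨k, rfl⟩ := Nat.exists_eq_add_of_le' hJ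
    rw [Function.iterate_add_apply, h1]
    clear hJ
    induction k with
    | zero => rfl
    | succ k ih => rw [Function.iterate_succ_apply', ih]; funext; simp [fwdDiff]
  rw [newton_interpolation J g h2 m]
  refine Finset.sum_congr rfl fun j _ => ?_
  rw [hc, fwdDiff_iterate_eq_alternating]
  simp

/-- For a nonnegative exponent `j` the associativity sum is finite. Reversing the index in its
second half turns it into the `j`-th forward difference at `0` of `p - q`. -/
lemma finsum_choose_eq_alternating (p q : ℤ → M) (j : ℕ) :
    ∑ᶠ i : ℕ, ((-1 : ℂ) ^ i * (Ring.choose (j : ℤ) i : ℤ)) •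
        (p (j - i) - ((-1 : ℂ) ^ (j : ℤ)) • q i) =
      ∑ i ∈ Finset.range (j + 1), ((-1 : ℂ) ^ i * (j.choose i : ℂ)) • (p (j - i) - q (j - i)) := by
  rw [finsum_eq_sum_of_support_subset (s := Finset.range (j + 1))]
  · simp only [smul_sub, Finset.sum_sub_distrib, Ring.choose_natCast, Int.cast_natCast]
    congr 1
    rw [← Finset.sum_range_reflect]
    refine Finset.sum_congr rfl fun i hi => ?_
    have hi' : i ≤ j := Nat.lt_succ_iff.1 (Finset.mem_range.1 hi)
    have e1 : j + 1 - 1 - i = j - i := by omega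
    rw [e1, Nat.choose_symm hi', smul_smul, Nat.cast_sub hi', zpow_natCast]
    congr 1
    have e2 : (-1 : ℂ) ^ j = (-1) ^ (j - i) * (-1) ^ i := by rw [← pow_add]; congr 1; omega
    have e3 : (-1 : ℂ) ^ (j - i) * (-1) ^ (j - i) = 1 := by rw [← mul_pow]; simp
    rw [e2]
    linear_combination ((-1 : ℂ) ^ i * j.choose i) * e3
  · intro i hi
    by_contra h
    apply hi
    have : j < i := by simpa using h
    simp [Ring.choose_natCast, Nat.choose_eq_zero_of_lt this]

end Newton

/-! ### Commutator formulas for modes and for intertwining operators. -/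

section Commutator

variable {V M : Type*} [AddCommGroup V] [Module ℂ V] [AddCommGroup M] [Module ℂ M] {𝒱 : VOA V}

/-- The commutator formula for modes on a module. -/
theorem VOAModule.commutator (X : VOAModule 𝒱 M) (v a : V) :
    ∃ N : ℕ, ∀ J : ℕ, N ≤ J → ∀ (m n : ℤ) (x : M),
      mode X.Y v m (mode X.Y a n x) - mode X.Y a n (mode X.Y v m x) =
        ∑ j ∈ Finset.range J, ((Ring.choose m j : ℤ) : ℂ) •
          mode X.Y (mode 𝒱.Y v j a) (m + n - j) x := by
  obtain ⟨N, hN⟩ := X.commutativity v a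
  refine ⟨N, fun J hJ m n x => ?_⟩
  -- The sum of the two mode indices is frozen and the commutator is regarded as a sequence in `p`.
  -- Commutativity kills its `N`-th difference and associativity computes its differences at `0`.
  have key := eq_sum_choose_of_alternating (N := N) (J := J) (m := m)
    (g := fun p => mode X.Y v p (mode X.Y a (m + n - p) x)
      - mode X.Y a (m + n - p) (mode X.Y v p x))
    (c := fun j => mode X.Y (mode 𝒱.Y v j a) (m + n - j) x) ?_ ?_ hJ
  · simpa using key
  · intro p
    have := LinearMap.congr_fun (hN p (m + n - p - N)) x
    simp only [LinearMap.sum_apply, LinearMap.smul_apply, LinearMap.sub_apply, Module.End.mul_apply,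
      LinearMap.zero_apply] at this
    rw [← this]
    refine Finset.sum_congr rfl fun i _ => ?_
    have e : m + n - (p + N - i) = m + n - p - N + i := by ring
    rw [e]
  · intro j
    rw [X.associativity]
    have := finsum_choose_eq_alternating (fun p => mode X.Y v p (mode X.Y a (m + n - p) x))
      (fun p => mode X.Y a (m + n - p) (mode X.Y v p x)) j
    rw [← this]
    refine finsum_congr fun i => ?_
    have e1 : m + n - (j - i) = m + n - j + (i : ℤ) := by ring
    have e2 : (j : ℤ) + (m + n - j) - i = m + n - i := by ring
    rw [e1, e2]

variable {W₁ W₂ W₃ : Type*} [AddCommGroup W₁] [Module ℂ W₁]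
  [AddCommGroup W₂] [Module ℂ W₂] [AddCommGroup W₃] [Module ℂ W₃]
  {X₁ : VOAModule 𝒱 W₁} {X₂ : VOAModule 𝒱 W₂} {X₃ : VOAModule 𝒱 W₃}

/-- The commutator formula for an intertwining operator. -/
theorem IntertwiningOperator.commutator (I : IntertwiningOperator X₁ X₂ X₃) (v : V) (u : W₁) :
    ∃ N : ℕ, ∀ J : ℕ, N ≤ J → ∀ (m : ℤ) (r : ℂ) (x : W₂),
      mode X₃.Y v m (I.coeff r u x) - I.coeff r u (mode X₂.Y v m x) =
        ∑ j ∈ Finset.range J, ((Ring.choose m j : ℤ) : ℂ) •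
          I.coeff (m + r - j) (mode X₁.Y v j u) x := by
  obtain ⟨N, hN⟩ := I.commutativity v u
  refine ⟨N, fun J hJ m r x => ?_⟩
  have key := eq_sum_choose_of_alternating (N := N) (J := J) (m := m)
    (g := fun p => mode X₃.Y v p (I.coeff (m + r - p) u x)
      - I.coeff (m + r - p) u (mode X₂.Y v p x))
    (c := fun j => I.coeff (m + r - j) (mode X₁.Y v j u) x) ?_ ?_ hJ
  · simpa using key
  · intro p
    rw [← hN p (m + r - p - N) x]
    refine Finset.sum_congr rfl fun i _ => ?_
    have e : (m : ℂ) + r - ((p + N - i : ℤ) : ℂ) = m + r - p - N + i := by push_cast; ring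
    rw [e]
  · intro j
    rw [I.associativity]
    have := finsum_choose_eq_alternating
      (fun p : ℤ => mode X₃.Y v p (I.coeff (m + r - p) u x))
      (fun p : ℤ => I.coeff (m + r - p) u (mode X₂.Y v p x)) j
    rw [← this]
    refine finsum_congr fun i => ?_
    have e1 : (m : ℂ) + r - ((j - i : ℤ) : ℂ) = m + r - j + i := by push_cast; ring
    have e2 : ((j : ℤ) : ℂ) + (m + r - j) - i = m + r - (i : ℤ) := by push_cast; ring
    rw [e1, e2]

end Commutator

/-! ### Residues of vertex operators against Laurent series. -/

section ModeSeries

instance laurentSeries_isScalarTower :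
    IsScalarTower ℂ (LaurentSeries ℂ) (LaurentSeries ℂ) :=
  ⟨fun c f g => by
    rw [smul_eq_mul, smul_eq_mul, ← HahnSeries.C_mul_eq_smul, ← HahnSeries.C_mul_eq_smul,
      mul_assoc]⟩

instance laurentSeries_smulCommClass :
    SMulCommClass ℂ (LaurentSeries ℂ) (LaurentSeries ℂ) :=
  ⟨fun c f g => by
    rw [smul_eq_mul, smul_eq_mul, ← HahnSeries.C_mul_eq_smul, ← HahnSeries.C_mul_eq_smul,
      mul_left_comm]⟩

variable {V M : Type*} [AddCommGroup V] [Module ℂ V] [AddCommGroup M] [Module ℂ M]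

lemma mode_truncation (Y : V →ₗ[ℂ] VertexOperator ℂ M) (a : V) (x : M) :
    ∃ N : ℤ, ∀ n : ℤ, N ≤ n → mode Y a n x = 0 := by
  refine ⟨-(HahnSeries.order ((HahnModule.of ℂ).symm (Y a x))), fun n hn => ?_⟩
  exact VertexOperator.ncoeff_eq_zero_of_lt_order _ _ _ (by omega)

lemma laurentSeries_bddBelow (f : LaurentSeries ℂ) : ∃ N : ℤ, ∀ n < N, f.coeff n = 0 :=
  ⟨f.order, fun _ hn => HahnSeries.coeff_eq_zero_of_lt_order hn⟩

lemma finite_support_coeff_smul (Y : V →ₗ[ℂ] VertexOperator ℂ M) (a : V) (f : LaurentSeries ℂ)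
    (x : M) : (Function.support fun i : ℤ => f.coeff i • mode Y a i x).Finite := by
  obtain ⟨N, hN⟩ := mode_truncation Y a x
  obtain ⟨K, hK⟩ := laurentSeries_bddBelow f
  refine (Set.finite_Ico K N).subset fun i hi => ?_
  simp only [Function.mem_support] at hi
  refine ⟨?_, ?_⟩
  · by_contra h; exact hi (by rw [hK i (by omega), zero_smul])
  · by_contra h; exact hi (by rw [hN i (by omega), smul_zero])

/-- `Res_z f(z) Y(a, z) x`. -/
noncomputable def resMode (Y : V →ₗ[ℂ] VertexOperator ℂ M) :
    V →ₗ[ℂ] LaurentSeries ℂ →ₗ[ℂ] Module.End ℂ M :=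
  LinearMap.mk₂ ℂ (fun a f =>
    { toFun := fun x => ∑ᶠ i : ℤ, f.coeff i • mode Y a i x
      map_add' := fun x y => by
        rw [← finsum_add_distrib (finite_support_coeff_smul Y a f x)
          (finite_support_coeff_smul Y a f y)]
        simp
      map_smul' := fun c x => by
        rw [RingHom.id_apply, smul_finsum]
        refine finsum_congr fun i => ?_
        rw [map_smul, smul_comm] })
    (fun a b f => by
      ext x
      simp only [LinearMap.coe_mk, AddHom.coe_mk, LinearMap.add_apply]
      rw [← finsum_add_distrib (finite_support_coeff_smul Y a f x)
          (finite_support_coeff_smul Y b f x)]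
      refine finsum_congr fun i => ?_
      simp [mode])
    (fun c a f => by
      ext x
      simp only [LinearMap.coe_mk, AddHom.coe_mk, LinearMap.smul_apply]
      rw [smul_finsum]
      refine finsum_congr fun i => ?_
      rw [mode, map_smul, map_smul, Pi.smul_apply, LinearMap.smul_apply, smul_comm]
      rfl)
    (fun a f g => by
      ext x
      simp only [LinearMap.coe_mk, AddHom.coe_mk, LinearMap.add_apply]
      rw [← finsum_add_distrib (finite_support_coeff_smul Y a f x)
          (finite_support_coeff_smul Y a g x)]
      refine finsum_congr fun i => ?_
      simp [add_smul])
    (fun c a f => by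
      ext x
      simp only [LinearMap.coe_mk, AddHom.coe_mk, LinearMap.smul_apply]
      rw [smul_finsum]
      refine finsum_congr fun i => ?_
      simp [mul_smul])

lemma resMode_apply (Y : V →ₗ[ℂ] VertexOperator ℂ M) (a : V) (f : LaurentSeries ℂ) (x : M) :
    resMode Y a f x = ∑ᶠ i : ℤ, f.coeff i • mode Y a i x := rfl

@[simp]
lemma resMode_single (Y : V →ₗ[ℂ] VertexOperator ℂ M) (a : V) (l : ℤ) (c : ℂ) :
    resMode Y a (HahnSeries.single l c) = c • mode Y a l := by
  ext x
  rw [resMode_apply, finsum_eq_single _ l]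
  · simp
  · intro i hi
    simp [HahnSeries.coeff_single_of_ne hi]

lemma resMode_eq_zero (Y : V →ₗ[ℂ] VertexOperator ℂ M) {a : V} {x : M} {N : ℤ}
    (hN : ∀ n : ℤ, N ≤ n → mode Y a n x = 0) {f : LaurentSeries ℂ}
    (hf : ∀ i < N, f.coeff i = 0) : resMode Y a f x = 0 := by
  rw [resMode_apply]
  refine finsum_eq_zero_of_forall_eq_zero fun i => ?_
  rcases lt_or_ge i N with h | h
  · rw [hf i h, zero_smul]
  · rw [hN i h, smul_zero]

lemma resMode_eq_sum (Y : V →ₗ[ℂ] VertexOperator ℂ M) {a : V} {x : M} {N K : ℤ}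
    (hN : ∀ n : ℤ, N ≤ n → mode Y a n x = 0) {f : LaurentSeries ℂ}
    (hf : ∀ i < K, f.coeff i = 0) :
    resMode Y a f x = ∑ i ∈ Finset.Ico K N, f.coeff i • mode Y a i x := by
  rw [resMode_apply]
  refine finsum_eq_sum_of_support_subset _ fun i hi => ?_
  simp only [Function.mem_support] at hi
  rw [Finset.coe_Ico]
  refine ⟨?_, ?_⟩
  · by_contra h; exact hi (by rw [hf i (by omega), zero_smul])
  · by_contra h; exact hi (by rw [hN i (by omega), smul_zero])

/-- Linear maps on Laurent series that agree on monomials and on all series of high order are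
equal. -/
lemma laurentSeries_ext {φ ψ : LaurentSeries ℂ →ₗ[ℂ] M} (N : ℤ)
    (h1 : ∀ f : LaurentSeries ℂ, (∀ i < N, f.coeff i = 0) → φ f = ψ f)
    (h2 : ∀ l : ℤ, φ (HahnSeries.single l 1) = ψ (HahnSeries.single l 1))
    (f : LaurentSeries ℂ) : φ f = ψ f := by
  obtain ⟨K, hK⟩ := laurentSeries_bddBelow f
  set p : LaurentSeries ℂ := ∑ l ∈ Finset.Ico K N, f.coeff l • HahnSeries.single l 1 with hp
  have hpc : ∀ i < N, (f - p).coeff i = 0 := by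
    intro i hi
    rw [HahnSeries.coeff_sub, hp, HahnSeries.coeff_sum]
    by_cases hKi : K ≤ i
    · rw [Finset.sum_eq_single i]
      · simp
      · intro b _ hb
        simp [HahnSeries.coeff_single_of_ne hb.symm]
      · intro h; exact absurd (Finset.mem_Ico.2 ⟨hKi, hi⟩) h
    · rw [hK i (by omega), Finset.sum_eq_zero, sub_zero]
      intro l hl
      have : i ≠ l := by have := (Finset.mem_Ico.1 hl).1; omega
      simp [HahnSeries.coeff_single_of_ne this]
  have e : f = (f - p) + p := (sub_add_cancel f p).symm
  rw [e, map_add, map_add, h1 _ hpc, hp]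
  simp only [map_sum, map_smul, h2]

lemma laurentSeries_coeff_mul_eq_zero {f g : LaurentSeries ℂ} {A B : ℤ}
    (hf : ∀ i < A, f.coeff i = 0) (hg : ∀ i < B, g.coeff i = 0) :
    ∀ i < A + B, (f * g).coeff i = 0 := by
  intro i hi
  rw [HahnSeries.coeff_mul]
  refine Finset.sum_eq_zero fun p hp => ?_
  have h := (Finset.mem_antidiagonal.1 hp).2.2
  rcases lt_or_ge p.1 A with h1 | h1
  · rw [hf _ h1, zero_mul]
  · rw [hg _ (by omega), mul_zero]

lemma hasseDeriv_coeff_eq_zero {f : LaurentSeries ℂ} {A : ℤ} (hf : ∀ i < A, f.coeff i = 0)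
    (j : ℕ) : ∀ i < A - j, (LaurentSeries.hasseDeriv ℂ j f).coeff i = 0 := by
  intro i hi
  rw [LaurentSeries.hasseDeriv_coeff, hf _ (by omega), smul_zero]

variable {𝒱 : VOA V}

/-- The commutator formula for `Res_z f(z) Y(v, z)` and `Res_z g(z) Y(a, z)`. -/
theorem VOAModule.resMode_commutator (X : VOAModule 𝒱 M) (v a : V) :
    ∃ N : ℕ, ∀ J : ℕ, N ≤ J → ∀ (f g : LaurentSeries ℂ) (x : M),
      resMode X.Y v f (resMode X.Y a g x) - resMode X.Y a g (resMode X.Y v f x) =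
        ∑ j ∈ Finset.range J,
          resMode X.Y (mode 𝒱.Y v j a) (LaurentSeries.hasseDeriv ℂ j f * g) x := by
  obtain ⟨N, hN⟩ := X.commutator v a
  refine ⟨N, fun J hJ f g x => ?_⟩
  have htr : ∃ T : ℤ, ∀ j ∈ Finset.range J, ∀ n : ℤ, T ≤ n →
      mode X.Y (mode 𝒱.Y v j a) n x = 0 := by
    choose T hT using fun j : ℕ => mode_truncation X.Y (mode 𝒱.Y v j a) x
    refine ⟨∑ j ∈ Finset.range J, |T j|, fun j hj n hn => hT j n (le_trans ?_ hn)⟩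
    exact (le_abs_self _).trans
      (Finset.single_le_sum (f := fun j => |T j|) (fun _ _ => abs_nonneg _) hj)
  obtain ⟨T, hT⟩ := htr
  -- Both sides are bilinear: `L`, `R` are read as linear in `g`, and `L'`, `R'` as linear in `f`.
  -- `laurentSeries_ext` reduces first `f` and then `g` to monomials, where the identity is the
  -- commutator formula for modes.
  let R (f : LaurentSeries ℂ) : LaurentSeries ℂ →ₗ[ℂ] M := ∑ j ∈ Finset.range J,
    ((LinearMap.applyₗ x ∘ₗ resMode X.Y (mode 𝒱.Y v j a)) ∘ₗ
      LinearMap.mulLeft ℂ (LaurentSeries.hasseDeriv ℂ j f))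
  let R' (g : LaurentSeries ℂ) : LaurentSeries ℂ →ₗ[ℂ] M := ∑ j ∈ Finset.range J,
    ((LinearMap.applyₗ x ∘ₗ resMode X.Y (mode 𝒱.Y v j a)) ∘ₗ
      LinearMap.mulRight ℂ g ∘ₗ LaurentSeries.hasseDeriv ℂ j)
  let L (f : LaurentSeries ℂ) : LaurentSeries ℂ →ₗ[ℂ] M :=
    (resMode X.Y v f ∘ₗ LinearMap.applyₗ x ∘ₗ resMode X.Y a)
      - LinearMap.applyₗ (resMode X.Y v f x) ∘ₗ resMode X.Y a
  let L' (g : LaurentSeries ℂ) : LaurentSeries ℂ →ₗ[ℂ] M :=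
    (LinearMap.applyₗ (resMode X.Y a g x) ∘ₗ resMode X.Y v)
      - resMode X.Y a g ∘ₗ LinearMap.applyₗ x ∘ₗ resMode X.Y v
  have hRR' : ∀ f g, R f g = R' g f := by
    intro f g; simp [R, R', LinearMap.sum_apply]
  have hLL' : ∀ f g, L f g = L' g f := by
    intro f g; simp [L, L']
  have hmono : ∀ k l : ℤ, L (HahnSeries.single k 1) (HahnSeries.single l 1)
      = R (HahnSeries.single k 1) (HahnSeries.single l 1) := by
    intro k l
    simp only [L, R, LinearMap.sub_apply, LinearMap.comp_apply, LinearMap.applyₗ_apply_apply,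
      resMode_single, one_smul, LinearMap.sum_apply, LinearMap.mulLeft_apply,
      LaurentSeries.hasseDeriv_single, HahnSeries.single_mul_single, hN J hJ]
    refine Finset.sum_congr rfl fun j _ => ?_
    rw [LinearMap.smul_apply]
    congr 2
    · simp
    · ring_nf
  have hg : ∀ (l : ℤ) (f : LaurentSeries ℂ), L f (HahnSeries.single l 1)
      = R f (HahnSeries.single l 1) := by
    intro l f
    rw [hRR', hLL']
    obtain ⟨T1, hT1⟩ := mode_truncation X.Y v (mode X.Y a l x)
    obtain ⟨T2, hT2⟩ := mode_truncation X.Y v x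
    -- Hasse derivatives of order `j < J` lower the order by less than `J`, and the monomial shifts
    -- it by `l`. Above this threshold every mode that occurs has index at least `T`.
    refine laurentSeries_ext (max (max T1 T2) (T + J - l)) (fun f hf => ?_) (fun k => ?_) f
    · have hs : ∀ i < l, (HahnSeries.single l (1 : ℂ)).coeff i = 0 := fun i hi =>
        HahnSeries.coeff_single_of_ne hi.ne
      simp only [L', R', LinearMap.sub_apply, LinearMap.comp_apply, LinearMap.applyₗ_apply_apply,
        resMode_single, one_smul, LinearMap.sum_apply, LinearMap.mulRight_apply]
      rw [resMode_eq_zero X.Y hT1 (fun i hi => hf i (by omega)),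
        resMode_eq_zero X.Y hT2 (fun i hi => hf i (by omega)), map_zero, sub_zero]
      refine (Finset.sum_eq_zero fun j hj => ?_).symm
      have hj' := Finset.mem_range.1 hj
      refine resMode_eq_zero X.Y (hT j hj) fun i hi => ?_
      exact laurentSeries_coeff_mul_eq_zero (hasseDeriv_coeff_eq_zero hf j) hs i (by omega)
    · rw [← hRR', ← hLL', hmono]
  have key : L f g = R f g := by
    obtain ⟨T1, hT1⟩ := mode_truncation X.Y a (resMode X.Y v f x)
    obtain ⟨T2, hT2⟩ := mode_truncation X.Y a x
    obtain ⟨K, hK⟩ := laurentSeries_bddBelow f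
    refine laurentSeries_ext (max (max T1 T2) (T + J - K)) (fun g hg => ?_) (fun l => hg l f) g
    simp only [L, R, LinearMap.sub_apply, LinearMap.comp_apply, LinearMap.applyₗ_apply_apply,
      LinearMap.sum_apply, LinearMap.mulLeft_apply]
    rw [resMode_eq_zero X.Y hT1 (fun i hi => hg i (by omega)),
        resMode_eq_zero X.Y hT2 (fun i hi => hg i (by omega)), map_zero, sub_zero]
    refine (Finset.sum_eq_zero fun j hj => ?_).symm
    have hj' := Finset.mem_range.1 hj
    refine resMode_eq_zero X.Y (hT j hj) fun i hi => ?_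
    exact laurentSeries_coeff_mul_eq_zero (hasseDeriv_coeff_eq_zero hK j) hg i (by omega)
  simpa [L, R, LinearMap.sum_apply] using key

/-- Integration by parts. -/
lemma VOAModule.resMode_derivative (X : VOAModule 𝒱 M) (a : V) (g : LaurentSeries ℂ) (x : M) :
    resMode X.Y (vir 𝒱.Y 𝒱.omega (-1) a) g x =
      - resMode X.Y a (LaurentSeries.hasseDeriv ℂ 1 g) x := by
  obtain ⟨T1, hT1⟩ := mode_truncation X.Y (vir 𝒱.Y 𝒱.omega (-1) a) x
  obtain ⟨T2, hT2⟩ := mode_truncation X.Y a x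
  let φ : LaurentSeries ℂ →ₗ[ℂ] M :=
    LinearMap.applyₗ x ∘ₗ resMode X.Y (vir 𝒱.Y 𝒱.omega (-1) a)
  let ψ : LaurentSeries ℂ →ₗ[ℂ] M :=
    - (LinearMap.applyₗ x ∘ₗ resMode X.Y a) ∘ₗ LaurentSeries.hasseDeriv ℂ 1
  refine laurentSeries_ext (φ := φ) (ψ := ψ) (max T1 (T2 + 1)) (fun f hf => ?_) (fun l => ?_) g
  · simp only [φ, ψ, LinearMap.comp_apply, LinearMap.applyₗ_apply_apply, LinearMap.neg_apply]
    rw [resMode_eq_zero X.Y hT1 (fun i hi => hf i (by omega)), resMode_eq_zero X.Y hT2, neg_zero]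
    intro i hi
    exact hasseDeriv_coeff_eq_zero hf 1 i (by push_cast; omega)
  · simp [φ, ψ, X.derivative a l]

end ModeSeries

/-! ### Weights of modes. -/

section Weights

variable {V M : Type*} [AddCommGroup V] [Module ℂ V] [AddCommGroup M] [Module ℂ M] {𝒱 : VOA V}

lemma mem_weightSpace {Y : V →ₗ[ℂ] VertexOperator ℂ M} {ω : V} {μ : ℂ} {x : M} :
    x ∈ weightSpace Y ω μ ↔ vir Y ω 0 x = μ • x := Module.End.mem_eigenspace_iff

lemma vir_mem_weightSpace {Y : V →ₗ[ℂ] VertexOperator ℂ M} {ω : V} {c : ℂ}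
    (h : VirasoroRelations (vir Y ω) c) {μ : ℂ} {x : M} (hx : x ∈ weightSpace Y ω μ) (n : ℤ) :
    vir Y ω n x ∈ weightSpace Y ω (μ - n) := by
  rw [mem_weightSpace] at hx ⊢
  have h1 := LinearMap.congr_fun (h 0 n) x
  simp only [LinearMap.sub_apply, Module.End.mul_apply, hx, map_smul, LinearMap.add_apply,
    LinearMap.smul_apply, zero_add, Int.cast_zero, zero_sub] at h1
  have h2 : (if n = 0 then ((0 : ℂ) ^ 3 - 0) / 12 * c else 0) = 0 := by split_ifs <;> simp
  rw [h2, zero_smul, add_zero, sub_eq_iff_eq_add] at h1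
  rw [h1, ← add_smul]
  congr 1
  ring

lemma mode_omega_mode_zero {Y : V →ₗ[ℂ] VertexOperator ℂ M} {ω : V} :
    mode Y ω 1 = vir Y ω 0 := rfl

/-- `a(n)` has weight `wt a - n - 1`. -/
lemma VOAModule.mode_mem_weightSpace (X : VOAModule 𝒱 M) {a : V} {h μ : ℂ} {x : M}
    (ha : a ∈ weightSpace 𝒱.Y 𝒱.omega h) (hx : x ∈ weightSpace X.Y 𝒱.omega μ) (n : ℤ) :
    mode X.Y a n x ∈ weightSpace X.Y 𝒱.omega (h + μ - n - 1) := by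
  rw [mem_weightSpace] at hx ha ⊢
  obtain ⟨N, hN⟩ := X.commutator 𝒱.omega a
  -- Two extra terms make room to split off `j = 0` and `j = 1`; the others carry `Ring.choose 1 j =
  -- 0`.
  have h1 := hN (N + 2) (by omega) 1 n x
  rw [Finset.sum_range_succ', Finset.sum_range_succ', Finset.sum_eq_zero] at h1
  · rw [mode_omega_mode_zero, hx, map_smul, sub_eq_iff_eq_add] at h1
    have e0 : mode 𝒱.Y 𝒱.omega ((0 : ℕ) : ℤ) a = vir 𝒱.Y 𝒱.omega (-1) a := rfl
    have e1 : mode 𝒱.Y 𝒱.omega ((0 + 1 : ℕ) : ℤ) a = h • a := ha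
    rw [e0, e1, X.derivative] at h1
    have e2 : mode X.Y (h • a) = h • mode X.Y a := by funext m; simp [mode]
    have e3 : (1 + n - ((0 + 1 : ℕ) : ℤ)) = n := by push_cast; ring
    have e4 : (1 + n - ((0 : ℕ) : ℤ) - 1) = n := by push_cast; ring
    rw [e2, Pi.smul_apply, e3, e4] at h1
    rw [h1]
    simp only [Ring.choose_zero_right, Ring.choose_one_right, LinearMap.smul_apply, smul_smul,
      ← add_smul, zero_add]
    congr 1
    push_cast
    ring
  · intro j _
    have : Ring.choose (1 : ℤ) (j + 1 + 1) = 0 := by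
      have := Ring.choose_natCast (R := ℤ) 1 (j + 1 + 1)
      rw [Nat.choose_eq_zero_of_lt (by omega)] at this
      exact_mod_cast this
    rw [this]
    simp

variable {W₁ W₂ W₃ : Type*} [AddCommGroup W₁] [Module ℂ W₁]
  [AddCommGroup W₂] [Module ℂ W₂] [AddCommGroup W₃] [Module ℂ W₃]
  {X₁ : VOAModule 𝒱 W₁} {X₂ : VOAModule 𝒱 W₂} {X₃ : VOAModule 𝒱 W₃}

/-- `u(r)` has weight `wt u - r - 1`. -/
lemma IntertwiningOperator.coeff_mem_weightSpace (I : IntertwiningOperator X₁ X₂ X₃) {u : W₁}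
    {μ ν : ℂ} {x : W₂} (hu : u ∈ weightSpace X₁.Y 𝒱.omega μ)
    (hx : x ∈ weightSpace X₂.Y 𝒱.omega ν) (r : ℂ) :
    I.coeff r u x ∈ weightSpace X₃.Y 𝒱.omega (μ + ν - r - 1) := by
  rw [mem_weightSpace] at hx hu ⊢
  obtain ⟨N, hN⟩ := I.commutator 𝒱.omega u
  have h1 := hN (N + 2) (by omega) 1 r x
  rw [Finset.sum_range_succ', Finset.sum_range_succ', Finset.sum_eq_zero] at h1
  · rw [mode_omega_mode_zero, mode_omega_mode_zero, hx, map_smul, sub_eq_iff_eq_add] at h1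
    have e0 : mode X₁.Y 𝒱.omega ((0 : ℕ) : ℤ) u = vir X₁.Y 𝒱.omega (-1) u := rfl
    have e1 : mode X₁.Y 𝒱.omega ((0 + 1 : ℕ) : ℤ) u = μ • u := hu
    have e3 : (((1 : ℤ) : ℂ) + r - ((0 + 1 : ℕ) : ℂ)) = r := by push_cast; ring
    have e4 : (((1 : ℤ) : ℂ) + r - ((0 : ℕ) : ℂ) - 1) = r := by push_cast; ring
    rw [e0, e1, I.derivative, map_smul, e3, e4] at h1
    rw [h1]
    simp only [Ring.choose_zero_right, Ring.choose_one_right, LinearMap.smul_apply, smul_smul,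
      ← add_smul, zero_add]
    congr 1
    push_cast
    ring
  · intro j _
    have : Ring.choose (1 : ℤ) (j + 1 + 1) = 0 := by
      have := Ring.choose_natCast (R := ℤ) 1 (j + 1 + 1)
      rw [Nat.choose_eq_zero_of_lt (by omega)] at this
      exact_mod_cast this
    rw [this]
    simp

end Weights

/-! ### Linear maps defined on the components of a grading. -/

section GradedMaps

variable {ι M P : Type*} [DecidableEq ι] [AddCommGroup M] [Module ℂ M] [AddCommGroup P]
  [Module ℂ P]

/-- The linear map that is `φ i` on the component of degree `i`. -/
noncomputable def gradedMap (A : ι → Submodule ℂ M) (h : DirectSum.IsInternal A)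
    (φ : ι → M →ₗ[ℂ] P) : M →ₗ[ℂ] P :=
  DirectSum.toModule ℂ ι P (fun i => φ i ∘ₗ (A i).subtype) ∘ₗ
    (LinearEquiv.ofBijective (DirectSum.coeLinearMap A) h).symm.toLinearMap

lemma ofBijective_coeLinearMap_symm_of_mem {A : ι → Submodule ℂ M} (h : DirectSum.IsInternal A)
    {i : ι} {x : M} (hx : x ∈ A i) :
    (LinearEquiv.ofBijective (DirectSum.coeLinearMap A) h).symm x =
      DirectSum.lof ℂ ι (fun i => A i) i ⟨x, hx⟩ := by
  rw [LinearEquiv.symm_apply_eq]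
  exact (DirectSum.coeLinearMap_lof A i ⟨x, hx⟩).symm

lemma gradedMap_of_mem {A : ι → Submodule ℂ M} (h : DirectSum.IsInternal A)
    (φ : ι → M →ₗ[ℂ] P) {i : ι} {x : M} (hx : x ∈ A i) : gradedMap A h φ x = φ i x := by
  simp only [gradedMap, LinearMap.comp_apply, LinearEquiv.coe_coe,
    ofBijective_coeLinearMap_symm_of_mem h hx, DirectSum.toModule_lof, Submodule.subtype_apply]

lemma component_of_mem {A : ι → Submodule ℂ M} (h : DirectSum.IsInternal A) {i : ι} {x : M}
    (hx : x ∈ A i) : (component A h i x : M) = x := by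
  simp [component, ofBijective_coeLinearMap_symm_of_mem h hx, DirectSum.component.lof_self]

lemma component_of_mem_ne {A : ι → Submodule ℂ M} (h : DirectSum.IsInternal A) {i j : ι}
    (hij : i ≠ j) {x : M} (hx : x ∈ A i) : component A h j x = 0 := by
  simp [component, ofBijective_coeLinearMap_symm_of_mem h hx, DirectSum.component.of, hij]

lemma gradedMap_eq_finsum {A : ι → Submodule ℂ M} (h : DirectSum.IsInternal A)
    (φ : ι → M →ₗ[ℂ] P) (x : M) :
    gradedMap A h φ x = ∑ᶠ i, φ i (component A h i x) := by
  classical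
  set d := (LinearEquiv.ofBijective (DirectSum.coeLinearMap A) h).symm x with hd
  have e : ∀ i, component A h i x = d i := fun i => rfl
  simp only [e]
  rw [finsum_eq_sum_of_support_subset (s := DFinsupp.support d)]
  · have : gradedMap A h φ x = DirectSum.toModule ℂ ι P (fun i => φ i ∘ₗ (A i).subtype) d := rfl
    rw [this]
    conv_lhs => rw [← DirectSum.sum_support_of d]
    rw [map_sum]
    refine Finset.sum_congr rfl fun i _ => ?_
    rw [← DirectSum.lof_eq_of ℂ, DirectSum.toModule_lof]
    rfl
  · intro i hi
    simp only [Function.mem_support] at hi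
    rw [Finset.mem_coe, DFinsupp.mem_support_toFun]
    intro h0
    exact hi (by rw [h0]; simp)

/-- Linear maps that agree on all components are equal. -/
lemma ext_of_isInternal {A : ι → Submodule ℂ M} (h : DirectSum.IsInternal A) {φ ψ : M →ₗ[ℂ] P}
    (hφ : ∀ i, ∀ x ∈ A i, φ x = ψ x) : φ = ψ := by
  have h1 : (⊤ : Submodule ℂ M) ≤ LinearMap.eqLocus φ ψ := by
    rw [← h.submodule_iSup_eq_top]
    exact iSup_le hφ
  ext x
  exact h1 (Submodule.mem_top (x := x))

end GradedMaps

/-! ### The Laurent series `log (1 + z)`, `1 + z`, their product, and their derivatives. -/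

section Series

/-- The Laurent series `log (1 + z)`. -/
noncomputable def logSeries : LaurentSeries ℂ := ((PowerSeries.log ℂ : PowerSeries ℂ) : LaurentSeries ℂ)

/-- The Laurent series `1 + z`. -/
noncomputable def onePlus : LaurentSeries ℂ := ((1 + PowerSeries.X : PowerSeries ℂ) : LaurentSeries ℂ)

lemma coeff_coe_neg (f : PowerSeries ℂ) {i : ℤ} (hi : i < 0) :
    (f : LaurentSeries ℂ).coeff i = 0 := by
  rw [PowerSeries.coeff_coe, if_pos hi]

lemma coeff_coe_nat (f : PowerSeries ℂ) (n : ℕ) :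
    (f : LaurentSeries ℂ).coeff n = PowerSeries.coeff n f := by
  rw [PowerSeries.coeff_coe, if_neg (by omega)]
  simp

/-- A fixed coefficient of either side is linear in each factor and ignores series of high order, so
the product rule reduces to monomials. -/
lemma laurentSeries_derivative_mul (f g : LaurentSeries ℂ) :
    LaurentSeries.hasseDeriv ℂ 1 (f * g) =
      f * LaurentSeries.hasseDeriv ℂ 1 g + g * LaurentSeries.hasseDeriv ℂ 1 f := by
  let D : LaurentSeries ℂ →ₗ[ℂ] LaurentSeries ℂ := LaurentSeries.hasseDeriv ℂ 1
  let c (n : ℤ) : LaurentSeries ℂ →ₗ[ℂ] ℂ :=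
    { toFun := fun f => f.coeff n
      map_add' := fun _ _ => rfl
      map_smul' := fun _ _ => rfl }
  have key : ∀ (n : ℤ) (f g : LaurentSeries ℂ),
      (∀ l, (D (f * HahnSeries.single l 1)).coeff n =
        (f * D (HahnSeries.single l 1) + HahnSeries.single l 1 * D f).coeff n) →
      (D (f * g)).coeff n = (f * D g + g * D f).coeff n := by
    intro n f g hl
    let φ : LaurentSeries ℂ →ₗ[ℂ] ℂ := c n ∘ₗ D ∘ₗ LinearMap.mulLeft ℂ f
    let ψ : LaurentSeries ℂ →ₗ[ℂ] ℂ := c n ∘ₗ (LinearMap.mulLeft ℂ f ∘ₗ D +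
      LinearMap.mulRight ℂ (D f))
    obtain ⟨K, hK⟩ := laurentSeries_bddBelow f
    refine laurentSeries_ext (φ := φ) (ψ := ψ) (n + 2 - K) (fun g hg => ?_) hl g
    have h1 := hasseDeriv_coeff_eq_zero (laurentSeries_coeff_mul_eq_zero hK hg) 1 n
      (by push_cast; omega)
    have h2 := laurentSeries_coeff_mul_eq_zero hK (hasseDeriv_coeff_eq_zero hg 1) n
      (by push_cast; omega)
    have h3 := laurentSeries_coeff_mul_eq_zero hg (hasseDeriv_coeff_eq_zero hK 1) n
      (by push_cast; omega)
    change (D (f * g)).coeff n = (f * D g + g * D f).coeff n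
    rw [HahnSeries.coeff_add, h2, h3, h1, add_zero]
  ext n
  refine key n f g fun l => ?_
  rw [mul_comm f, add_comm]
  refine key n (HahnSeries.single l 1) f fun k => ?_
  simp only [D, LaurentSeries.hasseDeriv_single, HahnSeries.single_mul_single,
    Ring.choose_one_right]
  have e1 : l + (k - ((1 : ℕ) : ℤ)) = l + k - ((1 : ℕ) : ℤ) := by ring
  have e2 : k + (l - ((1 : ℕ) : ℤ)) = l + k - ((1 : ℕ) : ℤ) := by ring
  rw [e1, e2, ← HahnSeries.single_add]
  congr 2
  simp [add_comm]

/-- Differentiation of Laurent series. -/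
noncomputable abbrev laurentDerivation : LaurentSeries ℂ →ₗ[ℂ] LaurentSeries ℂ :=
  LaurentSeries.hasseDeriv ℂ 1

lemma laurentDerivation_apply (f : LaurentSeries ℂ) :
    laurentDerivation f = LaurentSeries.hasseDeriv ℂ 1 f := rfl

lemma laurentDerivation_one : laurentDerivation 1 = 0 := by
  rw [← HahnSeries.single_zero_one, LaurentSeries.hasseDeriv_single, Ring.choose_one_right,
    zero_smul, HahnSeries.single_eq_zero]

lemma laurentDerivation_zpow {f : LaurentSeries ℂ} (hf : f ≠ 0) (n : ℤ) :
    laurentDerivation (f ^ n) = n • (f ^ (n - 1) * laurentDerivation f) := by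
  have step : ∀ k : ℤ, laurentDerivation (f ^ (k + 1)) =
      f ^ k * laurentDerivation f + f * laurentDerivation (f ^ k) := fun k => by
    rw [zpow_add_one₀ hf, laurentSeries_derivative_mul]
  induction n using Int.induction_on with
  | zero => rw [zpow_zero, laurentDerivation_one, zero_zsmul]
  | succ i hi =>
    rw [step, hi, add_sub_cancel_right, zpow_sub_one₀ hf]
    simp only [zsmul_eq_mul]
    push_cast
    field_simp
    ring
  | pred i hi =>
    have h := step (-i - 1)
    rw [sub_add_cancel, hi] at h
    have h2 : f * laurentDerivation (f ^ (-(i : ℤ) - 1)) =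
        f * ((-(i : ℤ) - 1) • (f ^ (-(i : ℤ) - 1 - 1) * laurentDerivation f)) := by
      rw [zpow_sub_one₀ hf (-(i : ℤ) - 1)]
      simp only [zsmul_eq_mul] at h ⊢
      push_cast at h ⊢
      have h3 : f * (f ^ (-(i : ℤ) - 1) * f⁻¹) = f ^ (-(i : ℤ) - 1) := by field_simp
      linear_combination -h - (-(i : LaurentSeries ℂ) - 1) * laurentDerivation f * h3
    exact mul_left_cancel₀ hf h2

lemma laurentDerivation_coe (f : PowerSeries ℂ) :
    laurentDerivation (f : LaurentSeries ℂ) =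
      ((PowerSeries.derivative ℂ f : PowerSeries ℂ) : LaurentSeries ℂ) := by
  ext n
  rw [laurentDerivation_apply, LaurentSeries.hasseDeriv_coeff]
  rcases lt_or_ge n 0 with hn | hn
  · rw [coeff_coe_neg _ hn]
    rcases eq_or_ne n (-1) with rfl | h1
    · simp
    · rw [coeff_coe_neg _ (by push_cast; omega), smul_zero]
  · lift n to ℕ using hn
    have : (n : ℤ) + ((1 : ℕ) : ℤ) = ((n + 1 : ℕ) : ℤ) := by push_cast; ring
    rw [this, coeff_coe_nat, coeff_coe_nat, PowerSeries.coeff_derivative, Ring.choose_one_right,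
      zsmul_eq_mul]
    push_cast
    ring

lemma laurentDerivation_onePlus : laurentDerivation onePlus = 1 := by
  rw [onePlus, laurentDerivation_coe]
  simp

lemma onePlus_ne_zero : onePlus ≠ 0 := by
  intro h
  have := congrArg (fun f : LaurentSeries ℂ => f.coeff ((0 : ℕ) : ℤ)) h
  simp only [onePlus, coeff_coe_nat] at this
  simp at this

lemma logSeries_ne_zero : logSeries ≠ 0 := by
  intro h
  have := congrArg (fun f : LaurentSeries ℂ => f.coeff ((1 : ℕ) : ℤ)) h
  simp only [logSeries, coeff_coe_nat] at this
  simp at this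

lemma laurentDerivation_logSeries : laurentDerivation logSeries = onePlus⁻¹ := by
  rw [← mul_eq_one_iff_eq_inv₀ onePlus_ne_zero, logSeries, laurentDerivation_coe, onePlus,
    ← PowerSeries.coe_mul, PowerSeries.deriv_log, ← PowerSeries.coe_one]
  congr 1
  ext n
  rw [mul_add, mul_one, map_add]
  cases n with
  | zero => simp
  | succ n =>
    rw [PowerSeries.coeff_succ_mul_X, PowerSeries.coeff_mk, PowerSeries.coeff_mk,
      PowerSeries.coeff_one, if_neg (Nat.succ_ne_zero n), ← map_add, pow_succ]
    simp

/-- The series `(1 + z) log (1 + z)`. -/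
noncomputable def eulerSeries : LaurentSeries ℂ := logSeries * onePlus

/-- `(1 + z) log (1 + z)` vanishes at `z = 0`. -/
lemma eulerSeries_coeff_zero {i : ℤ} (hi : i < 1) : eulerSeries.coeff i = 0 := by
  rw [eulerSeries, logSeries, onePlus, ← PowerSeries.coe_mul]
  rcases lt_or_ge i 0 with h | h
  · exact coeff_coe_neg _ h
  · have : i = ((0 : ℕ) : ℤ) := by push_cast; omega
    rw [this, coeff_coe_nat]
    simp

lemma eulerSeries_coeff_one : eulerSeries.coeff 1 = 1 := by
  rw [eulerSeries, logSeries, onePlus, ← PowerSeries.coe_mul]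
  have : (1 : ℤ) = ((0 + 1 : ℕ) : ℤ) := rfl
  rw [this, coeff_coe_nat, mul_add, map_add, PowerSeries.coeff_succ_mul_X]
  simp

lemma laurentDerivation_eulerSeries : laurentDerivation eulerSeries = 1 + logSeries := by
  rw [eulerSeries, laurentSeries_derivative_mul, laurentDerivation_onePlus,
    laurentDerivation_logSeries, mul_inv_cancel₀ onePlus_ne_zero]
  ring

/-- The second derivative of `(1 + z) log (1 + z)` is `1 / (1 + z)`, so the higher ones are
multiples of negative powers of `1 + z`; the multiple is read off from the constant coefficient. -/
lemma hasseDeriv_eulerSeries (j : ℕ) : LaurentSeries.hasseDeriv ℂ (j + 2) eulerSeries =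
    eulerSeries.coeff (j + 2 : ℕ) • onePlus ^ (-1 - (j : ℤ)) := by
  have step : ∀ i : ℕ, ((i : ℂ) + 1) • LaurentSeries.hasseDeriv ℂ (i + 1) eulerSeries =
      laurentDerivation (LaurentSeries.hasseDeriv ℂ i eulerSeries) := by
    intro i
    rw [laurentDerivation_apply, LaurentSeries.hasseDeriv_comp, add_comm 1 i, Nat.choose_one_right,
      ← Nat.cast_smul_eq_nsmul ℂ]
    push_cast
    rfl
  suffices h : ∃ c : ℂ, LaurentSeries.hasseDeriv ℂ (j + 2) eulerSeries =
      c • onePlus ^ (-1 - (j : ℤ)) by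
    obtain ⟨c, hc⟩ := h
    have h0 : (LaurentSeries.hasseDeriv ℂ (j + 2) eulerSeries).coeff 0
        = eulerSeries.coeff (j + 2 : ℕ) := by
      rw [LaurentSeries.hasseDeriv_coeff, zero_add, Ring.choose_natCast, Nat.choose_self]
      simp
    have h1 : (onePlus ^ (-1 - (j : ℤ))).coeff 0 = 1 := by
      have e : -1 - (j : ℤ) = -((j + 1 : ℕ) : ℤ) := by push_cast; ring
      have hu : (1 + PowerSeries.X : PowerSeries ℂ) ^ (j + 1) *
          ((1 + PowerSeries.X : PowerSeries ℂ) ^ (j + 1))⁻¹ = 1 :=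
        PowerSeries.mul_inv_cancel _ (by simp)
      have hu' : onePlus ^ (j + 1) *
          ((((1 + PowerSeries.X : PowerSeries ℂ) ^ (j + 1))⁻¹ : PowerSeries ℂ) :
            LaurentSeries ℂ) = 1 := by
        rw [onePlus, ← PowerSeries.coe_pow, ← PowerSeries.coe_mul, hu, PowerSeries.coe_one]
      rw [e, zpow_neg, zpow_natCast, inv_eq_of_mul_eq_one_right hu']
      have : (0 : ℤ) = ((0 : ℕ) : ℤ) := rfl
      rw [this, coeff_coe_nat]
      simp
    rw [hc, HahnSeries.coeff_smul, h1, smul_eq_mul, mul_one] at h0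
    rw [hc, h0]
  induction j with
  | zero =>
    have h1 := step 1
    rw [← laurentDerivation_apply, laurentDerivation_eulerSeries, map_add, laurentDerivation_one, zero_add,
      laurentDerivation_logSeries] at h1
    refine ⟨(((1 : ℕ) : ℂ) + 1)⁻¹, ?_⟩
    rw [eq_inv_smul_iff₀ (by norm_num), h1]
    simp
  | succ j ih =>
    obtain ⟨c, hc⟩ := ih
    have h1 := step (j + 2)
    rw [hc, laurentDerivation_apply, map_smul, ← laurentDerivation_apply,
      laurentDerivation_zpow onePlus_ne_zero, laurentDerivation_onePlus, mul_one, ← Int.cast_smul_eq_zsmul ℂ, smul_smul] at h1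
    have h2 : (((j + 2 : ℕ) : ℂ) + 1) ≠ 0 := by exact_mod_cast Nat.succ_ne_zero (j + 2)
    refine ⟨(((j + 2 : ℕ) : ℂ) + 1)⁻¹ * (c * ((-1 - (j : ℤ) : ℤ) : ℂ)), ?_⟩
    rw [mul_smul, eq_inv_smul_iff₀ h2, h1]
    congr 2
    push_cast
    ring

end Series

/-! ### The modes `a[m]` and the operator `L[0]`. -/

section SquareModes

variable {V M : Type*} [AddCommGroup V] [Module ℂ V] [AddCommGroup M] [Module ℂ M] {𝒱 : VOA V}

/-- `Res_z Y(a, z) f(z) (1 + z) ^ (wt a - 1)`, extended linearly to all `a`. -/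
noncomputable def VOAModule.squareRes (X : VOAModule 𝒱 M) :
    V →ₗ[ℂ] LaurentSeries ℂ →ₗ[ℂ] Module.End ℂ M :=
  gradedMap _ 𝒱.grading fun h =>
    LinearMap.lcomp ℂ _ (LinearMap.mulRight ℂ (onePlus ^ (h - 1))) ∘ₗ resMode X.Y

lemma VOAModule.squareRes_of_mem (X : VOAModule 𝒱 M) {h : ℤ} {a : V}
    (ha : a ∈ weightSpace 𝒱.Y 𝒱.omega h) (f : LaurentSeries ℂ) :
    X.squareRes a f = resMode X.Y a (f * onePlus ^ (h - 1)) := by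
  rw [squareRes, gradedMap_of_mem 𝒱.grading _ ha]
  rfl

lemma VOAModule.squareMode_eq (X : VOAModule 𝒱 M) (a : V) (m : ℤ) (x : M) :
    X.squareMode a m x = X.squareRes a (logSeries ^ m) x := by
  have h := gradedMap_eq_finsum 𝒱.grading
    (fun h => LinearMap.applyₗ x ∘ₗ LinearMap.applyₗ (logSeries ^ m) ∘ₗ
      LinearMap.lcomp ℂ _ (LinearMap.mulRight ℂ (onePlus ^ (h - 1))) ∘ₗ resMode X.Y) a
  have h2 : gradedMap _ 𝒱.grading (fun h => LinearMap.applyₗ x ∘ₗ LinearMap.applyₗ (logSeries ^ m) ∘ₗ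
      LinearMap.lcomp ℂ _ (LinearMap.mulRight ℂ (onePlus ^ (h - 1))) ∘ₗ resMode X.Y) =
      LinearMap.applyₗ x ∘ₗ LinearMap.applyₗ (logSeries ^ m) ∘ₗ X.squareRes := by
    refine ext_of_isInternal 𝒱.grading fun h a ha => ?_
    rw [gradedMap_of_mem 𝒱.grading _ ha]
    simp only [LinearMap.comp_apply, LinearMap.applyₗ_apply_apply, X.squareRes_of_mem ha]
    rfl
  rw [h2] at h
  exact h.symm

/-- The operator `L[0]`, for the vertex operator `Y(ω, z) = ∑ L(n) z ^ (-n - 2)`. -/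
noncomputable def squareWeightOp (Y : V →ₗ[ℂ] VertexOperator ℂ M) (ω : V) : Module.End ℂ M :=
  resMode Y ω eulerSeries

lemma squareWeightOp_sub (Y : V →ₗ[ℂ] VertexOperator ℂ M) (ω : V) (x : M) :
    squareWeightOp Y ω x - vir Y ω 0 x =
      resMode Y ω (eulerSeries - HahnSeries.single 1 1) x := by
  rw [map_sub, LinearMap.sub_apply, resMode_single, one_smul]
  rfl

lemma eulerSeries_sub_coeff {i : ℤ} (hi : i < 2) :
    (eulerSeries - HahnSeries.single 1 1).coeff i = 0 := by
  rw [HahnSeries.coeff_sub]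
  rcases eq_or_ne i 1 with rfl | h
  · simp [eulerSeries_coeff_one]
  · rw [eulerSeries_coeff_zero (by omega), HahnSeries.coeff_single_of_ne h, sub_zero]

/-- Since `(1 + z) log (1 + z) = z + O(z ^ 2)`, the difference `L[0] - L(0)` is a combination of
operators `L(k)` with `k ≥ 1`, which lower the weight. -/
lemma squareWeightOp_sub_mem {Y : V →ₗ[ℂ] VertexOperator ℂ M} {ω : V} {c : ℂ}
    (h : VirasoroRelations (vir Y ω) c) {μ : ℂ} {x : M} (hx : x ∈ weightSpace Y ω μ) :
    squareWeightOp Y ω x - μ • x ∈ ⨆ k : ℕ, weightSpace Y ω (μ - (k + 1)) := by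
  rw [← mem_weightSpace.1 hx, squareWeightOp_sub]
  obtain ⟨N, hN⟩ := mode_truncation Y ω x
  rw [resMode_eq_sum Y hN (fun i hi => eulerSeries_sub_coeff hi)]
  refine Submodule.sum_mem _ fun i hi => Submodule.smul_mem _ _ ?_
  have hi2 : 2 ≤ i := (Finset.mem_Ico.1 hi).1
  obtain ⟨k, rfl⟩ : ∃ k : ℕ, i = k + 1 + 1 := ⟨(i - 2).toNat, by omega⟩
  have h1 := vir_mem_weightSpace h hx ((k : ℤ) + 1)
  refine Submodule.mem_iSup_of_mem k ?_
  convert h1 using 2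
  · push_cast
    ring
  · rfl

/-- An operator that is triangular for a grading that is bounded below is diagonalizable. -/
lemma le_iSup_eigenspace_of_triangular {E : ℂ → Submodule ℂ M} {B : Module.End ℂ M}
    (hB : ∀ μ, ∀ x ∈ E μ, B x - μ • x ∈ ⨆ k : ℕ, E (μ - (k + 1))) (N : ℕ) : ∀ μ : ℂ,
    (∀ n : ℕ, N ≤ n → E (μ - n) = ⊥) →
      E μ ≤ ⨆ (k : ℕ) (_ : E (μ - k) ≠ ⊥), B.eigenspace (μ - k) := by
  induction N with
  | zero =>
    intro μ h
    have := h 0 le_rfl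
    rw [Nat.cast_zero, sub_zero] at this
    rw [this]
    exact bot_le
  | succ N ih =>
    intro μ hμ x hx
    by_cases hE : E μ = ⊥
    · rw [hE] at hx
      rw [(Submodule.mem_bot ℂ).1 hx]
      exact zero_mem _
    set G : Submodule ℂ M := ⨆ (k : ℕ) (_ : E (μ - (k + 1)) ≠ ⊥), B.eigenspace (μ - (k + 1)) with hG
    have h1 : ∀ k : ℕ, E (μ - (k + 1)) ≤ G := by
      intro k
      refine (ih (μ - (k + 1)) fun n hn => ?_).trans ?_
      · have := hμ (n + k + 1) (by omega)
        rw [← this]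
        congr 1
        push_cast
        ring
      · refine iSup_le fun i => iSup_le fun hi => ?_
        have e : μ - (k + 1) - i = μ - (((k + i : ℕ) : ℂ) + 1) := by push_cast; ring
        rw [e] at hi ⊢
        exact le_iSup₂_of_le (k + i) hi le_rfl
    have h2 : B x - μ • x ∈ G := (iSup_le h1) (hB μ x hx)
    -- On `G` the operator `B - μ` has the nonzero eigenvalues `-(k + 1)`, so some `y ∈ G` satisfies
    -- `(B - μ) y = (B - μ) x`, and `x - y` is an eigenvector for `μ`.
    have h3 : G ≤ Submodule.map (B - μ • (1 : Module.End ℂ M)) G := by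
      refine iSup_le fun k => iSup_le fun hk => ?_
      intro w hw
      have hk0 : ((k : ℂ) + 1) ≠ 0 := by exact_mod_cast Nat.succ_ne_zero k
      refine ⟨(-((k : ℂ) + 1)⁻¹) • w, Submodule.smul_mem _ _
        (Submodule.mem_iSup_of_mem k (Submodule.mem_iSup_of_mem hk hw)), ?_⟩
      rw [map_smul, LinearMap.sub_apply, Module.End.mem_eigenspace_iff.1 hw, LinearMap.smul_apply,
        Module.End.one_apply, ← sub_smul, smul_smul]
      have : -((k : ℂ) + 1)⁻¹ * (μ - (k + 1) - μ) = 1 := by field_simp; ring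
      rw [this, one_smul]
    obtain ⟨y, hy, hyx⟩ := h3 h2
    have h4 : x - y ∈ B.eigenspace μ := by
      rw [Module.End.mem_eigenspace_iff, map_sub, smul_sub]
      simp only [LinearMap.sub_apply, LinearMap.smul_apply, Module.End.one_apply] at hyx
      have : B x - B y - (μ • x - μ • y) = 0 := by
        rw [sub_sub_sub_comm, hyx, sub_self]
      exact sub_eq_zero.1 this
    rw [← sub_add_cancel x y]
    refine add_mem ?_ ?_
    · refine Submodule.mem_iSup_of_mem 0 ?_
      rw [Nat.cast_zero, sub_zero]
      exact Submodule.mem_iSup_of_mem hE h4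
    · have h5 : G ≤ ⨆ (k : ℕ) (_ : E (μ - k) ≠ ⊥), B.eigenspace (μ - k) := by
        refine iSup_le fun k => iSup_le fun hk => ?_
        have e : μ - ((k : ℂ) + 1) = μ - ((k + 1 : ℕ) : ℂ) := by push_cast; ring
        rw [e] at hk ⊢
        exact le_iSup₂_of_le (k + 1) hk le_rfl
      exact h5 hy

lemma VOA.iSup_eigenspace_squareWeightOp (𝒱 : VOA V) :
    ⨆ μ : ℂ, (squareWeightOp 𝒱.Y 𝒱.omega).eigenspace μ = ⊤ := by
  rw [eq_top_iff, ← 𝒱.grading.submodule_iSup_eq_top]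
  refine iSup_le fun n => ?_
  obtain ⟨N, hN⟩ := 𝒱.bounded_below
  refine (le_iSup_eigenspace_of_triangular (E := weightSpace 𝒱.Y 𝒱.omega)
    (B := squareWeightOp 𝒱.Y 𝒱.omega) (fun μ x hx => squareWeightOp_sub_mem 𝒱.virasoro hx)
    (n - N + 1).toNat n fun k hk => ?_).trans
    (iSup_le fun k => iSup_le fun _ => le_iSup_of_le _ le_rfl)
  have := hN (n - k) (by omega)
  rwa [Int.cast_sub, Int.cast_natCast] at this

lemma VOAModule.iSup_eigenspace_squareWeightOp (X : VOAModule 𝒱 M) :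
    ⨆ (μ : ℂ) (_ : weightSpace X.Y 𝒱.omega μ ≠ ⊥), (squareWeightOp X.Y 𝒱.omega).eigenspace μ = ⊤ := by
  rw [eq_top_iff, ← X.grading.submodule_iSup_eq_top]
  refine iSup_le fun μ => ?_
  obtain ⟨N, hN⟩ := X.bounded_below μ
  exact (le_iSup_eigenspace_of_triangular (E := weightSpace X.Y 𝒱.omega)
    (B := squareWeightOp X.Y 𝒱.omega) (fun μ x hx => squareWeightOp_sub_mem X.virasoro hx)
    N μ hN).trans (iSup_le fun k => iSup_le fun hk => le_iSup₂_of_le _ hk le_rfl)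

/-- Eigenspaces are independent, and those at the weights of the module already span everything. -/
lemma VOAModule.eigenspace_squareWeightOp_eq_bot (X : VOAModule 𝒱 M) {μ : ℂ}
    (h : weightSpace X.Y 𝒱.omega μ = ⊥) : (squareWeightOp X.Y 𝒱.omega).eigenspace μ = ⊥ := by
  have h1 := (Module.End.eigenspaces_iSupIndep (squareWeightOp X.Y 𝒱.omega)) μ
  rw [← disjoint_self]
  refine h1.mono_right (le_top.trans ?_)
  rw [← X.iSup_eigenspace_squareWeightOp]
  refine iSup_le fun ν => iSup_le fun hν => ?_
  have : ν ≠ μ := by rintro rfl; exact hν h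
  exact le_iSup₂_of_le ν this le_rfl

/-- `[L[0], a[m]] = (L[0] a)[m] - (m + 1) a[m]`. -/
theorem VOAModule.squareWeightOp_commutator (X : VOAModule 𝒱 M) (a : V) (m : ℤ) (x : M) :
    squareWeightOp X.Y 𝒱.omega (X.squareRes a (logSeries ^ m) x) -
      X.squareRes a (logSeries ^ m) (squareWeightOp X.Y 𝒱.omega x) =
      X.squareRes (squareWeightOp 𝒱.Y 𝒱.omega a) (logSeries ^ m) x -
        ((m : ℂ) + 1) • X.squareRes a (logSeries ^ m) x := by
  let E (y : M) : V →ₗ[ℂ] M := LinearMap.applyₗ y ∘ₗ LinearMap.applyₗ (logSeries ^ m) ∘ₗ X.squareRes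
  suffices h : squareWeightOp X.Y 𝒱.omega ∘ₗ E x - E (squareWeightOp X.Y 𝒱.omega x) =
      E x ∘ₗ squareWeightOp 𝒱.Y 𝒱.omega - ((m : ℂ) + 1) • E x from LinearMap.congr_fun h a
  refine ext_of_isInternal 𝒱.grading fun h a ha => ?_
  simp only [E, LinearMap.sub_apply, LinearMap.comp_apply, LinearMap.applyₗ_apply_apply,
    LinearMap.smul_apply, X.squareRes_of_mem ha]
  obtain ⟨N, hN⟩ := X.resMode_commutator 𝒱.omega a
  obtain ⟨T, hT⟩ := mode_truncation 𝒱.Y 𝒱.omega a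
  set J := N + T.toNat
  have h1 := hN (J + 2) (by omega) eulerSeries (logSeries ^ m * onePlus ^ (h - 1)) x
  have hT' : ∀ n : ℤ, (J : ℤ) + 2 ≤ n → mode 𝒱.Y 𝒱.omega n a = 0 := fun n hn => hT n (by omega)
  have h2 : squareWeightOp 𝒱.Y 𝒱.omega a = h • a + ∑ j ∈ Finset.range J,
      eulerSeries.coeff (j + 2 : ℕ) • mode 𝒱.Y 𝒱.omega (j + 2 : ℕ) a := by
    have e := squareWeightOp_sub 𝒱.Y 𝒱.omega a
    rw [mem_weightSpace.1 ha, resMode_eq_sum 𝒱.Y hT' (fun i hi => eulerSeries_sub_coeff hi),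
      sub_eq_iff_eq_add', Int.cast_smul_eq_zsmul] at e
    rw [e]
    congr 1
    symm
    refine Finset.sum_bij (fun (j : ℕ) _ => ((j + 2 : ℕ) : ℤ)) ?_ ?_ ?_ ?_
    · intro j hj
      have := Finset.mem_range.1 hj
      exact Finset.mem_Ico.2 ⟨by omega, by omega⟩
    · intro i _ j _ hij
      omega
    · intro i hi
      have := Finset.mem_Ico.1 hi
      exact ⟨(i - 2).toNat, Finset.mem_range.2 (by omega), by omega⟩
    · intro j _
      rw [HahnSeries.coeff_sub, HahnSeries.coeff_single_of_ne (by omega), sub_zero]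
  have h3 : ∀ j : ℕ, mode 𝒱.Y 𝒱.omega (j + 2 : ℕ) a ∈
      weightSpace 𝒱.Y 𝒱.omega ((h - 1 - j : ℤ) : ℂ) := by
    intro j
    have := vir_mem_weightSpace 𝒱.virasoro ha ((j : ℤ) + 1)
    have e : ((j + 2 : ℕ) : ℤ) = (j : ℤ) + 1 + 1 := by push_cast; ring
    rw [e]
    convert this using 2
    · push_cast
      ring
    · rfl
  -- In the commutator sum, `j = 0` is the `L(-1)` term, `j = 1` contributes `h • a`, and the terms
  -- `j ≥ 2` reassemble `(L[0] - L(0)) a`.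
  rw [squareWeightOp, h1, Finset.sum_range_succ', Finset.sum_range_succ', h2]
  have e0 : mode 𝒱.Y 𝒱.omega ((0 : ℕ) : ℤ) a = vir 𝒱.Y 𝒱.omega (-1) a := rfl
  have e1 : mode 𝒱.Y 𝒱.omega ((0 + 1 : ℕ) : ℤ) a = h • a :=
    (mem_weightSpace.1 ha).trans (Int.cast_smul_eq_zsmul ℂ h a)
  rw [e0, e1, X.resMode_derivative, zero_add, LaurentSeries.hasseDeriv_zero, LinearMap.id_apply]
  rw [map_add, map_sum, LinearMap.add_apply, LinearMap.add_apply, LinearMap.sum_apply,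
    LinearMap.sum_apply, map_zsmul, map_zsmul, LinearMap.smul_apply, LinearMap.smul_apply,
    LinearMap.smul_apply, LinearMap.smul_apply, X.squareRes_of_mem ha]
  -- The vector `L(j + 1) a` has weight `h - 1 - j`. The power of `1 + z` from
  -- `hasseDeriv_eulerSeries` is exactly what changes the factor for weight `h` into the one for
  -- this lower weight.
  have e2 : ∀ j ∈ Finset.range J,
      resMode X.Y (mode 𝒱.Y 𝒱.omega ((j + 1 + 1 : ℕ) : ℤ) a)
        (LaurentSeries.hasseDeriv ℂ (j + 1 + 1) eulerSeries *
          (logSeries ^ m * onePlus ^ (h - 1))) x =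
      X.squareRes (eulerSeries.coeff (j + 2 : ℕ) • mode 𝒱.Y 𝒱.omega (j + 2 : ℕ) a)
        (logSeries ^ m) x := by
    intro j _
    rw [hasseDeriv_eulerSeries, map_smul, LinearMap.smul_apply, LinearMap.smul_apply,
      X.squareRes_of_mem (h3 j), smul_mul_assoc, map_smul, LinearMap.smul_apply]
    congr 3
    have : h - 1 - (j : ℤ) - 1 = (-1 - (j : ℤ)) + (h - 1) := by ring
    rw [this, zpow_add₀ onePlus_ne_zero]
    ring
  rw [Finset.sum_congr rfl e2]
  -- The terms with the extra factor `logSeries` in `e3` and in `h` times `e5` cancel; `h a[m] - (m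
  -- + 1) a[m]` remains.
  have e3 : LaurentSeries.hasseDeriv ℂ 1 (eulerSeries * (logSeries ^ m * onePlus ^ (h - 1))) =
      ((m : ℂ) + 1) • (logSeries ^ m * onePlus ^ (h - 1)) +
        h • (logSeries * (logSeries ^ m * onePlus ^ (h - 1))) := by
    have : eulerSeries * (logSeries ^ m * onePlus ^ (h - 1)) =
        logSeries ^ (m + 1) * onePlus ^ h := by
      rw [eulerSeries, zpow_add_one₀ logSeries_ne_zero, zpow_sub_one₀ onePlus_ne_zero]
      field_simp [onePlus_ne_zero]
    rw [this, laurentSeries_derivative_mul, laurentDerivation_zpow logSeries_ne_zero,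
      laurentDerivation_zpow onePlus_ne_zero, laurentDerivation_onePlus, laurentDerivation_logSeries,
      add_sub_cancel_right]
    have e4 : ((m : ℂ) + 1) • (logSeries ^ m * onePlus ^ (h - 1)) =
        (m + 1) • (logSeries ^ m * onePlus ^ (h - 1)) := by
      rw [← Int.cast_smul_eq_zsmul ℂ]
      push_cast
      rfl
    rw [e4]
    simp only [zsmul_eq_mul]
    rw [zpow_add_one₀ logSeries_ne_zero, zpow_sub_one₀ onePlus_ne_zero]
    push_cast
    ring
  have e5 : LaurentSeries.hasseDeriv ℂ 1 eulerSeries * (logSeries ^ m * onePlus ^ (h - 1)) =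
      (logSeries ^ m * onePlus ^ (h - 1)) + logSeries * (logSeries ^ m * onePlus ^ (h - 1)) := by
    rw [← laurentDerivation_apply, laurentDerivation_eulerSeries]
    ring
  rw [e3, e5]
  generalize (∑ j ∈ Finset.range J, X.squareRes (eulerSeries.coeff (j + 2 : ℕ) •
    mode 𝒱.Y 𝒱.omega (j + 2 : ℕ) a) (logSeries ^ m) x) = S
  simp only [map_add, map_smul, map_zsmul, LinearMap.add_apply, LinearMap.smul_apply, smul_add]
  abel

end SquareModes

/-! ### Binomial expansions of powers of `1 + z`. -/

section SeriesIdentities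

lemma onePlus_zpow_eq (z : ℤ) :
    onePlus ^ z = ((PowerSeries.binomialSeries ℂ z : PowerSeries ℂ) : LaurentSeries ℂ) := by
  have h : ∀ n : ℕ, onePlus ^ n =
      ((PowerSeries.binomialSeries ℂ (n : ℤ) : PowerSeries ℂ) : LaurentSeries ℂ) := fun n => by
    rw [PowerSeries.binomialSeries_nat, onePlus, ← PowerSeries.coe_pow]
  rcases Int.eq_nat_or_neg z with ⟨n, rfl | rfl⟩
  · rw [zpow_natCast, h]
  · rw [zpow_neg, zpow_natCast]
    refine inv_eq_of_mul_eq_one_right ?_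
    rw [h, ← PowerSeries.coe_mul, ← PowerSeries.binomialSeries_add, add_neg_cancel,
      PowerSeries.binomialSeries_zero, PowerSeries.coe_one]

lemma onePlus_zpow_coeff (z : ℤ) (j : ℕ) : (onePlus ^ z).coeff j = (Ring.choose z j : ℤ) := by
  rw [onePlus_zpow_eq, coeff_coe_nat, PowerSeries.binomialSeries_coeff]
  simp

lemma onePlus_zpow_coeff_neg (z : ℤ) {i : ℤ} (hi : i < 0) : (onePlus ^ z).coeff i = 0 := by
  rw [onePlus_zpow_eq, coeff_coe_neg _ hi]

/-- The Laurent series `z`. -/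
noncomputable abbrev zSeries : LaurentSeries ℂ := HahnSeries.single 1 1

lemma zSeries_ne_zero : zSeries ≠ 0 := by
  simp [zSeries]

lemma onePlus_eq : onePlus = 1 + zSeries := by
  rw [onePlus, PowerSeries.coe_add, PowerSeries.coe_one, PowerSeries.coe_X]

lemma zSeries_zpow (n : ℤ) : zSeries ^ n = HahnSeries.single n 1 := by
  have h : ∀ n : ℕ, zSeries ^ n = HahnSeries.single (n : ℤ) 1 := fun n => by
    rw [zSeries, HahnSeries.single_pow]
    simp
  rcases Int.eq_nat_or_neg n with ⟨n, rfl | rfl⟩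
  · rw [zpow_natCast, h]
  · rw [zpow_neg, zpow_natCast, h]
    refine inv_eq_of_mul_eq_one_right ?_
    rw [HahnSeries.single_mul_single, add_neg_cancel, mul_one, HahnSeries.single_zero_one]

/-- The expansion of `(1 + z) ^ h / z ^ 2`. -/
lemma onePlus_pow_div_sq (h : ℕ) :
    (onePlus * zSeries ^ (-2 : ℤ)) * onePlus ^ ((h : ℤ) - 1) = zSeries ^ (-2 : ℤ) +
      (h : ℂ) • zSeries ^ (-1 : ℤ) +
        ∑ q ∈ Finset.range h, (q : ℂ) • onePlus ^ ((h : ℤ) - 1 + (-(q : ℤ))) := by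
  have key : ∀ h : ℕ, onePlus ^ (h : ℤ) = 1 + (h : LaurentSeries ℂ) * zSeries +
      zSeries ^ 2 * ∑ q ∈ Finset.range h, (q : LaurentSeries ℂ) *
        onePlus ^ ((h : ℤ) - 1 + (-(q : ℤ))) := by
    intro h
    induction h with
    | zero => simp
    | succ h ih =>
      have e : ∀ q ∈ Finset.range h, (q : LaurentSeries ℂ) *
          onePlus ^ (((h + 1 : ℕ) : ℤ) - 1 + (-(q : ℤ))) =
          onePlus * ((q : LaurentSeries ℂ) * onePlus ^ ((h : ℤ) - 1 + (-(q : ℤ)))) := by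
        intro q _
        have : ((h + 1 : ℕ) : ℤ) - 1 + (-(q : ℤ)) = (h : ℤ) - 1 + (-(q : ℤ)) + 1 := by
          push_cast; ring
        rw [this, zpow_add_one₀ onePlus_ne_zero]
        ring
      have e2 : ((h + 1 : ℕ) : ℤ) - 1 + (-(h : ℤ)) = 0 := by push_cast; ring
      rw [Finset.sum_range_succ, Finset.sum_congr rfl e, ← Finset.mul_sum, e2, zpow_zero]
      push_cast
      rw [zpow_add_one₀ onePlus_ne_zero, ih, onePlus_eq]
      ring
  have hz := zSeries_ne_zero
  have h1 := key h
  have e3 : ∀ (c : ℕ) (f : LaurentSeries ℂ), (c : ℂ) • f = (c : LaurentSeries ℂ) * f := by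
    intro c f
    rw [← HahnSeries.C_mul_eq_smul, map_natCast]
  simp only [e3]
  have e4 : onePlus * zSeries ^ (-2 : ℤ) * onePlus ^ ((h : ℤ) - 1) =
      zSeries ^ (-2 : ℤ) * onePlus ^ (h : ℤ) := by
    rw [zpow_sub_one₀ onePlus_ne_zero]
    field_simp [onePlus_ne_zero]
  have e5 : zSeries ^ (-2 : ℤ) * zSeries ^ 2 = 1 := by
    rw [← zpow_natCast, ← zpow_add₀ hz]; simp
  have e6 : zSeries ^ (-2 : ℤ) * zSeries = zSeries ^ (-1 : ℤ) := by
    rw [← zpow_add_one₀ hz]; simp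
  rw [e4, h1, mul_add, mul_add, mul_one, ← mul_assoc _ (zSeries ^ 2), e5, one_mul,
    mul_left_comm, e6]

end SeriesIdentities

/-! ### Lambert series and the reindexing of two-sided sums. -/

section Lambert

/-- `q ^ p / (1 - q ^ p)`. -/
noncomputable def lambertTerm (p : ℕ) : PowerSeries ℂ := lambert (Pi.single p 1)

lemma coeff_lambertTerm (p n : ℕ) :
    PowerSeries.coeff n (lambertTerm p) = if p ∣ n ∧ n ≠ 0 then 1 else 0 := by
  rw [lambertTerm, lambert, PowerSeries.coeff_mk]
  simp [Pi.single_apply]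

lemma lambertTerm_mul {p : ℕ} (hp : 1 ≤ p) :
    lambertTerm p * (1 - PowerSeries.X ^ p) = PowerSeries.X ^ p := by
  ext n
  rw [mul_sub, mul_one, map_sub, PowerSeries.coeff_mul_X_pow', PowerSeries.coeff_X_pow,
    coeff_lambertTerm, coeff_lambertTerm]
  by_cases h1 : p ≤ n
  · rw [if_pos h1]
    obtain ⟨k, rfl⟩ := Nat.exists_eq_add_of_le h1
    rw [Nat.add_sub_cancel_left]
    by_cases h2 : p ∣ k
    · rw [if_pos ⟨by simpa using h2, by omega⟩]
      by_cases h3 : k = 0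
      · simp [h3]
      · rw [if_pos ⟨h2, h3⟩, if_neg (by omega), sub_self]
    · rw [if_neg (by simpa using fun h => absurd h h2), if_neg (fun h => h2 h.1), sub_zero, if_neg]
      rintro h
      apply h2
      have : k = 0 := by omega
      simp [this]
  · have h4 : ¬(p ∣ n ∧ n ≠ 0) := fun ⟨h2, h3⟩ =>
      h1 (Nat.le_of_dvd (Nat.pos_of_ne_zero h3) h2)
    rw [if_neg h1, if_neg h4, if_neg (by omega), sub_zero]

/-- The hypothesis is the form in which cyclicity of the trace and the commutator formula are
combined; solving it means dividing by `1 - q ^ p`. -/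
lemma eq_lambertTerm_mul {p : ℕ} (hp : 1 ≤ p) {t s : PowerSeries ℂ}
    (h : t = PowerSeries.X ^ p * (t + s)) : t = lambertTerm p * s := by
  have h1 : (1 - PowerSeries.X ^ p : PowerSeries ℂ) ≠ 0 := by
    intro h0
    have := lambertTerm_mul hp
    rw [h0, mul_zero] at this
    exact pow_ne_zero p PowerSeries.X_ne_zero this.symm
  refine mul_right_cancel₀ h1 ?_
  calc t * (1 - PowerSeries.X ^ p) = PowerSeries.X ^ p * s := by linear_combination h
    _ = lambertTerm p * (1 - PowerSeries.X ^ p) * s := by rw [lambertTerm_mul hp]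
    _ = _ := by ring

/-- The series `lambertTerm p` starts at `q ^ p`, so only `p ≤ n` matter and no infinite sum of
power series is needed. -/
lemma coeff_lambert_mul (c : ℕ → ℂ) (g : PowerSeries ℂ) (n : ℕ) :
    PowerSeries.coeff n (lambert c * g) =
      ∑ p ∈ Finset.Icc 1 n, c p * PowerSeries.coeff n (lambertTerm p * g) := by
  simp only [PowerSeries.coeff_mul, Finset.mul_sum]
  rw [Finset.sum_comm]
  refine Finset.sum_congr rfl fun x hx => ?_
  have hx1 := Finset.HasAntidiagonal.mem_antidiagonal.1 hx
  simp only [coeff_lambertTerm, lambert, PowerSeries.coeff_mk]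
  rw [Finset.sum_mul]
  refine Finset.sum_subset_zero_on_sdiff (s₁ := x.1.divisors) ?_ ?_ ?_
  · intro d hd
    have h1 := Nat.divisor_le hd
    have h2 := Nat.pos_of_mem_divisors hd
    exact Finset.mem_Icc.2 ⟨h2, by omega⟩
  · intro d hd
    have hd' := (Finset.mem_sdiff.1 hd).2
    rw [Nat.mem_divisors] at hd'
    rw [if_neg hd']
    ring
  · intro d hd
    rw [if_pos (Nat.mem_divisors.1 hd), one_mul]

/-- Reindexing of the sum of a sequence over all integers that uses one expression far to the left
and another one to the right. -/
lemma sum_range_shift {T' : ℕ → ℂ} {T : ℤ → ℂ} {n : ℕ} (hT' : ∀ p, n < p → T' p = 0)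
    (hT : ∀ k : ℤ, n < k → T k = 0) (h N : ℕ) (hN : n + h + 1 ≤ N) :
    ∑ i ∈ Finset.range N, (T' (h + i) + T (i + 1 - h)) =
      T' 0 + ∑ p ∈ Finset.Icc 1 n, (T' p + T p) +
        ∑ q ∈ Finset.range h, (T (-(q : ℤ)) - T' q) := by
  -- Raising `h` by one drops the term `T' h` on one side and adds `T (-h)` on the other; the sum
  -- over `q` records these changes.
  induction h with
  | zero =>
    have e : ∀ i : ℕ, T' (0 + i) + T ((i : ℤ) + 1 - (0 : ℕ)) = T' i + T ((i + 1 : ℕ) : ℤ) := by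
      intro i
      rw [zero_add]
      push_cast
      rw [sub_zero]
    simp only [e]
    rw [Finset.range_zero, Finset.sum_empty, add_zero, Finset.sum_add_distrib,
      Finset.sum_add_distrib, ← add_assoc]
    have r1 : ∑ i ∈ Finset.range N, T' i = T' 0 + ∑ p ∈ Finset.Icc 1 n, T' p := by
      obtain ⟨M, rfl⟩ : ∃ M, N = M + 1 := ⟨N - 1, by omega⟩
      rw [Finset.sum_range_succ', add_comm, Finset.range_eq_Ico, Finset.sum_Ico_add' T' 0 M 1]
      congr 1
      symm
      refine Finset.sum_subset (fun p hp => ?_) fun p hp hp' => hT' p ?_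
      · have := Finset.mem_Icc.1 hp; exact Finset.mem_Ico.2 ⟨by omega, by omega⟩
      · have := Finset.mem_Ico.1 hp
        by_contra hc
        exact hp' (Finset.mem_Icc.2 ⟨by omega, by omega⟩)
    have r2 : ∑ i ∈ Finset.range N, T ((i + 1 : ℕ) : ℤ) = ∑ p ∈ Finset.Icc 1 n, T p := by
      rw [Finset.range_eq_Ico, Finset.sum_Ico_add' (fun i : ℕ => T i) 0 N 1]
      symm
      refine Finset.sum_subset (fun p hp => ?_) fun p hp hp' => hT p ?_
      · have := Finset.mem_Icc.1 hp; exact Finset.mem_Ico.2 ⟨by omega, by omega⟩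
      · have := Finset.mem_Ico.1 hp
        by_contra hc
        exact hp' (Finset.mem_Icc.2 ⟨by omega, by omega⟩)
    rw [r1, r2]
  | succ h ih =>
    have h1 := ih (by omega)
    rw [Finset.sum_range_succ _ h, ← add_assoc, ← h1, Finset.sum_add_distrib,
      Finset.sum_add_distrib]
    have r1 : ∑ i ∈ Finset.range N, T' (h + 1 + i) + T' h = ∑ i ∈ Finset.range N, T' (h + i) := by
      have e1 := Finset.sum_range_succ (fun i => T' (h + i)) N
      have e2 := Finset.sum_range_succ' (fun i => T' (h + i)) N
      rw [e1, hT' (h + N) (by omega), add_zero] at e2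
      rw [e2, add_zero]
      congr 1
      refine Finset.sum_congr rfl fun i _ => ?_
      congr 1
      ring
    have r2 : ∑ i ∈ Finset.range N, T ((i : ℤ) + 1 - (h + 1 : ℕ)) =
        ∑ i ∈ Finset.range N, T ((i : ℤ) + 1 - h) + T (-(h : ℤ)) := by
      have e1 := Finset.sum_range_succ (fun i : ℕ => T ((i : ℤ) - h)) N
      have e2 := Finset.sum_range_succ' (fun i : ℕ => T ((i : ℤ) - h)) N
      rw [e1, hT (N - h) (by omega), add_zero] at e2
      have e3 : ∀ i : ℕ, T ((i : ℤ) + 1 - (h + 1 : ℕ)) = T ((i : ℤ) - h) := fun i => by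
        congr 1; push_cast; ring
      simp only [e3]
      rw [e2]
      congr 1
      simp
    rw [r2, ← r1]
    ring

end Lambert

/-! ### Traces of diagonal blocks and their cyclicity. -/

section BlockTrace

variable {V W : Type*} [AddCommGroup V] [Module ℂ V] [AddCommGroup W] [Module ℂ W] {𝒱 : VOA V}

/-- The trace of the diagonal block of an operator on a weight space. -/
noncomputable def blockTrace (X : VOAModule 𝒱 W) (ν : ℂ) : Module.End ℂ W →ₗ[ℂ] ℂ where
  toFun f := LinearMap.trace ℂ (weightSpace X.Y 𝒱.omega ν)
    (component _ X.grading ν ∘ₗ f ∘ₗ (weightSpace X.Y 𝒱.omega ν).subtype)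
  map_add' f g := by rw [LinearMap.add_comp, LinearMap.comp_add, map_add]
  map_smul' c f := by rw [LinearMap.smul_comp, LinearMap.comp_smul, map_smul, RingHom.id_apply]

lemma blockTrace_congr (X : VOAModule 𝒱 W) {ν : ℂ} {f g : Module.End ℂ W}
    (h : ∀ x ∈ weightSpace X.Y 𝒱.omega ν, f x = g x) : blockTrace X ν f = blockTrace X ν g := by
  have : f ∘ₗ (weightSpace X.Y 𝒱.omega ν).subtype = g ∘ₗ (weightSpace X.Y 𝒱.omega ν).subtype := by
    ext x
    exact h x x.2
  simp only [blockTrace, LinearMap.coe_mk, AddHom.coe_mk, this]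

lemma blockTrace_mul_comm (X : VOAModule 𝒱 W) {ν ν' : ℂ} {f g : Module.End ℂ W}
    (hf : ∀ x ∈ weightSpace X.Y 𝒱.omega ν, f x ∈ weightSpace X.Y 𝒱.omega ν')
    (hg : ∀ x ∈ weightSpace X.Y 𝒱.omega ν', g x ∈ weightSpace X.Y 𝒱.omega ν) :
    blockTrace X ν (g * f) = blockTrace X ν' (f * g) := by
  have := X.finite ν
  have := X.finite ν'
  have h1 : component _ X.grading ν ∘ₗ (g * f) ∘ₗ (weightSpace X.Y 𝒱.omega ν).subtype =
      (g.restrict hg) ∘ₗ (f.restrict hf) := by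
    ext x
    simp [component_of_mem X.grading (hg _ (hf _ x.2))]
  have h2 : component _ X.grading ν' ∘ₗ (f * g) ∘ₗ (weightSpace X.Y 𝒱.omega ν').subtype =
      (f.restrict hf) ∘ₗ (g.restrict hg) := by
    ext x
    simp [component_of_mem X.grading (hf _ (hg _ x.2))]
  simp only [blockTrace, LinearMap.coe_mk, AddHom.coe_mk, h1, h2]
  exact LinearMap.trace_comp_comm' _ _

lemma blockTrace_eq_zero (X : VOAModule 𝒱 W) {ν : ℂ} {f : Module.End ℂ W}
    (h : ∀ x ∈ weightSpace X.Y 𝒱.omega ν, f x = 0) : blockTrace X ν f = 0 := by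
  rw [blockTrace_congr X (g := 0) h, map_zero]

end BlockTrace

/-! ### Traces of products of two modes, and the traces of `o(a(-1) u)` and `o(a(-2) u)`. -/

section TraceRecursion

variable {V U W : Type*} [AddCommGroup V] [Module ℂ V] [AddCommGroup U] [Module ℂ U]
  [AddCommGroup W] [Module ℂ W] {𝒱 : VOA V} {XU : VOAModule 𝒱 U} {XW : VOAModule 𝒱 W}

/-- The zero mode as a linear map. -/
noncomputable def IntertwiningOperator.zeroModeHom (I : IntertwiningOperator XU XW XW) :
    U →ₗ[ℂ] Module.End ℂ W :=
  gradedMap _ XU.grading fun μ => I.coeff (μ - 1)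

lemma IntertwiningOperator.zeroMode_eq (I : IntertwiningOperator XU XW XW) (u : U) :
    I.zeroMode u = I.zeroModeHom u :=
  (gradedMap_eq_finsum XU.grading _ u).symm

lemma IntertwiningOperator.zeroModeHom_of_mem (I : IntertwiningOperator XU XW XW) {u : U} {μ : ℂ}
    (hu : u ∈ weightSpace XU.Y 𝒱.omega μ) : I.zeroModeHom u = I.coeff (μ - 1) u :=
  gradedMap_of_mem XU.grading _ hu

/-- The formal trace function `∑ tr_{W_{s + n}} o(u) q ^ n` of the weights in `s + ℕ`. -/
noncomputable def IntertwiningOperator.traceSeries (I : IntertwiningOperator XU XW XW) (s : ℂ) :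
    U →ₗ[ℂ] PowerSeries ℂ where
  toFun u := PowerSeries.mk fun n => blockTrace XW (s + n) (I.zeroModeHom u)
  map_add' u v := by ext n; simp
  map_smul' c u := by ext n; simp

lemma IntertwiningOperator.coeff_traceSeries (I : IntertwiningOperator XU XW XW) (s : ℂ) (u : U)
    (n : ℕ) : PowerSeries.coeff n (I.traceSeries s u) =
      blockTrace XW (s + n) (I.zeroModeHom u) := by
  simp [traceSeries]

/-- `s` is below or at the bottom of the weights in `s + ℤ`. -/
def VOAModule.IsLowerBound (X : VOAModule 𝒱 W) (s : ℂ) : Prop :=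
  ∀ n : ℤ, n < 0 → weightSpace X.Y 𝒱.omega (s + n) = ⊥

/-- The series `∑ tr_{W_{s + n}} u(wt u - 1 - k) a(wt a - 1 + k) q ^ n`. -/
noncomputable def IntertwiningOperator.rightTrace (I : IntertwiningOperator XU XW XW) (s : ℂ)
    (h : ℕ) (μ : ℂ) (a : V) (u : U) (k : ℤ) : PowerSeries ℂ :=
  PowerSeries.mk fun n => blockTrace XW (s + n) (I.coeff (μ - 1 - k) u * mode XW.Y a (h - 1 + k))

/-- The series `∑ tr_{W_{s + n}} a(wt a - 1 + k) u(wt u - 1 - k) q ^ n`. -/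
noncomputable def IntertwiningOperator.leftTrace (I : IntertwiningOperator XU XW XW) (s : ℂ)
    (h : ℕ) (μ : ℂ) (a : V) (u : U) (k : ℤ) : PowerSeries ℂ :=
  PowerSeries.mk fun n => blockTrace XW (s + n) (mode XW.Y a (h - 1 + k) * I.coeff (μ - 1 - k) u)

lemma VOAModule.mode_lowers (X : VOAModule 𝒱 W) {h : ℕ} {a : V}
    (ha : a ∈ weightSpace 𝒱.Y 𝒱.omega (h : ℤ)) {k : ℤ} {ν ν' : ℂ} (hν : ν' = ν - k) {x : W}
    (hx : x ∈ weightSpace X.Y 𝒱.omega ν) :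
    mode X.Y a (h - 1 + k) x ∈ weightSpace X.Y 𝒱.omega ν' := by
  have := X.mode_mem_weightSpace ha hx (h - 1 + k)
  convert this using 2
  rw [hν]
  push_cast
  ring

lemma IntertwiningOperator.coeff_raises (I : IntertwiningOperator XU XW XW) {μ : ℂ} {u : U}
    (hu : u ∈ weightSpace XU.Y 𝒱.omega μ) {k : ℤ} {ν ν' : ℂ} (hν : ν' = ν + k) {x : W}
    (hx : x ∈ weightSpace XW.Y 𝒱.omega ν) :
    I.coeff (μ - 1 - k) u x ∈ weightSpace XW.Y 𝒱.omega ν' := by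
  have := I.coeff_mem_weightSpace hu hx (μ - 1 - k)
  convert this using 2
  rw [hν]
  ring

lemma resMode_onePlus_zpow (X : VOAModule 𝒱 U) {a : V} {u : U} {J : ℕ}
    (hJ : ∀ n : ℤ, J ≤ n → mode X.Y a n u = 0) (z : ℤ) :
    resMode X.Y a (onePlus ^ z) u =
      ∑ j ∈ Finset.range J, ((Ring.choose z j : ℤ) : ℂ) • mode X.Y a j u := by
  rw [resMode_eq_sum X.Y hJ (K := 0) (fun i hi => onePlus_zpow_coeff_neg z hi)]
  symm
  refine Finset.sum_bij (fun (j : ℕ) _ => (j : ℤ)) ?_ ?_ ?_ ?_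
  · intro j hj
    have := Finset.mem_range.1 hj
    exact Finset.mem_Ico.2 ⟨by omega, by omega⟩
  · intro i _ j _ hij
    omega
  · intro i hi
    have := Finset.mem_Ico.1 hi
    exact ⟨i.toNat, Finset.mem_range.2 (by omega), by omega⟩
  · intro j _
    rw [onePlus_zpow_coeff]

variable (I : IntertwiningOperator XU XW XW) {s : ℂ} {h : ℕ} {μ : ℂ} {a : V} {u : U}

/-- The trace of the commutator `[a(wt a - 1 + k), u(wt u - 1 - k)]`. -/
lemma IntertwiningOperator.leftTrace_sub_rightTrace
    (ha : a ∈ weightSpace 𝒱.Y 𝒱.omega (h : ℤ)) (hu : u ∈ weightSpace XU.Y 𝒱.omega μ) (k : ℤ) :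
    I.leftTrace s h μ a u k - I.rightTrace s h μ a u k =
      I.traceSeries s (resMode XU.Y a (onePlus ^ ((h : ℤ) - 1 + k)) u) := by
  obtain ⟨N, hN⟩ := I.commutator a u
  obtain ⟨T, hT⟩ := mode_truncation XU.Y a u
  set J := N + T.toNat
  rw [resMode_onePlus_zpow XU (J := J) (fun n hn => hT n (by omega))]
  ext n
  rw [map_sub, leftTrace, rightTrace, PowerSeries.coeff_mk, PowerSeries.coeff_mk, ← map_sub,
    I.coeff_traceSeries]
  refine blockTrace_congr XW fun x _ => ?_
  rw [LinearMap.sub_apply, Module.End.mul_apply, Module.End.mul_apply, hN J (by omega), map_sum,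
    LinearMap.sum_apply]
  refine Finset.sum_congr rfl fun j _ => ?_
  have h1 := XU.mode_mem_weightSpace ha hu j
  rw [map_smul, I.zeroModeHom_of_mem h1, LinearMap.smul_apply]
  congr 3
  push_cast
  ring_nf

/-- Cyclicity moves the trace from `W_{s + n}` to `W_{s + n - p}`, whence the factor `q ^ p`. For `n
< p` the mode of `a` maps below the lowest weight, so the coefficient vanishes. -/
lemma IntertwiningOperator.rightTrace_eq (hs : XW.IsLowerBound s)
    (ha : a ∈ weightSpace 𝒱.Y 𝒱.omega (h : ℤ)) (hu : u ∈ weightSpace XU.Y 𝒱.omega μ) (p : ℕ) :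
    I.rightTrace s h μ a u p = PowerSeries.X ^ p * I.leftTrace s h μ a u p := by
  ext n
  rw [PowerSeries.coeff_X_pow_mul', rightTrace, leftTrace, PowerSeries.coeff_mk]
  split_ifs with hpn
  · rw [PowerSeries.coeff_mk]
    refine blockTrace_mul_comm XW (fun x hx => XW.mode_lowers ha ?_ hx)
      (fun x hx => I.coeff_raises hu ?_ hx)
    · push_cast [Nat.cast_sub hpn]; ring
    · push_cast [Nat.cast_sub hpn]; ring
  · refine blockTrace_eq_zero XW fun x hx => ?_
    have h1 := XW.mode_lowers ha (k := p) (ν' := s + ((n - p : ℤ) : ℂ)) (by push_cast; ring) hx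
    rw [hs _ (by omega), Submodule.mem_bot] at h1
    rw [Module.End.mul_apply, h1, map_zero]

lemma IntertwiningOperator.leftTrace_neg_eq (hs : XW.IsLowerBound s)
    (ha : a ∈ weightSpace 𝒱.Y 𝒱.omega (h : ℤ)) (hu : u ∈ weightSpace XU.Y 𝒱.omega μ) (p : ℕ) :
    I.leftTrace s h μ a u (-(p : ℤ)) = PowerSeries.X ^ p * I.rightTrace s h μ a u (-(p : ℤ)) := by
  ext n
  rw [PowerSeries.coeff_X_pow_mul', rightTrace, leftTrace, PowerSeries.coeff_mk]
  split_ifs with hpn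
  · rw [PowerSeries.coeff_mk]
    refine blockTrace_mul_comm XW (fun x hx => I.coeff_raises hu ?_ hx)
      (fun x hx => XW.mode_lowers ha ?_ hx)
    · push_cast [Nat.cast_sub hpn]; ring
    · push_cast [Nat.cast_sub hpn]; ring
  · refine blockTrace_eq_zero XW fun x hx => ?_
    have h1 := I.coeff_raises hu (k := -p) (ν' := s + ((n - p : ℤ) : ℂ)) (by push_cast; ring) hx
    rw [hs _ (by omega), Submodule.mem_bot] at h1
    rw [Module.End.mul_apply, h1, map_zero]

/-- The left trace is the right trace plus the commutator term, so the right trace equals `q ^ p`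
times itself plus a known series. The restriction `1 ≤ p` makes `1 - q ^ p` nonzero. -/
lemma IntertwiningOperator.rightTrace_eq_lambertTerm (hs : XW.IsLowerBound s)
    (ha : a ∈ weightSpace 𝒱.Y 𝒱.omega (h : ℤ)) (hu : u ∈ weightSpace XU.Y 𝒱.omega μ) {p : ℕ}
    (hp : 1 ≤ p) : I.rightTrace s h μ a u p = lambertTerm p *
      I.traceSeries s (resMode XU.Y a (onePlus ^ ((h : ℤ) - 1 + p)) u) := by
  refine eq_lambertTerm_mul hp ?_
  rw [← I.leftTrace_sub_rightTrace ha hu, add_sub_cancel, ← I.rightTrace_eq hs ha hu]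

lemma IntertwiningOperator.leftTrace_eq_lambertTerm (hs : XW.IsLowerBound s)
    (ha : a ∈ weightSpace 𝒱.Y 𝒱.omega (h : ℤ)) (hu : u ∈ weightSpace XU.Y 𝒱.omega μ) {p : ℕ}
    (hp : 1 ≤ p) : I.leftTrace s h μ a u (-(p : ℤ)) = -(lambertTerm p *
      I.traceSeries s (resMode XU.Y a (onePlus ^ ((h : ℤ) - 1 + (-(p : ℤ)))) u)) := by
  rw [← mul_neg]
  refine eq_lambertTerm_mul hp ?_
  rw [← I.leftTrace_sub_rightTrace ha hu, neg_sub, add_sub_cancel, ← I.leftTrace_neg_eq hs ha hu]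

/-- The trace of `o(a(e) u)` for `e < 0`, from the associativity formula. -/
lemma IntertwiningOperator.coeff_traceSeries_mode (hs : XW.IsLowerBound s)
    (ha : a ∈ weightSpace 𝒱.Y 𝒱.omega (h : ℤ)) (hu : u ∈ weightSpace XU.Y 𝒱.omega μ) {e : ℤ}
    (he : e < 0) {n N : ℕ} (hN : n + h + 1 ≤ N) :
    PowerSeries.coeff n (I.traceSeries s (mode XU.Y a e u)) =
      ∑ i ∈ Finset.range N, ((-1 : ℂ) ^ i * (Ring.choose e i : ℤ)) *
        (PowerSeries.coeff n (I.leftTrace s h μ a u (e - i - h + 1)) -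
          (-1 : ℂ) ^ e * PowerSeries.coeff n (I.rightTrace s h μ a u (i + 1 - h))) := by
  rw [I.coeff_traceSeries, I.zeroModeHom_of_mem (XU.mode_mem_weightSpace ha hu e)]
  have e0 : ∀ i ∈ Finset.range N, ((-1 : ℂ) ^ i * (Ring.choose e i : ℤ)) *
        (PowerSeries.coeff n (I.leftTrace s h μ a u (e - i - h + 1)) -
          (-1 : ℂ) ^ e * PowerSeries.coeff n (I.rightTrace s h μ a u (i + 1 - h))) =
      blockTrace XW (s + n) (((-1 : ℂ) ^ i * (Ring.choose e i : ℤ)) •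
        (mode XW.Y a (h - 1 + (e - i - h + 1)) * I.coeff (μ - 1 - (e - i - h + 1 : ℤ)) u -
          ((-1 : ℂ) ^ e) • (I.coeff (μ - 1 - (i + 1 - h : ℤ)) u *
            mode XW.Y a (h - 1 + (i + 1 - h))))) := by
    intro i _
    rw [leftTrace, rightTrace, PowerSeries.coeff_mk, PowerSeries.coeff_mk, map_smul, map_sub,
      map_smul, smul_eq_mul, smul_eq_mul]
  rw [Finset.sum_congr rfl e0, ← map_sum]
  refine blockTrace_congr XW fun x hx => ?_
  rw [I.associativity, LinearMap.sum_apply, finsum_eq_sum_of_support_subset (s := Finset.range N)]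
  · refine Finset.sum_congr rfl fun i _ => ?_
    simp only [LinearMap.smul_apply, LinearMap.sub_apply, Module.End.mul_apply]
    have e1 : (h : ℤ) - 1 + (e - i - h + 1) = e - i := by ring
    have e2 : (h : ℤ) - 1 + (i + 1 - h) = i := by ring
    have e3 : μ - 1 - ((e - i - h + 1 : ℤ) : ℂ) = ((h : ℤ) : ℂ) + μ - e - 1 - 1 + i := by
      push_cast; ring
    have e4 : μ - 1 - ((i + 1 - h : ℤ) : ℂ) = e + (((h : ℤ) : ℂ) + μ - e - 1 - 1) - i := by
      push_cast; ring
    rw [e1, e2, e3, e4]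
  · intro i hi
    by_contra hiN
    have hiN' : N ≤ i := by simpa using hiN
    apply hi
    -- For `i ≥ N` both modes that act first would land below the lower bound `s`; here `e < 0` and
    -- `N ≥ n + h + 1` are used.
    have h1 := I.coeff_raises hu (k := e - i - h + 1) (ν' := s + ((n + e - i - h + 1 : ℤ) : ℂ))
      (by push_cast; ring) hx
    rw [hs _ (by omega), Submodule.mem_bot] at h1
    have h2 := XW.mode_lowers ha (k := i + 1 - h) (ν' := s + ((n - (i + 1 - h) : ℤ) : ℂ))
      (by push_cast; ring) hx
    rw [hs _ (by omega), Submodule.mem_bot] at h2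
    have e2 : (h : ℤ) - 1 + (i + 1 - h) = i := by ring
    have e3 : μ - 1 - ((e - i - h + 1 : ℤ) : ℂ) = ((h : ℤ) : ℂ) + μ - e - 1 - 1 + i := by
      push_cast; ring
    rw [e2] at h2
    rw [e3] at h1
    simp only [h1, h2, map_zero, smul_zero, sub_zero]

lemma choose_neg_one (i : ℕ) : Ring.choose (-1 : ℤ) i = (-1) ^ i := by
  induction i with
  | zero => simp
  | succ i ih =>
    have := Ring.choose_succ_succ (-1 : ℤ) i
    rw [neg_add_cancel, Ring.choose_zero_succ, ih] at this
    rw [pow_succ]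
    linarith

lemma choose_neg_two (i : ℕ) : Ring.choose (-2 : ℤ) i = (-1) ^ i * (i + 1) := by
  induction i with
  | zero => simp
  | succ i ih =>
    have := Ring.choose_succ_succ (-2 : ℤ) i
    have e : (-2 : ℤ) + 1 = -1 := by norm_num
    rw [e, choose_neg_one, ih] at this
    rw [pow_succ] at this ⊢
    push_cast
    linarith

lemma IntertwiningOperator.coeff_leftTrace_eq_zero (hs : XW.IsLowerBound s)
    (ha : a ∈ weightSpace 𝒱.Y 𝒱.omega (h : ℤ)) (hu : u ∈ weightSpace XU.Y 𝒱.omega μ) {n p : ℕ}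
    (hp : n < p) : PowerSeries.coeff n (I.leftTrace s h μ a u (-(p : ℤ))) = 0 := by
  rw [I.leftTrace_neg_eq hs ha hu, PowerSeries.coeff_X_pow_mul', if_neg (by omega)]

lemma IntertwiningOperator.coeff_rightTrace_eq_zero (hs : XW.IsLowerBound s)
    (ha : a ∈ weightSpace 𝒱.Y 𝒱.omega (h : ℤ)) (hu : u ∈ weightSpace XU.Y 𝒱.omega μ) {n : ℕ} {k : ℤ}
    (hk : n < k) : PowerSeries.coeff n (I.rightTrace s h μ a u k) = 0 := by
  lift k to ℕ using by omega
  rw [I.rightTrace_eq hs ha hu, PowerSeries.coeff_X_pow_mul', if_neg (by omega)]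

/-- The trace of `o(a(-1) u)`. -/
lemma IntertwiningOperator.traceSeries_mode_neg_one (hs : XW.IsLowerBound s)
    (ha : a ∈ weightSpace 𝒱.Y 𝒱.omega (h : ℤ)) (hu : u ∈ weightSpace XU.Y 𝒱.omega μ) (n : ℕ) :
    PowerSeries.coeff n (I.traceSeries s (mode XU.Y a (-1) u)) =
      PowerSeries.coeff n (I.rightTrace s h μ a u 0) +
      ∑ p ∈ Finset.Icc 1 n, PowerSeries.coeff n (lambertTerm p *
        (I.traceSeries s (resMode XU.Y a (onePlus ^ ((h : ℤ) - 1 + p)) u) -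
          I.traceSeries s (resMode XU.Y a (onePlus ^ ((h : ℤ) - 1 + (-(p : ℤ)))) u))) -
      ∑ q ∈ Finset.range h, PowerSeries.coeff n
        (I.traceSeries s (resMode XU.Y a (onePlus ^ ((h : ℤ) - 1 + (-(q : ℤ)))) u)) := by
  have h1 := sum_range_shift (n := n)
    (T' := fun p => PowerSeries.coeff n (I.leftTrace s h μ a u (-(p : ℤ))))
    (T := fun k => PowerSeries.coeff n (I.rightTrace s h μ a u k))
    (fun p hp => I.coeff_leftTrace_eq_zero hs ha hu hp)
    (fun k hk => I.coeff_rightTrace_eq_zero hs ha hu hk) h (n + h + 1) le_rfl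
  rw [I.coeff_traceSeries_mode hs ha hu (by norm_num) (le_refl (n + h + 1))]
  have e0 : I.leftTrace s h μ a u (-((0 : ℕ) : ℤ)) = I.rightTrace s h μ a u 0 := by
    have := I.leftTrace_neg_eq hs ha hu 0
    simpa using this
  have e1 : ∀ i : ℕ, ((-1 : ℂ) ^ i * (Ring.choose (-1 : ℤ) i : ℤ)) *
        (PowerSeries.coeff n (I.leftTrace s h μ a u (-1 - i - h + 1)) -
          (-1 : ℂ) ^ (-1 : ℤ) * PowerSeries.coeff n (I.rightTrace s h μ a u (i + 1 - h))) =
      PowerSeries.coeff n (I.leftTrace s h μ a u (-((h + i : ℕ) : ℤ))) +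
        PowerSeries.coeff n (I.rightTrace s h μ a u (i + 1 - h)) := by
    intro i
    have e2 : -1 - (i : ℤ) - h + 1 = -((h + i : ℕ) : ℤ) := by push_cast; ring
    have e3 : (-1 : ℂ) ^ i * (-1) ^ i = 1 := by rw [← mul_pow]; simp
    rw [choose_neg_one, e2]
    push_cast
    rw [e3]
    norm_num
  rw [Finset.sum_congr rfl fun i _ => e1 i, h1, e0, sub_eq_add_neg _ (Finset.sum _ _),
    ← Finset.sum_neg_distrib]
  congr 1
  · congr 1
    refine Finset.sum_congr rfl fun p hp => ?_
    have hp1 := (Finset.mem_Icc.1 hp).1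
    rw [I.leftTrace_eq_lambertTerm hs ha hu hp1, I.rightTrace_eq_lambertTerm hs ha hu hp1, mul_sub,
      map_sub, map_neg]
    ring
  · refine Finset.sum_congr rfl fun q _ => ?_
    rw [← I.leftTrace_sub_rightTrace ha hu, map_sub]
    ring

/-- The trace of `o(a(-2) u + wt(a) a(-1) u)`. -/
lemma IntertwiningOperator.traceSeries_mode_neg_two (hs : XW.IsLowerBound s)
    (ha : a ∈ weightSpace 𝒱.Y 𝒱.omega (h : ℤ)) (hu : u ∈ weightSpace XU.Y 𝒱.omega μ) (n : ℕ) :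
    PowerSeries.coeff n (I.traceSeries s (mode XU.Y a (-2) u)) +
      h * PowerSeries.coeff n (I.traceSeries s (mode XU.Y a (-1) u)) +
      ∑ q ∈ Finset.range h, q * PowerSeries.coeff n
        (I.traceSeries s (resMode XU.Y a (onePlus ^ ((h : ℤ) - 1 + (-(q : ℤ)))) u)) =
      - ∑ p ∈ Finset.Icc 1 n, p * PowerSeries.coeff n (lambertTerm p *
        (I.traceSeries s (resMode XU.Y a (onePlus ^ ((h : ℤ) - 1 + p)) u) +
          I.traceSeries s (resMode XU.Y a (onePlus ^ ((h : ℤ) - 1 + (-(p : ℤ)))) u))) := by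
  set N := n + h + 1
  have h1 := sum_range_shift (n := n)
    -- Weighting by the shift `k` removes the term `k = 0`, the only one that cyclicity cannot
    -- determine.
    (T' := fun p => p * PowerSeries.coeff n (I.leftTrace s h μ a u (-(p : ℤ))))
    (T := fun k => -(k * PowerSeries.coeff n (I.rightTrace s h μ a u k)))
    (fun p hp => by rw [I.coeff_leftTrace_eq_zero hs ha hu hp, mul_zero])
    (fun k hk => by rw [I.coeff_rightTrace_eq_zero hs ha hu hk, mul_zero, neg_zero]) h (N + 1)
    (by omega)
  have hminus : ∀ i : ℕ, (-1 : ℂ) ^ i * (-1) ^ i = 1 := fun i => by rw [← mul_pow]; simp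
  have e1 : PowerSeries.coeff n (I.traceSeries s (mode XU.Y a (-1) u)) =
      ∑ i ∈ Finset.range (N + 1),
        (PowerSeries.coeff n (I.leftTrace s h μ a u (-((h + i : ℕ) : ℤ))) +
          PowerSeries.coeff n (I.rightTrace s h μ a u (i + 1 - h))) := by
    rw [I.coeff_traceSeries_mode hs ha hu (by norm_num) (N := N + 1) (by omega)]
    refine Finset.sum_congr rfl fun i _ => ?_
    have e2 : -1 - (i : ℤ) - h + 1 = -((h + i : ℕ) : ℤ) := by push_cast; ring
    rw [choose_neg_one, e2]
    push_cast
    rw [hminus]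
    norm_num
  -- The left half is shifted by one index: for `e = -2` its `i`-th term has coefficient `i + 1` and
  -- index `h + (i + 1)`. The new initial term has coefficient `0`, and the surplus last term
  -- vanishes because its index exceeds `n`.
  have e2 : PowerSeries.coeff n (I.traceSeries s (mode XU.Y a (-2) u)) =
      ∑ i ∈ Finset.range (N + 1),
        (i * PowerSeries.coeff n (I.leftTrace s h μ a u (-((h + i : ℕ) : ℤ))) -
          (i + 1) * PowerSeries.coeff n (I.rightTrace s h μ a u (i + 1 - h))) := by
    rw [I.coeff_traceSeries_mode hs ha hu (by norm_num) (N := N + 1) (by omega),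
      Finset.sum_sub_distrib, Finset.sum_range_succ' (fun i : ℕ =>
        (i : ℂ) * PowerSeries.coeff n (I.leftTrace s h μ a u (-((h + i : ℕ) : ℤ))))]
    have e3 : ∀ i : ℕ, ((-1 : ℂ) ^ i * (Ring.choose (-2 : ℤ) i : ℤ)) *
        (PowerSeries.coeff n (I.leftTrace s h μ a u (-2 - i - h + 1)) -
          (-1 : ℂ) ^ (-2 : ℤ) * PowerSeries.coeff n (I.rightTrace s h μ a u (i + 1 - h))) =
        ((i + 1 : ℕ) : ℂ) * PowerSeries.coeff n (I.leftTrace s h μ a u (-((h + (i + 1) : ℕ) : ℤ))) -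
        (i + 1) * PowerSeries.coeff n (I.rightTrace s h μ a u (i + 1 - h)) := by
      intro i
      have e2 : -2 - (i : ℤ) - h + 1 = -((h + (i + 1) : ℕ) : ℤ) := by push_cast; ring
      rw [choose_neg_two, e2]
      push_cast
      rw [← mul_assoc, hminus]
      norm_num
      ring
    rw [Finset.sum_congr rfl fun i _ => e3 i, Finset.sum_sub_distrib, Finset.sum_range_succ _ N]
    have e4 : PowerSeries.coeff n (I.leftTrace s h μ a u (-((h + (N + 1) : ℕ) : ℤ))) = 0 :=
      I.coeff_leftTrace_eq_zero hs ha hu (by omega)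
    rw [e4]
    simp
  rw [e1, e2, Finset.mul_sum, ← Finset.sum_add_distrib]
  have e5 : ∀ i ∈ Finset.range (N + 1),
      ((i : ℂ) * PowerSeries.coeff n (I.leftTrace s h μ a u (-((h + i : ℕ) : ℤ))) -
          (i + 1) * PowerSeries.coeff n (I.rightTrace s h μ a u (i + 1 - h))) +
        h * (PowerSeries.coeff n (I.leftTrace s h μ a u (-((h + i : ℕ) : ℤ))) +
          PowerSeries.coeff n (I.rightTrace s h μ a u (i + 1 - h))) =
      ((h + i : ℕ) : ℂ) * PowerSeries.coeff n (I.leftTrace s h μ a u (-((h + i : ℕ) : ℤ))) +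
        -(((i + 1 - h : ℤ) : ℂ) * PowerSeries.coeff n (I.rightTrace s h μ a u (i + 1 - h))) := by
    intro i _
    push_cast
    ring
  -- The boundary terms of `sum_range_shift` cancel against the sum over `q`, because left trace
  -- minus right trace is the trace of the commutator.
  rw [Finset.sum_congr rfl e5, h1, add_assoc, ← Finset.sum_add_distrib, Finset.sum_eq_zero (s := Finset.range h)]
  · rw [Nat.cast_zero, zero_mul, zero_add, add_zero, ← Finset.sum_neg_distrib]
    refine Finset.sum_congr rfl fun p hp => ?_
    have hp1 := (Finset.mem_Icc.1 hp).1
    rw [I.leftTrace_eq_lambertTerm hs ha hu hp1, I.rightTrace_eq_lambertTerm hs ha hu hp1, mul_add,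
      map_add, map_neg]
    push_cast
    ring
  · intro q _
    rw [← I.leftTrace_sub_rightTrace ha hu, map_sub]
    push_cast
    ring

end TraceRecursion

/-! ### Zhu's recursion in terms of the modes `a[m]`, and the derivative of a trace series. -/

section SquareTraces

variable {V U W : Type*} [AddCommGroup V] [Module ℂ V] [AddCommGroup U] [Module ℂ U]
  [AddCommGroup W] [Module ℂ W] {𝒱 : VOA V} {XU : VOAModule 𝒱 U} {XW : VOAModule 𝒱 W}

lemma mem_weightSpace_cases (hV : ∀ n : ℤ, n < 0 → weightSpace 𝒱.Y 𝒱.omega (n : ℂ) = ⊥) {n : ℤ}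
    {a : V} (ha : a ∈ weightSpace 𝒱.Y 𝒱.omega (n : ℂ)) :
    a = 0 ∨ ∃ h : ℕ, n = h ∧ a ∈ weightSpace 𝒱.Y 𝒱.omega (((h : ℕ) : ℤ) : ℂ) := by
  rcases lt_or_ge n 0 with hn | hn
  · rw [hV n hn, Submodule.mem_bot] at ha
    exact Or.inl ha
  · lift n to ℕ using hn
    exact Or.inr ⟨n, rfl, ha⟩

/-- A property of pairs of vectors that is stable under addition holds for all pairs if it holds
for homogeneous ones. -/
lemma homogeneous_induction (XU : VOAModule 𝒱 U)
    (hV : ∀ n : ℤ, n < 0 → weightSpace 𝒱.Y 𝒱.omega (n : ℂ) = ⊥)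
    {p : V → U → Prop} (hl0 : ∀ u, p 0 u) (hr0 : ∀ a, p a 0)
    (hl : ∀ a b u, p a u → p b u → p (a + b) u) (hr : ∀ a u v, p a u → p a v → p a (u + v))
    (hp : ∀ (h : ℕ) (μ : ℂ) (a : V) (u : U), a ∈ weightSpace 𝒱.Y 𝒱.omega ((h : ℤ) : ℂ) →
      u ∈ weightSpace XU.Y 𝒱.omega μ → p a u) (a : V) (u : U) : p a u := by
  have ha : a ∈ ⨆ n : ℤ, weightSpace 𝒱.Y 𝒱.omega (n : ℂ) := by
    rw [𝒱.grading.submodule_iSup_eq_top]; trivial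
  have hu : u ∈ ⨆ μ : ℂ, weightSpace XU.Y 𝒱.omega μ := by
    rw [XU.grading.submodule_iSup_eq_top]; trivial
  refine Submodule.iSup_induction _ (motive := fun a => p a u) ha (fun n a ha => ?_) (hl0 u)
    (fun a b => hl a b u)
  rcases mem_weightSpace_cases hV ha with rfl | ⟨h, -, ha⟩
  · exact hl0 u
  · exact Submodule.iSup_induction _ (motive := fun u => p a u) hu
      (fun μ u hu => hp h μ a u ha hu) (hr0 a) (hr a)

/-- The factor `(1 + z) ^ k` is expanded binomially and cut at `z ^ J`, beyond which the modes
annihilate `u`. The dependence on `k` is then confined to scalar binomial coefficients. -/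
lemma resMode_eq_sum_squareRes (X : VOAModule 𝒱 U) {h : ℕ} {a : V} {u : U} {J : ℕ}
    (ha : a ∈ weightSpace 𝒱.Y 𝒱.omega ((h : ℤ) : ℂ))
    (hJ : ∀ n : ℤ, J ≤ n → mode X.Y a n u = 0) (k : ℤ) :
    resMode X.Y a (onePlus ^ ((h : ℤ) - 1 + k)) u =
      ∑ j ∈ Finset.range J, ((Ring.choose k j : ℤ) : ℂ) •
        X.squareRes a (zSeries ^ (j : ℤ)) u := by
  have e : ∑ j ∈ Finset.range J, ((Ring.choose k j : ℤ) : ℂ) • X.squareRes a (zSeries ^ (j : ℤ)) u =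
      X.squareRes a (∑ j ∈ Finset.range J, ((Ring.choose k j : ℤ) : ℂ) • zSeries ^ (j : ℤ)) u := by
    simp only [map_sum, map_smul, LinearMap.sum_apply, LinearMap.smul_apply]
  rw [e, X.squareRes_of_mem ha, ← sub_eq_zero, ← LinearMap.sub_apply, ← map_sub, add_comm _ k,
    zpow_add₀ onePlus_ne_zero, ← sub_mul]
  refine resMode_eq_zero X.Y hJ fun i hi => ?_
  refine laurentSeries_coeff_mul_eq_zero (A := J) (B := 0) (fun i hi => ?_)
    (fun i hi => onePlus_zpow_coeff_neg _ hi) i (by omega)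
  rw [HahnSeries.coeff_sub, HahnSeries.coeff_sum]
  simp only [zSeries_zpow, HahnSeries.coeff_smul, smul_eq_mul]
  rcases lt_or_ge i 0 with h0 | h0
  · rw [onePlus_zpow_coeff_neg _ h0, Finset.sum_eq_zero, sub_zero]
    intro j _
    rw [HahnSeries.coeff_single_of_ne (by omega), mul_zero]
  · lift i to ℕ using h0
    rw [onePlus_zpow_coeff, Finset.sum_eq_single i]
    · simp
    · intro j _ hj
      rw [HahnSeries.coeff_single_of_ne (by omega), mul_zero]
    · intro hi'
      exact absurd (Finset.mem_range.2 (by omega)) hi'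

/-- Arguments `f p` that are combinations of finitely many fixed series let the sum over `p`
collapse into finitely many Lambert series. This gives a finite relation over `discSeries`. -/
lemma mk_sum_lambertTerm {c : ℕ → ℂ} {J : ℕ} {d : ℕ → ℕ → ℂ} {g : ℕ → PowerSeries ℂ}
    {f : ℕ → PowerSeries ℂ} (hf : ∀ p, f p = ∑ j ∈ Finset.range J, d j p • g j) (n : ℕ) :
    ∑ p ∈ Finset.Icc 1 n, c p * PowerSeries.coeff n (lambertTerm p * f p) =
      PowerSeries.coeff n (∑ j ∈ Finset.range J, lambert (fun p => c p * d j p) * g j) := by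
  rw [map_sum]
  simp only [coeff_lambert_mul, hf, Finset.mul_sum, map_sum]
  rw [Finset.sum_comm]
  refine Finset.sum_congr rfl fun j _ => Finset.sum_congr rfl fun p _ => ?_
  rw [mul_smul_comm, map_smul, smul_eq_mul]
  ring

/-- The trace of `o(a[0] u)` vanishes. -/
theorem IntertwiningOperator.traceSeries_squareRes_one (I : IntertwiningOperator XU XW XW)
    (hV : ∀ n : ℤ, n < 0 → weightSpace 𝒱.Y 𝒱.omega (n : ℂ) = ⊥) {s : ℂ} (hs : XW.IsLowerBound s)
    (a : V) (u : U) : I.traceSeries s (XU.squareRes a 1 u) = 0 := by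
  refine homogeneous_induction XU hV (p := fun a u => I.traceSeries s (XU.squareRes a 1 u) = 0)
    (by simp) (by simp) (fun a b u h1 h2 => by simp [h1, h2])
    (fun a u v h1 h2 => by simp [h1, h2]) (fun h μ a u ha hu => ?_) a u
  -- At shift `0` cyclicity carries the factor `q ^ 0 = 1`, so the two traces agree and the
  -- commutator has trace zero.
  have h1 := I.leftTrace_sub_rightTrace (s := s) ha hu 0
  have h2 := I.rightTrace_eq hs ha hu 0
  simp only [Nat.cast_zero, pow_zero, one_mul] at h2
  rw [h2, sub_self, add_zero] at h1
  rw [XU.squareRes_of_mem ha, one_mul, h1]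

/-- The coefficients of the recursion for `o(a[-2] u)`. -/
noncomputable def symmetricLambert (j : ℕ) : PowerSeries ℂ :=
  lambert fun p => p * (((Ring.choose (p : ℤ) j : ℤ) : ℂ) + ((Ring.choose (-(p : ℤ)) j : ℤ) : ℂ))

/-- The trace of `o(Res_z Y(a, z) u (1 + z) ^ (wt a) z ^ (-2))`. -/
theorem IntertwiningOperator.traceSeries_squareRes_neg_two (I : IntertwiningOperator XU XW XW)
    (hV : ∀ n : ℤ, n < 0 → weightSpace 𝒱.Y 𝒱.omega (n : ℂ) = ⊥) {s : ℂ} (hs : XW.IsLowerBound s)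
    (a : V) (u : U) : ∃ J₀ : ℕ, ∀ J : ℕ, J₀ ≤ J →
      I.traceSeries s (XU.squareRes a (onePlus * zSeries ^ (-2 : ℤ)) u) =
        - ∑ j ∈ Finset.range J, symmetricLambert j *
          I.traceSeries s (XU.squareRes a (zSeries ^ (j : ℤ)) u) := by
  refine homogeneous_induction XU hV (p := fun a u => ∃ J₀ : ℕ, ∀ J : ℕ, J₀ ≤ J →
      I.traceSeries s (XU.squareRes a (onePlus * zSeries ^ (-2 : ℤ)) u) =
        - ∑ j ∈ Finset.range J, symmetricLambert j *
          I.traceSeries s (XU.squareRes a (zSeries ^ (j : ℤ)) u))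
    (fun u => ⟨0, fun J _ => by simp⟩) (fun a => ⟨0, fun J _ => by simp⟩) ?_ ?_ ?_ a u
  · rintro a b u ⟨J₁, h1⟩ ⟨J₂, h2⟩
    refine ⟨max J₁ J₂, fun J hJ => ?_⟩
    simp only [map_add, LinearMap.add_apply, mul_add, Finset.sum_add_distrib, neg_add]
    rw [h1 J (by omega), h2 J (by omega)]
  · rintro a u v ⟨J₁, h1⟩ ⟨J₂, h2⟩
    refine ⟨max J₁ J₂, fun J hJ => ?_⟩
    simp only [map_add, mul_add, Finset.sum_add_distrib, neg_add]
    rw [h1 J (by omega), h2 J (by omega)]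
  · intro h μ a u ha hu
    obtain ⟨T, hT⟩ := mode_truncation XU.Y a u
    refine ⟨T.toNat, fun J hJ => ?_⟩
    have hJ' : ∀ n : ℤ, (J : ℤ) ≤ n → mode XU.Y a n u = 0 := fun n hn => hT n (by omega)
    ext n
    rw [XU.squareRes_of_mem ha, onePlus_pow_div_sq]
    simp only [map_add, LinearMap.add_apply, map_smul, LinearMap.smul_apply, zSeries_zpow,
      resMode_single, one_smul, map_sum, LinearMap.sum_apply, smul_eq_mul]
    rw [I.traceSeries_mode_neg_two hs ha hu, map_neg]
    congr 1
    refine mk_sum_lambertTerm (fun p => ?_) n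
    rw [resMode_eq_sum_squareRes XU ha hJ', resMode_eq_sum_squareRes XU ha hJ', map_sum, map_sum,
      ← Finset.sum_add_distrib]
    refine Finset.sum_congr rfl fun j _ => ?_
    rw [map_smul, map_smul, ← add_smul, zSeries_zpow]

lemma discSeries_mul_mem {P : Submodule discSeries (PowerSeries ℂ)} {f g : PowerSeries ℂ}
    (hf : f ∈ discSeries) (hg : g ∈ P) : f * g ∈ P :=
  P.smul_mem ⟨f, hf⟩ hg

lemma subexpGrowth_choose (j : ℕ) :
    SubexpGrowth (fun p => ((Ring.choose (p : ℤ) j : ℤ) : ℂ)) ∧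
      SubexpGrowth (fun p => ((Ring.choose (-(p : ℤ)) j : ℤ) : ℂ)) := by
  constructor
  · refine SubexpGrowth.choose (z := fun p => (p : ℤ)) ?_ j
    simpa using SubexpGrowth.natCast
  · refine SubexpGrowth.choose (z := fun p => -(p : ℤ)) ?_ j
    simpa using (SubexpGrowth.const (-1)).mul SubexpGrowth.natCast

/-- The derivative of a trace function is a combination of trace functions. -/
theorem IntertwiningOperator.eulerOp_traceSeries_mem (I : IntertwiningOperator XU XW XW)
    {s : ℂ} (hs : XW.IsLowerBound s) (u : U) :
    eulerOp s (I.traceSeries s u) ∈ Submodule.span discSeries (Set.range (I.traceSeries s)) := by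
  set P := Submodule.span discSeries (Set.range (I.traceSeries s))
  have hP : ∀ v, I.traceSeries s v ∈ P := fun v => Submodule.subset_span ⟨v, rfl⟩
  have hu : u ∈ ⨆ μ : ℂ, weightSpace XU.Y 𝒱.omega μ := by
    rw [XU.grading.submodule_iSup_eq_top]; trivial
  refine Submodule.iSup_induction _ (motive := fun u => eulerOp s (I.traceSeries s u) ∈ P) hu
    (fun μ u hu => ?_) ?_ ?_
  · have ha : 𝒱.omega ∈ weightSpace 𝒱.Y 𝒱.omega (((2 : ℕ) : ℤ) : ℂ) := by
      simpa using 𝒱.omega_weight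
    obtain ⟨T, hT⟩ := mode_truncation XU.Y 𝒱.omega u
    have hJ : ∀ n : ℤ, (T.toNat : ℤ) ≤ n → mode XU.Y 𝒱.omega n u = 0 := fun n hn => hT n (by omega)
    have key : eulerOp s (I.traceSeries s u) = I.traceSeries s (mode XU.Y 𝒱.omega (-1) u) -
        ∑ j ∈ Finset.range T.toNat, lambert (fun p => 1 * (((Ring.choose (p : ℤ) j : ℤ) : ℂ) +
            -1 * ((Ring.choose (-(p : ℤ)) j : ℤ) : ℂ))) *
          I.traceSeries s (XU.squareRes 𝒱.omega (zSeries ^ (j : ℤ)) u) +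
        ∑ q ∈ Finset.range 2,
          I.traceSeries s (resMode XU.Y 𝒱.omega (onePlus ^ (((2 : ℕ) : ℤ) - 1 + (-(q : ℤ)))) u) := by
      ext n
      have h1 := I.traceSeries_mode_neg_one hs ha hu n
      -- The term at shift `0` contains `ω(1) = L(0)`, which acts on `W_{s + n}` as `s + n` and thus
      -- produces `q d/dq + s`.
      have h2 : PowerSeries.coeff n (I.rightTrace s 2 μ 𝒱.omega u 0) =
          PowerSeries.coeff n (eulerOp s (I.traceSeries s u)) := by
        rw [rightTrace, eulerOp, PowerSeries.coeff_mk, PowerSeries.coeff_mk, I.coeff_traceSeries,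
          I.zeroModeHom_of_mem hu]
        have e (f : Module.End ℂ W) : (s + n) * blockTrace XW (s + n) f =
            blockTrace XW (s + n) ((s + n) • f) := by rw [map_smul, smul_eq_mul]
        rw [e]
        refine blockTrace_congr XW fun x hx => ?_
        have e : mode XW.Y 𝒱.omega (((2 : ℕ) : ℤ) - 1 + 0) x = (s + n) • x :=
          mem_weightSpace.1 hx
        rw [Module.End.mul_apply, e, map_smul]
        simp
      have h3 := mk_sum_lambertTerm (c := fun _ => 1) (J := T.toNat)
        (d := fun j p => ((Ring.choose (p : ℤ) j : ℤ) : ℂ) +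
            -1 * ((Ring.choose (-(p : ℤ)) j : ℤ) : ℂ))
        (g := fun j => I.traceSeries s (XU.squareRes 𝒱.omega (zSeries ^ (j : ℤ)) u))
        (f := fun p =>
          I.traceSeries s (resMode XU.Y 𝒱.omega (onePlus ^ (((2 : ℕ) : ℤ) - 1 + p)) u) -
          I.traceSeries s (resMode XU.Y 𝒱.omega (onePlus ^ (((2 : ℕ) : ℤ) - 1 + (-(p : ℤ)))) u))
        (fun p => by
          rw [resMode_eq_sum_squareRes XU ha hJ, resMode_eq_sum_squareRes XU ha hJ, map_sum,
            map_sum, ← Finset.sum_sub_distrib]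
          refine Finset.sum_congr rfl fun j _ => ?_
          rw [map_smul, map_smul, ← sub_smul, neg_one_mul, sub_eq_add_neg]) n
      rw [map_add, map_sub, ← h3, h1, h2, map_sum]
      simp only [one_mul]
      ring
    rw [key]
    refine add_mem (sub_mem (hP _) (sum_mem fun j _ => discSeries_mul_mem (lambert_mem ?_) (hP _)))
      (sum_mem fun q _ => hP _)
    exact (SubexpGrowth.const 1).mul ((subexpGrowth_choose j).1.add
      ((SubexpGrowth.const (-1)).mul (subexpGrowth_choose j).2))
  · have : eulerOp s (I.traceSeries s 0) = 0 := by ext; simp [eulerOp]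
    rw [this]
    exact zero_mem _
  · intro u v h1 h2
    have : eulerOp s (I.traceSeries s (u + v)) =
        eulerOp s (I.traceSeries s u) + eulerOp s (I.traceSeries s v) := by
      ext; simp [eulerOp, mul_add]
    rw [this]
    exact add_mem h1 h2

end SquareTraces

/-! ### Comparison of powers of `z` and of `log (1 + z)`. -/

section LogExpansion

/-- `log (1 + z) = z g(z)` with `g(z) = 1 - z / 2 + ⋯`. -/
lemma exists_logSeries_eq : ∃ g : PowerSeries ℂ, PowerSeries.coeff 0 g = 1 ∧
    PowerSeries.coeff 1 g = -1 / 2 ∧ logSeries = zSeries * (g : LaurentSeries ℂ) := by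
  obtain ⟨g, hg⟩ := PowerSeries.X_dvd_iff.2 (PowerSeries.constantCoeff_log (A := ℂ))
  have h : ∀ n, PowerSeries.coeff n g = PowerSeries.coeff (n + 1) (PowerSeries.log ℂ) := by
    intro n
    rw [hg, PowerSeries.coeff_succ_X_mul]
  refine ⟨g, ?_, ?_, ?_⟩
  · rw [h]; simp
  · rw [h]; simp; norm_num
  · rw [logSeries, hg, PowerSeries.coe_mul, PowerSeries.coe_X]

lemma logSeries_pow_coeff (k : ℕ) : (∀ i < (k : ℤ), (logSeries ^ (k : ℤ)).coeff i = 0) ∧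
    (logSeries ^ (k : ℤ)).coeff k = 1 := by
  obtain ⟨g, hg0, -, hg⟩ := exists_logSeries_eq
  have e : logSeries ^ (k : ℤ) = HahnSeries.single (k : ℤ) 1 * ((g ^ k : PowerSeries ℂ) : LaurentSeries ℂ) := by
    rw [hg, mul_zpow, zSeries_zpow, zpow_natCast, PowerSeries.coe_pow]
  constructor
  · intro i hi
    rw [e]
    exact laurentSeries_coeff_mul_eq_zero (A := k) (B := 0)
      (fun i hi => HahnSeries.coeff_single_of_ne (by omega)) (fun i hi => coeff_coe_neg _ hi) i
      (by omega)
  · have := HahnSeries.coeff_single_mul_add (r := (1 : ℂ))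
      (x := ((g ^ k : PowerSeries ℂ) : LaurentSeries ℂ)) (a := 0) (b := (k : ℤ))
    rw [zero_add] at this
    rw [e, this, one_mul]
    have h0 := coeff_coe_nat (g ^ k) 0
    rw [Nat.cast_zero] at h0
    rw [h0]
    rw [PowerSeries.coeff_zero_eq_constantCoeff_apply] at hg0 ⊢
    rw [map_pow, hg0, one_pow]

/-- `(1 + z) / z ^ 2 - log (1 + z) ^ (-2)` is a power series. -/
lemma onePlus_div_sq_sub_coeff {i : ℤ} (hi : i < 0) :
    (onePlus * zSeries ^ (-2 : ℤ) - logSeries ^ (-2 : ℤ)).coeff i = 0 := by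
  obtain ⟨g, hg0, hg1, hg⟩ := exists_logSeries_eq
  have hgc : PowerSeries.constantCoeff g = 1 := by
    rw [← PowerSeries.coeff_zero_eq_constantCoeff_apply, hg0]
  -- The difference equals `z ^ (-2) * r * g ^ (-2)`, and `r` vanishes to order two because `g ^ 2 =
  -- 1 - z + ⋯`.
  set r : PowerSeries ℂ := (1 + PowerSeries.X) * g ^ 2 - 1 with hr
  have hu : g ^ 2 * (g ^ 2)⁻¹ = 1 := PowerSeries.mul_inv_cancel _ (by simp [hgc])
  have hu' : (g : LaurentSeries ℂ) ^ 2 * (((g ^ 2)⁻¹ : PowerSeries ℂ) : LaurentSeries ℂ) = 1 := by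
    rw [← PowerSeries.coe_pow, ← PowerSeries.coe_mul, hu, PowerSeries.coe_one]
  have hu2 : ((g : LaurentSeries ℂ)) ^ (-2 : ℤ) = (((g ^ 2)⁻¹ : PowerSeries ℂ) : LaurentSeries ℂ) := by
    rw [zpow_neg]
    exact inv_eq_of_mul_eq_one_right (by exact_mod_cast hu')
  have e : onePlus * zSeries ^ (-2 : ℤ) - logSeries ^ (-2 : ℤ) =
      zSeries ^ (-2 : ℤ) * ((r * (g ^ 2)⁻¹ : PowerSeries ℂ) : LaurentSeries ℂ) := by
    rw [hg, mul_zpow, hu2, hr, PowerSeries.coe_mul, PowerSeries.coe_sub, PowerSeries.coe_mul,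
      PowerSeries.coe_one, PowerSeries.coe_pow, ← onePlus]
    linear_combination -(onePlus * zSeries ^ (-2 : ℤ)) * hu'
  have hr0 : PowerSeries.coeff 0 r = 0 := by
    simp [hr, hgc]
  have hr1 : PowerSeries.coeff 1 r = 0 := by
    rw [hr, map_sub, add_mul, one_mul, map_add, sq, PowerSeries.coeff_mul]
    have : PowerSeries.coeff 1 (PowerSeries.X * (g * g)) = 1 := by
      have := PowerSeries.coeff_succ_X_mul 0 (g * g)
      rw [zero_add] at this
      rw [this]
      simp [hgc]
    rw [this, Finset.Nat.antidiagonal_succ]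
    simp [hgc, hg1]
  have hrc : ∀ i : ℤ, i < 2 → (r : LaurentSeries ℂ).coeff i = 0 := by
    intro i hi
    rcases lt_or_ge i 0 with h | h
    · exact coeff_coe_neg _ h
    · lift i to ℕ using h
      rw [coeff_coe_nat]
      have : i = 0 ∨ i = 1 := by omega
      rcases this with rfl | rfl
      · exact hr0
      · exact hr1
  rw [e, zSeries_zpow, PowerSeries.coe_mul]
  refine laurentSeries_coeff_mul_eq_zero (A := -2) (B := 2 + 0)
    (fun i hi => HahnSeries.coeff_single_of_ne (by omega))
    (laurentSeries_coeff_mul_eq_zero hrc fun i hi => coeff_coe_neg _ hi) i (by omega)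

/-- Power series are, modulo series of high order, combinations of powers of `log (1 + z)`. -/
lemma mem_of_logSeries_pow_mem {M : Type*} [AddCommGroup M] [Module ℂ M]
    {φ : LaurentSeries ℂ →ₗ[ℂ] M} {P : Submodule ℂ M} {J : ℕ}
    (hJ : ∀ f : LaurentSeries ℂ, (∀ i < (J : ℤ), f.coeff i = 0) → φ f = 0)
    (hP : ∀ m : ℕ, φ (logSeries ^ (m : ℤ)) ∈ P) (f : LaurentSeries ℂ)
    (hf : ∀ i < 0, f.coeff i = 0) : φ f ∈ P := by
  -- For `f` of order at least `k`, subtracting its leading coefficient times `log (1 + z) ^ k`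
  -- raises the order; `φ` vanishes once the order reaches `J`, so `d` bounds the number of steps.
  suffices h : ∀ (d k : ℕ), J ≤ k + d → ∀ f : LaurentSeries ℂ,
      (∀ i < (k : ℤ), f.coeff i = 0) → φ f ∈ P from
    h J 0 (by omega) f (by simpa using hf)
  intro d
  induction d with
  | zero =>
    intro k hk f hf
    rw [hJ f fun i hi => hf i (by omega)]
    exact zero_mem _
  | succ d ih =>
    intro k hk f hf
    have h1 : φ (f - f.coeff k • logSeries ^ (k : ℤ)) ∈ P := by
      refine ih (k + 1) (by omega) _ fun i hi => ?_
      rw [HahnSeries.coeff_sub, HahnSeries.coeff_smul]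
      rcases lt_or_ge i k with h | h
      · rw [hf i h, (logSeries_pow_coeff k).1 i h, smul_zero, sub_zero]
      · have : i = k := by push_cast at hi; omega
        rw [this, (logSeries_pow_coeff k).2, smul_eq_mul, mul_one, sub_self]
    have h2 := P.add_mem h1 (P.smul_mem (f.coeff k) (hP k))
    rwa [← map_smul, ← map_add, sub_add_cancel] at h2

end LogExpansion

/-! ### Finite generation from `C_{[2,0]}`, and convergence of the trace series. -/

section FiniteGeneration

variable {V U W : Type*} [AddCommGroup V] [Module ℂ V] [AddCommGroup U] [Module ℂ U]
  [AddCommGroup W] [Module ℂ W] {𝒱 : VOA V} {XU : VOAModule 𝒱 U} {XW : VOAModule 𝒱 W}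

lemma VOAModule.exists_squareRes_truncation (X : VOAModule 𝒱 U)
    (hV : ∀ n : ℤ, n < 0 → weightSpace 𝒱.Y 𝒱.omega (n : ℂ) = ⊥) (a : V) (u : U) :
    ∃ J₀ : ℕ, ∀ J : ℕ, J₀ ≤ J → ∀ f : LaurentSeries ℂ, (∀ i < (J : ℤ), f.coeff i = 0) →
      X.squareRes a f u = 0 := by
  refine homogeneous_induction X hV (p := fun a u => ∃ J₀ : ℕ, ∀ J : ℕ, J₀ ≤ J →
    ∀ f : LaurentSeries ℂ, (∀ i < (J : ℤ), f.coeff i = 0) → X.squareRes a f u = 0)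
    (fun u => ⟨0, fun J _ => by simp⟩) (fun a => ⟨0, fun J _ => by simp⟩) ?_ ?_ ?_ a u
  · rintro a b u ⟨J₁, h1⟩ ⟨J₂, h2⟩
    refine ⟨max J₁ J₂, fun J hJ f hf => ?_⟩
    rw [map_add, LinearMap.add_apply, LinearMap.add_apply, h1 J (by omega) f hf,
      h2 J (by omega) f hf, add_zero]
  · rintro a u v ⟨J₁, h1⟩ ⟨J₂, h2⟩
    refine ⟨max J₁ J₂, fun J hJ f hf => ?_⟩
    rw [map_add, h1 J (by omega) f hf, h2 J (by omega) f hf, add_zero]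
  · intro h μ a u ha hu
    obtain ⟨T, hT⟩ := mode_truncation X.Y a u
    refine ⟨T.toNat, fun J hJ f hf => ?_⟩
    rw [X.squareRes_of_mem ha]
    refine resMode_eq_zero X.Y hT fun i hi => ?_
    exact laurentSeries_coeff_mul_eq_zero (B := 0) hf
      (fun i hi => onePlus_zpow_coeff_neg _ hi) i (by omega)

/-- The trace of `o(a[-2] u)` is a combination of the traces of `o(a[m] u)`, `m ≥ 1`, with
coefficients that converge in the unit disc. -/
theorem IntertwiningOperator.traceSeries_logSeries_neg_two_mem (I : IntertwiningOperator XU XW XW)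
    (hV : ∀ n : ℤ, n < 0 → weightSpace 𝒱.Y 𝒱.omega (n : ℂ) = ⊥) {s : ℂ} (hs : XW.IsLowerBound s)
    (a : V) (u : U) {P : Submodule discSeries (PowerSeries ℂ)}
    (hP : ∀ m : ℕ, 1 ≤ m → I.traceSeries s (XU.squareRes a (logSeries ^ (m : ℤ)) u) ∈ P) :
    I.traceSeries s (XU.squareRes a (logSeries ^ (-2 : ℤ)) u) ∈ P := by
  let φ : LaurentSeries ℂ →ₗ[ℂ] PowerSeries ℂ :=
    I.traceSeries s ∘ₗ LinearMap.applyₗ u ∘ₗ XU.squareRes a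
  obtain ⟨J₁, h1⟩ := XU.exists_squareRes_truncation hV a u
  obtain ⟨J₂, h2⟩ := I.traceSeries_squareRes_neg_two hV hs a u
  have hlog : ∀ m : ℕ, φ (logSeries ^ (m : ℤ)) ∈ P.restrictScalars ℂ := by
    intro m
    rcases Nat.eq_zero_or_pos m with rfl | hm
    · have : φ (logSeries ^ ((0 : ℕ) : ℤ)) = 0 := by
        simpa [φ] using I.traceSeries_squareRes_one hV hs a u
      rw [this]
      exact zero_mem _
    · exact hP m hm
  have hpow : ∀ f : LaurentSeries ℂ, (∀ i < 0, f.coeff i = 0) → φ f ∈ P.restrictScalars ℂ :=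
    mem_of_logSeries_pow_mem (J := J₁) (fun f hf => by
      simp only [φ, LinearMap.comp_apply, LinearMap.applyₗ_apply_apply]
      rw [h1 J₁ le_rfl f hf, map_zero]) hlog
  have h3 : φ (onePlus * zSeries ^ (-2 : ℤ)) ∈ P.restrictScalars ℂ := by
    have e := h2 J₂ le_rfl
    change φ (onePlus * zSeries ^ (-2 : ℤ)) = _ at e
    rw [e]
    refine neg_mem (sum_mem fun j _ => ?_)
    refine discSeries_mul_mem (lambert_mem ?_) (hpow (zSeries ^ (j : ℤ)) fun i hi => ?_)
    · exact SubexpGrowth.natCast.mul ((subexpGrowth_choose j).1.add (subexpGrowth_choose j).2)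
    · rw [zSeries_zpow, HahnSeries.coeff_single_of_ne (by omega)]
  have h4 := sub_mem h3 (hpow _ fun i hi => onePlus_div_sq_sub_coeff hi)
  rwa [← map_sub, sub_sub_cancel] at h4

lemma VOAModule.squareRes_mem_eigenspace (X : VOAModule 𝒱 U) {a : V} {x : U} {α ν : ℂ}
    (ha : a ∈ (squareWeightOp 𝒱.Y 𝒱.omega).eigenspace α)
    (hx : x ∈ (squareWeightOp X.Y 𝒱.omega).eigenspace ν) (m : ℤ) :
    X.squareRes a (logSeries ^ m) x ∈
      (squareWeightOp X.Y 𝒱.omega).eigenspace (α + ν - m - 1) := by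
  have h := X.squareWeightOp_commutator a m x
  rw [Module.End.mem_eigenspace_iff] at ha hx ⊢
  rw [ha, hx, map_smul, map_smul, LinearMap.smul_apply, LinearMap.smul_apply,
    sub_eq_iff_eq_add] at h
  rw [h, ← sub_smul, ← add_smul]
  congr 1
  ring

/-- `C_{[2,0]}(U)` is spanned by `L[0]`-homogeneous vectors. -/
lemma VOAModule.C20_le (X : VOAModule 𝒱 U) : X.C20 ≤ Submodule.span ℂ {x : U |
    ∃ (m : ℤ) (α ν : ℂ) (a : V) (v : U), (m = -2 ∨ m = 0) ∧
      a ∈ (squareWeightOp 𝒱.Y 𝒱.omega).eigenspace α ∧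
      v ∈ (squareWeightOp X.Y 𝒱.omega).eigenspace ν ∧
      x = X.squareRes a (logSeries ^ m) v} := by
  set D := Submodule.span ℂ {x : U |
    ∃ (m : ℤ) (α ν : ℂ) (a : V) (v : U), (m = -2 ∨ m = 0) ∧
      a ∈ (squareWeightOp 𝒱.Y 𝒱.omega).eigenspace α ∧
      v ∈ (squareWeightOp X.Y 𝒱.omega).eigenspace ν ∧
      x = X.squareRes a (logSeries ^ m) v} with hD
  have key : ∀ m : ℤ, (m = -2 ∨ m = 0) → ∀ (a : V) (u : U),
      X.squareRes a (logSeries ^ m) u ∈ D := by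
    intro m hm a u
    have ha : a ∈ ⨆ α : ℂ, (squareWeightOp 𝒱.Y 𝒱.omega).eigenspace α := by
      rw [𝒱.iSup_eigenspace_squareWeightOp]; trivial
    have hu : u ∈ ⨆ (ν : ℂ) (_ : weightSpace X.Y 𝒱.omega ν ≠ ⊥),
        (squareWeightOp X.Y 𝒱.omega).eigenspace ν := by
      rw [X.iSup_eigenspace_squareWeightOp]; trivial
    have hle : ⨆ (ν : ℂ) (_ : weightSpace X.Y 𝒱.omega ν ≠ ⊥),
        (squareWeightOp X.Y 𝒱.omega).eigenspace ν ≤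
        ⨆ ν : ℂ, (squareWeightOp X.Y 𝒱.omega).eigenspace ν :=
      iSup_mono fun ν => iSup_le fun _ => le_rfl
    have hu' := hle hu
    refine Submodule.iSup_induction _
      (motive := fun a => X.squareRes a (logSeries ^ m) u ∈ D) ha (fun α a ha => ?_) ?_ ?_
    · refine Submodule.iSup_induction _
        (motive := fun u => X.squareRes a (logSeries ^ m) u ∈ D) hu' (fun ν u hu => ?_) ?_ ?_
      · exact Submodule.subset_span ⟨m, α, ν, a, u, hm, ha, hu, rfl⟩
      · rw [map_zero]; exact zero_mem _
      · intro u v h1 h2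
        rw [map_add]
        exact add_mem h1 h2
    · simp
    · intro a b h1 h2
      rw [map_add, LinearMap.add_apply, LinearMap.add_apply]
      exact add_mem h1 h2
  rw [C20, Submodule.span_le]
  rintro x ⟨a, u, rfl | rfl⟩
  · rw [X.squareMode_eq]; exact key _ (Or.inl rfl) a u
  · rw [X.squareMode_eq]; exact key _ (Or.inr rfl) a u

/-- Under condition `C_{[2,0]}`, finitely many trace functions generate all of them over the
convergent power series. -/
theorem IntertwiningOperator.exists_finite_generators (I : IntertwiningOperator XU XW XW)
    (hV : ∀ n : ℤ, n < 0 → weightSpace 𝒱.Y 𝒱.omega (n : ℂ) = ⊥) (hC : XU.SatisfiesC20)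
    {s : ℂ} (hs : XW.IsLowerBound s) :
    ∃ T : Set U, T.Finite ∧
      ∀ u, I.traceSeries s u ∈ Submodule.span discSeries (I.traceSeries s '' T) := by
  set E : ℂ → Submodule ℂ U := fun ν => (squareWeightOp XU.Y 𝒱.omega).eigenspace ν with hE
  have htop : ⨆ ν, E ν = ⊤ := by
    rw [eq_top_iff, ← XU.iSup_eigenspace_squareWeightOp]
    exact iSup_mono fun ν => iSup_le fun _ => le_rfl
  have hint : DirectSum.IsInternal E :=
    DirectSum.isInternal_submodule_of_iSupIndep_of_iSup_eq_top
      (Module.End.eigenspaces_iSupIndep _) htop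
  -- The images of the `L[0]`-eigenvectors span the finite-dimensional quotient, so finitely many of
  -- them already do; these are lifted to homogeneous vectors.
  obtain ⟨T, hTE, hTfin, hT⟩ : ∃ T : Set U, (∀ t ∈ T, ∃ ν, t ∈ E ν) ∧ T.Finite ∧
      Submodule.span ℂ T ⊔ XU.C20 = ⊤ := by
    have h1 : Submodule.span ℂ (XU.C20.mkQ '' (⋃ ν, (E ν : Set U))) = ⊤ := by
      rw [Submodule.span_image, ← Submodule.iSup_eq_span, htop, Submodule.map_top,
        Submodule.range_mkQ]
    have h2 : (⊤ : Submodule ℂ (U ⧸ XU.C20)).FG := by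
      have : FiniteDimensional ℂ (U ⧸ XU.C20) := hC
      exact Module.Finite.fg_top
    rw [← h1] at h2
    obtain ⟨S, hS, hSspan⟩ := Submodule.fg_span_iff_fg_span_finset_subset _ |>.1 h2
    obtain ⟨T, hT, hTS⟩ := (Set.exists_subset_image_finite_and (p := fun S =>
      Submodule.span ℂ (XU.C20.mkQ '' (⋃ ν, (E ν : Set U))) = Submodule.span ℂ S)).1
      ⟨(S : Set (U ⧸ XU.C20)), hS, S.finite_toSet, hSspan⟩
    refine ⟨T, fun t ht => by simpa using hT ht, hTS.1, ?_⟩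
    have h3 := hTS.2
    rw [h1, Submodule.span_image] at h3
    have h4 := congrArg (Submodule.comap XU.C20.mkQ) h3
    rwa [Submodule.comap_top, Submodule.comap_map_mkQ, sup_comm, eq_comm] at h4
  refine ⟨T, hTfin, ?_⟩
  set P := Submodule.span discSeries (I.traceSeries s '' T) with hP
  -- Induction on the number of steps below `μ` after which the eigenspaces vanish, a discrete
  -- substitute for induction on the complex weight.
  have main : ∀ (N : ℕ) (μ : ℂ), (∀ n : ℕ, N ≤ n → E (μ - n) = ⊥) → ∀ u ∈ E μ,
      I.traceSeries s u ∈ P := by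
    intro N
    induction N with
    | zero =>
      intro μ hμ u hu
      have := hμ 0 le_rfl
      rw [Nat.cast_zero, sub_zero] at this
      rw [this, Submodule.mem_bot] at hu
      rw [hu, map_zero]
      exact zero_mem _
    | succ N ih =>
      intro μ hμ u hu
      -- Projection to weight `μ` before taking the trace discards the generators of other weights
      -- in a decomposition of `u` along `T` and `C_{[2,0]}`.
      let φ : U →ₗ[ℂ] PowerSeries ℂ :=
        I.traceSeries s ∘ₗ (E μ).subtype ∘ₗ component E hint μ
      have hφ : ∀ x ∈ E μ, φ x = I.traceSeries s x := fun x hx => by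
        simp [φ, component_of_mem hint hx]
      have hφ0 : ∀ ν x, ν ≠ μ → x ∈ E ν → φ x = 0 := fun ν x hν hx => by
        simp [φ, component_of_mem_ne hint hν hx]
      have h1 : (⊤ : Submodule ℂ U) ≤ Submodule.comap φ (P.restrictScalars ℂ) := by
        rw [← hT]
        refine sup_le (Submodule.span_le.2 fun t ht => ?_)
          (XU.C20_le.trans (Submodule.span_le.2 ?_))
        · obtain ⟨ν, hν⟩ := hTE t ht
          change φ t ∈ P
          rcases eq_or_ne ν μ with rfl | hne
          · rw [hφ t hν]
            exact Submodule.subset_span ⟨t, ht, rfl⟩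
          · rw [hφ0 ν t hne hν]
            exact zero_mem _
        · rintro x ⟨m, α, ν, a, v, hm, ha, hv, rfl⟩
          change φ _ ∈ P
          have hmem := XU.squareRes_mem_eigenspace ha hv
          rcases eq_or_ne (α + ν - m - 1) μ with heq | hne
          · rw [hφ _ (heq ▸ hmem m)]
            rcases hm with rfl | rfl
            · refine I.traceSeries_logSeries_neg_two_mem hV hs a v fun k hk => ?_
              refine ih _ (fun n hn => ?_) _ (hmem k)
              -- The vector `a[k] v` lies `k + 2` steps below `a[-2] v`, whose weight is `μ`.
              have := hμ (k + 2 + n) (by omega)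
              rw [← heq] at this
              convert this using 2
              push_cast
              ring
            · rw [zpow_zero, I.traceSeries_squareRes_one hV hs]
              exact zero_mem _
          · rw [hφ0 _ _ hne (hmem m)]
            exact zero_mem _
      rw [← hφ u hu]
      exact h1 (Submodule.mem_top (x := u))
  have hall : (⊤ : Submodule ℂ U) ≤ Submodule.comap (I.traceSeries s) (P.restrictScalars ℂ) := by
    rw [← htop]
    refine iSup_le fun μ u hu => ?_
    obtain ⟨N, hN⟩ := XU.bounded_below μ
    exact main N μ (fun n hn => XU.eigenspace_squareWeightOp_eq_bot (hN n hn)) u hu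
  exact fun u => hall (Submodule.mem_top (x := u))

/-- Under condition `C_{[2,0]}`, the trace functions converge in the unit disc. -/
theorem IntertwiningOperator.traceSeries_mem_discSeries (I : IntertwiningOperator XU XW XW)
    (hV : ∀ n : ℤ, n < 0 → weightSpace 𝒱.Y 𝒱.omega (n : ℂ) = ⊥) (hC : XU.SatisfiesC20)
    {s : ℂ} (hs : XW.IsLowerBound s) (u : U) : I.traceSeries s u ∈ discSeries := by
  obtain ⟨T, hT, hspan⟩ := I.exists_finite_generators hV hC hs
  refine span_le_discSeries (hT.image (I.traceSeries s)) s ?_ (hspan u)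
  rintro _ ⟨t, _, rfl⟩
  refine (Submodule.span_le.2 ?_) (I.eulerOp_traceSeries_mem hs t)
  rintro _ ⟨v, rfl⟩
  exact hspan v

end FiniteGeneration

/-! ### Invariant subspaces as modules, and the weights of irreducible modules. -/

section Submodules

variable {V M : Type*} [AddCommGroup V] [Module ℂ V] [AddCommGroup M] [Module ℂ M] {𝒱 : VOA V}

/-- The components of an eigenvector decomposition lie in every invariant subspace that contains
the sum. -/
lemma mem_of_sum_eigenvectors_mem {B : Module.End ℂ M} {p : Submodule ℂ M}
    (hB : ∀ x ∈ p, B x ∈ p) (S : Finset ℂ) : ∀ m : ℂ → M, (∀ μ, m μ ∈ B.eigenspace μ) →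
      ∑ μ ∈ S, m μ ∈ p → ∀ μ ∈ S, m μ ∈ p := by
  classical
  induction S using Finset.induction_on with
  | empty => simp
  | insert ν S hν ih =>
    intro m hm hsum
    -- Applying `B - ν` kills the component at `ν` and rescales the others by nonzero factors.
    have h1 : ∑ μ ∈ S, (μ - ν) • m μ ∈ p := by
      have h2 := p.sub_mem (hB _ hsum) (p.smul_mem ν hsum)
      rw [map_sum, Finset.smul_sum, ← Finset.sum_sub_distrib, Finset.sum_insert hν] at h2
      simp only [fun μ => Module.End.mem_eigenspace_iff.1 (hm μ), ← sub_smul, sub_self,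
        zero_add] at h2
      exact h2
    have h3 : ∀ μ ∈ S, m μ ∈ p := by
      intro μ hμ
      have h4 := ih (fun μ => (μ - ν) • m μ) (fun μ => Submodule.smul_mem _ _ (hm μ)) h1 μ hμ
      have h5 : μ - ν ≠ 0 := sub_ne_zero.2 (by rintro rfl; exact hν hμ)
      exact (Submodule.smul_mem_iff _ h5).1 h4
    intro μ hμ
    rcases Finset.mem_insert.1 hμ with rfl | hμ
    · rw [Finset.sum_insert hν] at hsum
      exact (Submodule.add_mem_iff_left _ (sum_mem h3)).1 hsum
    · exact h3 μ hμ

variable (X : VOAModule 𝒱 M) {N : Submodule ℂ M}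

lemma VOAModule.bddBelow_support_restrict (hN : X.IsInvariant N) (v : V) (x : N) :
    BddBelow (Function.support fun n : ℤ =>
      ((mode X.Y v (-n - 1)).restrict fun x hx => hN v _ x hx : Module.End ℂ N) x) := by
  obtain ⟨T, hT⟩ := mode_truncation X.Y v (x : M)
  refine ⟨-T, fun n hn => ?_⟩
  by_contra hlt
  apply hn
  ext
  exact hT _ (by omega)

/-- The vertex operators on an invariant subspace. -/
noncomputable def VOAModule.subY (hN : X.IsInvariant N) : V →ₗ[ℂ] VertexOperator ℂ N where
  toFun v := VertexOperator.of_coeff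
    (fun n => (mode X.Y v (-n - 1)).restrict fun x hx => hN v _ x hx)
    (X.bddBelow_support_restrict hN v)
  map_add' v w := by
    refine HVertexOperator.coeff_inj ?_
    funext n
    ext x
    simp [mode]
  map_smul' c v := by
    refine HVertexOperator.coeff_inj ?_
    funext n
    ext x
    simp [mode]

lemma VOAModule.coe_mode_subY (hN : X.IsInvariant N) (v : V) (n : ℤ) (x : N) :
    (mode (X.subY hN) v n x : M) = mode X.Y v n x := by
  have : mode (X.subY hN) v n = (mode X.Y v (-(-n - 1) - 1)).restrict fun x hx => hN v _ x hx :=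
    VertexOperator.ncoeff_of_coeff _ (X.bddBelow_support_restrict hN v) n
  rw [this]
  have e : -(-n - 1) - 1 = n := by ring
  rw [LinearMap.coe_restrict_apply, e]

lemma VOAModule.mem_weightSpace_subY (hN : X.IsInvariant N) (μ : ℂ) (x : N) :
    x ∈ weightSpace (X.subY hN) 𝒱.omega μ ↔ (x : M) ∈ weightSpace X.Y 𝒱.omega μ := by
  rw [mem_weightSpace, mem_weightSpace, ← Subtype.coe_inj, vir, X.coe_mode_subY]
  rfl

/-- An invariant subspace is a module. -/
noncomputable def VOAModule.sub (hN : X.IsInvariant N) : VOAModule 𝒱 N where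
  Y := X.subY hN
  vacuum n := by
    ext x
    rw [X.coe_mode_subY, X.vacuum]
    split_ifs <;> rfl
  virasoro m n := by
    ext x
    have := LinearMap.congr_fun (X.virasoro m n) (x : M)
    by_cases hmn : m + n = 0 <;> simpa [vir, X.coe_mode_subY, hmn] using this
  derivative v n := by
    ext x
    have := LinearMap.congr_fun (X.derivative v n) (x : M)
    simpa [X.coe_mode_subY] using this
  commutativity v w := by
    obtain ⟨K, hK⟩ := X.commutativity v w
    refine ⟨K, fun m n => ?_⟩
    ext x
    have := LinearMap.congr_fun (hK m n) (x : M)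
    simpa [X.coe_mode_subY, LinearMap.sum_apply] using this
  associativity v w n r x := by
    refine Subtype.coe_injective ?_
    -- An injective map preserves supports, so it commutes with `∑ᶠ` without any finiteness
    -- argument, even for the default value.
    have h := N.subtype.toAddMonoidHom.map_finsum_of_injective Subtype.coe_injective
      (fun i : ℕ => ((-1 : ℂ) ^ i * (Ring.choose n i : ℤ)) •
        (mode (X.subY hN) v (n - i) (mode (X.subY hN) w (r + i) x)
          - ((-1 : ℂ) ^ n) • mode (X.subY hN) w (n + r - i) (mode (X.subY hN) v i x)))
    refine Eq.trans ?_ h.symm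
    dsimp only
    rw [X.coe_mode_subY, X.associativity]
    refine finsum_congr fun i => ?_
    simp [X.coe_mode_subY]
  grading := by
    refine DirectSum.isInternal_submodule_of_iSupIndep_of_iSup_eq_top
      (Module.End.eigenspaces_iSupIndep _) ?_
    rw [eq_top_iff]
    rintro ⟨x, hx⟩ -
    have h1 : x ∈ ⨆ μ : ℂ, weightSpace X.Y 𝒱.omega μ := by
      rw [X.grading.submodule_iSup_eq_top]; trivial
    obtain ⟨m, hm, rfl⟩ := (Submodule.mem_iSup_iff_exists_finsupp _ _).1 h1
    have h2 := mem_of_sum_eigenvectors_mem (B := vir X.Y 𝒱.omega 0) (p := N)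
      (fun x hx => hN _ _ x hx) m.support m hm hx
    have h3 : ∀ μ, m μ ∈ N := by
      intro μ
      by_cases h : μ ∈ m.support
      · exact h2 μ h
      · rw [Finsupp.notMem_support_iff.1 h]; exact zero_mem _
    have h4 : (⟨m.sum fun _ x => x, hx⟩ : N) = ∑ μ ∈ m.support, ⟨m μ, h3 μ⟩ := by
      ext
      simp [Finsupp.sum]
    rw [h4]
    refine sum_mem fun μ _ => Submodule.mem_iSup_of_mem μ ?_
    exact (X.mem_weightSpace_subY hN μ _).2 (hm μ)
  finite μ := by
    have := X.finite μ
    let f : weightSpace (X.subY hN) 𝒱.omega μ →ₗ[ℂ] weightSpace X.Y 𝒱.omega μ :=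
      N.subtype.restrict fun x hx => (X.mem_weightSpace_subY hN μ x).1 hx
    refine FiniteDimensional.of_injective f fun x y hxy => ?_
    have := congrArg (Subtype.val) hxy
    exact Subtype.ext (Subtype.ext this)
  bounded_below μ := by
    obtain ⟨K, hK⟩ := X.bounded_below μ
    refine ⟨K, fun n hn => ?_⟩
    rw [eq_bot_iff]
    intro x hx
    have h1 := (X.mem_weightSpace_subY hN _ x).1 hx
    rw [hK n hn, Submodule.mem_bot] at h1
    exact (Submodule.mem_bot ℂ).2 (Subtype.ext h1)

variable {X}

lemma VOAModule.IsIrreducibleSub.sub_isIrreducible (h : X.IsIrreducibleSub N) :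
    (X.sub h.1).IsIrreducible := by
  have hmode : ∀ (a : V) (n : ℤ) (x : N), (mode (X.sub h.1).Y a n x : M) = mode X.Y a n x :=
    X.coe_mode_subY h.1
  refine ⟨fun _ _ _ _ => trivial, fun h0 => h.2.1 ?_, fun N' hN' _ => ?_⟩
  · rw [eq_bot_iff]
    intro x hx
    have h1 : (⟨x, hx⟩ : N) ∈ (⊤ : Submodule ℂ N) := trivial
    rw [h0, Submodule.mem_bot] at h1
    exact (Submodule.mem_bot ℂ).2 (congrArg Subtype.val h1)
  · have h1 : X.IsInvariant (N'.map N.subtype) := by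
      rintro a n _ ⟨x, hx, rfl⟩
      exact ⟨_, hN' a n x hx, hmode a n x⟩
    rcases h.2.2 _ h1 (Submodule.map_subtype_le N N') with h2 | h2
    · exact Or.inl (Submodule.map_injective_of_injective N.injective_subtype
        (h2.trans (Submodule.map_bot _).symm))
    · right
      refine Submodule.map_injective_of_injective N.injective_subtype ?_
      rw [h2, Submodule.map_subtype_top]

/-- The weights of an irreducible module lie in one class modulo `ℤ`. -/
lemma VOAModule.IsIrreducible.exists_weights_subset (h : X.IsIrreducible) :
    ∃ κ : ℂ, ∀ μ : ℂ, weightSpace X.Y 𝒱.omega μ ≠ ⊥ → ∃ n : ℤ, μ = κ + n := by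
  obtain ⟨κ, hκ⟩ : ∃ κ, weightSpace X.Y 𝒱.omega κ ≠ ⊥ := by
    by_contra! hc
    apply h.2.1
    rw [← X.grading.submodule_iSup_eq_top]
    simp [hc]
  -- Modes of integrally graded vectors shift weights by integers, so the sum over one class is
  -- invariant; it is nonzero, hence everything.
  set P : Submodule ℂ M := ⨆ n : ℤ, weightSpace X.Y 𝒱.omega (κ + n) with hP
  have hinv : X.IsInvariant P := by
    intro a n x hx
    have ha : a ∈ ⨆ n : ℤ, weightSpace 𝒱.Y 𝒱.omega (n : ℂ) := by
      rw [𝒱.grading.submodule_iSup_eq_top]; trivial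
    refine Submodule.iSup_induction _ (motive := fun a => mode X.Y a n x ∈ P) ha
      (fun k a ha => ?_) ?_ ?_
    · refine Submodule.iSup_induction _ (motive := fun x => mode X.Y a n x ∈ P) hx
        (fun j x hx => ?_) ?_ ?_
      · refine Submodule.mem_iSup_of_mem (k + j - n - 1) ?_
        have := X.mode_mem_weightSpace ha hx n
        convert this using 2
        push_cast
        ring
      · rw [map_zero]; exact zero_mem _
      · intro x y h1 h2; rw [map_add]; exact add_mem h1 h2
    · simp [mode]
    · intro a b h1 h2
      have : mode X.Y (a + b) n x = mode X.Y a n x + mode X.Y b n x := by simp [mode]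
      rw [this]; exact add_mem h1 h2
  have hle : weightSpace X.Y 𝒱.omega κ ≤ P := by
    refine le_iSup_of_le 0 ?_
    rw [Int.cast_zero, add_zero]
  rcases h.2.2 P hinv le_top with h1 | h1
  · rw [h1, le_bot_iff] at hle
    exact absurd hle hκ
  · refine ⟨κ, fun μ hμ => ?_⟩
    by_contra! hc
    apply hμ
    have h2 := (Module.End.eigenspaces_iSupIndep (vir X.Y 𝒱.omega 0)) μ
    rw [← disjoint_self]
    refine h2.mono_right (le_top.trans ?_)
    rw [← h1]
    exact iSup_le fun n => le_iSup₂_of_le (κ + n) (hc n).symm le_rfl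

lemma VOAModule.IsIsomorphic.weightSpace_ne_bot {M' : Type*} [AddCommGroup M'] [Module ℂ M']
    {X' : VOAModule 𝒱 M'} (h : X.IsIsomorphic X') {μ : ℂ}
    (hμ : weightSpace X.Y 𝒱.omega μ ≠ ⊥) : weightSpace X'.Y 𝒱.omega μ ≠ ⊥ := by
  obtain ⟨f, hf⟩ := h
  obtain ⟨x, hx, hx0⟩ := Submodule.exists_mem_ne_zero_of_ne_bot hμ
  refine (Submodule.ne_bot_iff _).2 ⟨f x, ?_, fun h0 => hx0 (by simpa using h0)⟩
  rw [mem_weightSpace] at hx ⊢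
  rw [vir, ← hf, ← map_smul, ← hx]
  rfl

end Submodules

/-! ### Finitely many classes of weights for modules of a rational algebra. -/

section Rational

variable {V W : Type u} [AddCommGroup V] [Module ℂ V] [AddCommGroup W] [Module ℂ W] {𝒱 : VOA V}

/-- The weights of a module for a rational vertex operator algebra lie in finitely many classes
modulo `ℤ`. -/
theorem VOA.IsRational.exists_finset_weights (hrat : 𝒱.IsRational) (X : VOAModule 𝒱 W) :
    ∃ K : Finset ℂ, ∀ μ : ℂ, weightSpace X.Y 𝒱.omega μ ≠ ⊥ → ∃ κ ∈ K, ∃ n : ℤ, μ = κ + n := by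
  classical
  obtain ⟨⟨k, F, hF, hirr⟩, hcr⟩ := hrat
  choose κ hκ using fun i => (hF i).exists_weights_subset
  refine ⟨Finset.univ.image κ, fun μ hμ => ?_⟩
  by_contra! hc
  apply hμ
  obtain ⟨ι, N, hN, -, htop⟩ := hcr ⟨W, X⟩
  -- If `μ` lies in none of the finitely many classes, every irreducible summand is contained in the
  -- sum of the other weight spaces, and independence of eigenspaces forces `W_μ = 0`.
  have hle : ∀ i, N i ≤ ⨆ (ν : ℂ) (_ : ν ≠ μ), weightSpace X.Y 𝒱.omega ν := by
    intro i x hx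
    have hi : X.IsIrreducibleSub (N i) := hN i
    obtain ⟨j, hj⟩ := hirr ⟨N i, X.sub hi.1⟩ hi.sub_isIrreducible
    have h1 : (⟨x, hx⟩ : N i) ∈ ⨆ ν : ℂ, weightSpace (X.sub hi.1).Y 𝒱.omega ν := by
      rw [(X.sub hi.1).grading.submodule_iSup_eq_top]; trivial
    refine Submodule.iSup_induction _ (motive := fun y : N i =>
      (y : W) ∈ ⨆ (ν : ℂ) (_ : ν ≠ μ), weightSpace X.Y 𝒱.omega ν) h1 (fun ν y hy => ?_)
      (zero_mem _) (fun y z h2 h3 => add_mem h2 h3)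
    by_cases h0 : weightSpace (X.sub hi.1).Y 𝒱.omega ν = ⊥
    · rw [h0, Submodule.mem_bot] at hy
      rw [hy]
      exact zero_mem _
    · obtain ⟨n, hn⟩ := hκ j ν (hj.weightSpace_ne_bot h0)
      refine Submodule.mem_iSup_of_mem ν (Submodule.mem_iSup_of_mem ?_
        ((X.mem_weightSpace_subY hi.1 ν y).1 hy))
      rintro rfl
      exact hc (κ j) (Finset.mem_image_of_mem κ (Finset.mem_univ j)) n hn
  have h2 := (Module.End.eigenspaces_iSupIndep (vir X.Y 𝒱.omega 0)) μ
  rw [← disjoint_self]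
  refine h2.mono_right (le_top.trans ?_)
  have htop' : ⨆ i, N i = (⊤ : Submodule ℂ W) := htop
  rw [← htop']
  exact iSup_le hle

end Rational

/-! ### Assembly of the trace function from the classes of weights modulo `ℤ`. -/

section Trace

variable {V U W : Type*} [AddCommGroup V] [Module ℂ V] [AddCommGroup U] [Module ℂ U]
  [AddCommGroup W] [Module ℂ W] {𝒱 : VOA V} {XU : VOAModule 𝒱 U} {XW : VOAModule 𝒱 W}

lemma VOAModule.exists_isLowerBound (X : VOAModule 𝒱 W) (κ : ℂ) :
    ∃ N : ℕ, X.IsLowerBound (κ - N) := by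
  obtain ⟨N, hN⟩ := X.bounded_below κ
  refine ⟨N, fun n hn => ?_⟩
  rw [← hN (N + n.natAbs) (Nat.le_add_right _ _)]
  congr 1
  have : (n : ℂ) = -(n.natAbs : ℂ) := by
    rw [← Int.cast_natCast, ← Int.cast_neg]
    congr 1
    omega
  rw [this]
  push_cast
  ring

/-- Lower bounds for the weights in finitely many classes modulo `ℤ`, one for each class. -/
lemma VOAModule.exists_finset_isLowerBound (X : VOAModule 𝒱 W) (K : Finset ℂ) :
    ∃ S : Finset ℂ, (∀ s ∈ S, X.IsLowerBound s) ∧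
      (∀ s ∈ S, ∀ t ∈ S, ∀ n : ℤ, s = t + n → s = t) ∧
      ∀ κ ∈ K, ∃ s ∈ S, ∃ n : ℤ, κ = s + n := by
  classical
  induction K using Finset.induction_on with
  | empty => exact ⟨∅, by simp, by simp, by simp⟩
  | insert κ K _ ih =>
    obtain ⟨S, h1, h2, h3⟩ := ih
    by_cases hκ : ∃ s ∈ S, ∃ n : ℤ, κ = s + n
    · exact ⟨S, h1, h2, Finset.forall_mem_insert _ _ _ |>.2 ⟨hκ, h3⟩⟩
    push Not at hκ
    obtain ⟨N, hN⟩ := X.exists_isLowerBound κ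
    refine ⟨insert (κ - N) S, Finset.forall_mem_insert _ _ _ |>.2 ⟨hN, h1⟩, ?_, ?_⟩
    · intro s hs t ht n hst
      rcases Finset.mem_insert.1 hs with rfl | hs <;> rcases Finset.mem_insert.1 ht with rfl | ht
      · rfl
      · refine absurd ?_ (hκ t ht (n + N))
        push_cast
        linear_combination hst
      · refine absurd ?_ (hκ s hs (N - n))
        push_cast
        linear_combination -hst
      · exact h2 s hs t ht n hst
    · refine Finset.forall_mem_insert _ _ _ |>.2
        ⟨⟨_, Finset.mem_insert_self _ _, N, by push_cast; ring⟩, fun κ' h => ?_⟩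
      obtain ⟨s, hs, n, hn⟩ := h3 κ' h
      exact ⟨s, Finset.mem_insert_of_mem hs, n, hn⟩

variable (I : IntertwiningOperator XU XW XW)

lemma IntertwiningOperator.weightTrace_eq_blockTrace (u : U) (μ : ℂ) :
    I.weightTrace u μ = blockTrace XW μ (I.zeroModeHom u) := by
  rw [weightTrace, I.zeroMode_eq]
  rfl

lemma IntertwiningOperator.traceTerm_eq_zero {u : U} {τ μ : ℂ}
    (h : weightSpace XW.Y 𝒱.omega μ = ⊥) : I.traceTerm u τ μ = 0 := by
  rw [traceTerm, I.weightTrace_eq_blockTrace, blockTrace_eq_zero, zero_mul]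
  intro x hx
  rw [h, Submodule.mem_bot] at hx
  rw [hx, map_zero]

lemma IntertwiningOperator.traceTerm_add_natCast (u : U) (τ s : ℂ) (n : ℕ) :
    I.traceTerm u τ (s + n) = Complex.exp (2 * Real.pi * Complex.I * (s - 𝒱.c / 24) * τ) *
      (PowerSeries.coeff n (I.traceSeries s u) *
        Complex.exp (2 * Real.pi * Complex.I * τ) ^ n) := by
  rw [traceTerm, I.weightTrace_eq_blockTrace, I.coeff_traceSeries, ← Complex.exp_nat_mul,
    mul_left_comm, ← Complex.exp_add]
  congr 2
  ring

lemma norm_exp_two_pi_I_mul_lt_one {τ : ℂ} (h : 0 < τ.im) :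
    ‖Complex.exp (2 * Real.pi * Complex.I * τ)‖ < 1 := by
  rw [Complex.norm_exp, Real.exp_lt_one_iff]
  simp
  positivity

/-- The part of the trace function coming from the weights `s, s + 1, s + 2, …`. -/
noncomputable def IntertwiningOperator.cosetTrace (u : U) (s τ : ℂ) : ℂ :=
  Complex.exp (2 * Real.pi * Complex.I * (s - 𝒱.c / 24) * τ) *
    ∑' n : ℕ, PowerSeries.coeff n (I.traceSeries s u) *
      Complex.exp (2 * Real.pi * Complex.I * τ) ^ n

variable {I} {u : U} {s : ℂ}

lemma IntertwiningOperator.differentiableOn_cosetTrace (h : I.traceSeries s u ∈ discSeries) :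
    DifferentiableOn ℂ (I.cosetTrace u s) {τ : ℂ | 0 < τ.im} := by
  refine DifferentiableOn.mul (by fun_prop) ?_
  exact (differentiableOn_discSeries h).comp
    (f := fun τ : ℂ => Complex.exp (2 * Real.pi * Complex.I * τ)) (by fun_prop)
    fun τ hτ => mem_ball_zero_iff.2 (norm_exp_two_pi_I_mul_lt_one hτ)

/-- The sum runs over all complex weights, so the contribution of one class is cut out by an
indicator and transported along the injection `n ↦ s + n`. -/
lemma IntertwiningOperator.hasSum_indicator_traceTerm (h : I.traceSeries s u ∈ discSeries) {τ : ℂ}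
    (hτ : 0 < τ.im) : HasSum (Set.indicator (Set.range fun n : ℕ => s + n) (I.traceTerm u τ))
      (I.cosetTrace u s τ) := by
  have hinj : Function.Injective fun n : ℕ => s + (n : ℂ) :=
    (add_right_injective s).comp Nat.cast_injective
  refine (hinj.hasSum_iff fun μ hμ => Set.indicator_of_notMem hμ _).1 ?_
  have h1 : Summable fun n : ℕ => PowerSeries.coeff n (I.traceSeries s u) *
      Complex.exp (2 * Real.pi * Complex.I * τ) ^ n := by
    refine Summable.of_norm ?_
    simpa only [norm_mul, norm_pow] using
      summable_discSeries h (norm_nonneg _) (norm_exp_two_pi_I_mul_lt_one hτ)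
  refine (h1.hasSum.mul_left
    (Complex.exp (2 * Real.pi * Complex.I * (s - 𝒱.c / 24) * τ))).congr_fun fun n => ?_
  rw [Function.comp_apply, Set.indicator_of_mem (Set.mem_range_self n), I.traceTerm_add_natCast]

/-- If the weights of `W` lie in finitely many classes modulo `ℤ`, then the trace function is a
finite sum of contributions of these classes. -/
theorem IntertwiningOperator.exists_hasSum_traceTerm {K : Finset ℂ}
    (hK : ∀ μ : ℂ, weightSpace XW.Y 𝒱.omega μ ≠ ⊥ → ∃ κ ∈ K, ∃ n : ℤ, μ = κ + n)
    (h : ∀ s, XW.IsLowerBound s → I.traceSeries s u ∈ discSeries) :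
    ∃ S : Finset ℂ, (∀ s ∈ S, XW.IsLowerBound s) ∧ ∀ τ : ℂ, 0 < τ.im →
      HasSum (I.traceTerm u τ) (∑ s ∈ S, I.cosetTrace u s τ) := by
  obtain ⟨S, h1, h2, h3⟩ := XW.exists_finset_isLowerBound K
  refine ⟨S, h1, fun τ hτ => ?_⟩
  -- It remains to see that each nonzero term is counted once: the sets `s + ℕ` with `s ∈ S` cover
  -- the weights of `W` and are disjoint, since distinct elements of `S` are incongruent modulo `ℤ`.
  convert hasSum_sum fun s hs => hasSum_indicator_traceTerm (h s (h1 s hs)) hτ using 1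
  funext μ
  by_cases hμ : weightSpace XW.Y 𝒱.omega μ = ⊥
  · rw [I.traceTerm_eq_zero hμ]
    refine (Finset.sum_eq_zero fun s _ => ?_).symm
    exact Set.indicator_apply_eq_zero.2 fun _ => I.traceTerm_eq_zero hμ
  obtain ⟨κ, hκ, m, rfl⟩ := hK μ hμ
  obtain ⟨s, hs, n, rfl⟩ := h3 κ hκ
  have hn : 0 ≤ n + m := by
    by_contra! hlt
    apply hμ
    have := h1 s hs _ hlt
    rwa [Int.cast_add, ← add_assoc] at this
  have e : s + ((n + m).toNat : ℂ) = s + n + m := by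
    rw [← Int.cast_natCast, Int.toNat_of_nonneg hn, Int.cast_add, add_assoc]
  rw [Finset.sum_eq_single_of_mem s hs, Set.indicator_of_mem (Set.mem_range.2 ⟨(n + m).toNat, e⟩)]
  intro t ht hts
  refine Set.indicator_of_notMem ?_ _
  rintro ⟨k, hk⟩
  refine hts (h2 t ht s hs (n + m - k) ?_)
  push_cast
  linear_combination hk

end Trace

end Vertex

theorem theorem4p7 {V U W : Type u} [AddCommGroup V] [Module ℂ V] [AddCommGroup U] [Module ℂ U]
    [AddCommGroup W] [Module ℂ W] (𝒱 : Vertex.VOA V)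
    (hV : ∀ n : ℤ, n < 0 → Vertex.weightSpace 𝒱.Y 𝒱.omega (n : ℂ) = ⊥)
    (hrat : 𝒱.IsRational)
    (XU : Vertex.VOAModule 𝒱 U) (hU : XU.IsIrreducible) (hspan : XU.IsSpannedByDescendants)
    (hC : XU.SatisfiesC20)
    (XW : Vertex.VOAModule 𝒱 W) (I : Vertex.IntertwiningOperator XU XW XW) (u : U) :
    (∀ τ : ℂ, 0 < τ.im → Summable (fun μ : ℂ => I.traceTerm u τ μ)) ∧
      DifferentiableOn ℂ (fun τ : ℂ => I.traceFunction u τ) {τ : ℂ | 0 < τ.im} := by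
  obtain ⟨K, hK⟩ := hrat.exists_finset_weights XW
  have hdisc : ∀ s, XW.IsLowerBound s → I.traceSeries s u ∈ Vertex.discSeries :=
    fun s hs => I.traceSeries_mem_discSeries hV hC hs u
  obtain ⟨S, hS, hsum⟩ := Vertex.IntertwiningOperator.exists_hasSum_traceTerm hK hdisc
  refine ⟨fun τ hτ => (hsum τ hτ).summable, ?_⟩
  refine DifferentiableOn.congr (f := fun τ => ∑ s ∈ S, I.cosetTrace u s τ) ?_
    fun τ hτ => (hsum τ hτ).tsum_eq
  exact DifferentiableOn.fun_sum fun s hs =>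
    Vertex.IntertwiningOperator.differentiableOn_cosetTrace (hdisc s (hS s hs))
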